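/- Let $d\ge 1$, let $\xi_1,\dots,\xi_d$ be the complex $d$-th roots of unity, and let $S\subset\{1,\dots,d\}$ be non-empty. Let $k=\mathbb{C}(\sqrt q,z)$ with $\sqrt q,z$ indeterminates, put $\lambda_S=\frac{z+(1-q)/|S|}{qz}$, let $k_S=k(\sqrt{\lambda_S})$, and set $$D_S=\frac{1}{\sqrt{\lambda_S}\,z},\qquad u=\sqrt q\sqrt{\lambda_S},\qquad v=(q-1)\sqrt{\lambda_S},\qquad c_b=\frac1{|S|}\sum_{a\in S}\xi_a^b\quad(0\le b\le d-1).$$ *Algebras.* $Y_{d,n}$ is the $k_S$-algebra generated by $g_1,\dots,g_{n-1},t_1,\dots,t_n$ with relations $g_ig_j=g_jg_i$ ($|i-j|>1$), $g_ig_{i+1}g_i=g_{i+1}g_ig_{i+1}$, $t_it_j=t_jt_i$, $g_it_j=t_{s_i(j)}g_i$, $t_j^d=1$, $g_i^2=u^2+v\,e_ig_i$, where $s_i=(i,i+1)$ and $e_i=\frac1d\sum_{0\le s\le d-1}t_i^st_{i+1}^{-s}$. $\widetilde Y_{d,n}$ is generated by $G_1,\dots,G_{n-1},t_1,\dots,t_n$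 with the same relations, except that the last one is $G_i^2=1+(q-1)e_i+(q-1)e_iG_i$. $\mathcal H_n$ is the $k_S$-algebra generated by $T_1,\dots,T_{n-1}$ with the braid relations and $T_i^2=u^2+vT_i$ (and $\mathcal H_0=k_S$). The algebra with index $n$ is mapped to the one with index $n+1$ by sending each generator to the generator of the same name. *Juyumaya's trace.* $\operatorname{tr}_S$ is the linear form on the chain $\{\widetilde Y_{d,n}\}$ with $\operatorname{tr}(1)=1$, $\operatorname{tr}(xy)=\operatorname{tr}(yx)$, $\operatorname{tr}(xG_n)=z\operatorname{tr}(x)$ for $n\ge1$, $x\in\widetilde Y_{d,n}$, and $\operatorname{tr}(xt_{n+1}^b)=c_b\operatorname{tr}(x)$ for $n\ge0$, $x\in\widetilde Y_{d,n}$, $0\le b\le d-1$. *Markov traces.* A Markov trace on $\{Y_{d,n}\}_{n\ge1}$ is a family of linear forms $\rho_n:Y_{d,n}\to k_S$ with $\rho_n(xy)=\rho_n(yx)$ and $\rho_{n+1}(xg_n)=\rho_{n+1}(xg_n^{-1})=\rho_n(x)$ for $x\in Y_{d,n}$, $n\ge 1$. Let $\{\tau_n\}$ be the family of linear forms on $\{\mathcal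 H_n\}$ defined by the same conditions, with $T_n$ in place of $g_n$, and $\tau_1(1)=1$; let $\tau_0$ be the identity. *Parameters.* Let $\operatorname{Comp}_d(n)$ be the set of $d$-tuples $\mu$ of non-negative integers of sum $|\mu|=n$, let $[\mu]$ be obtained from $\mu$ by replacing every non-zero part by $1$, and let $\operatorname{Comp}^0_d$ be the set of non-zero tuples in $\{0,1\}^d$. For $\mu\in\operatorname{Comp}_d(n)$ let $\mathcal O(\mu)$ be the set of characters $\chi$ of $(\mathbb Z/d\mathbb Z)^n$ such that $\chi(t_j)=\xi_a$ for exactly $\mu_a$ indices $j$, for each $a$. Put $$E_\chi=\prod_{i}\Bigl(\frac1d\sum_{0\le s\le d-1}\chi(t_i)^st_i^{-s}\Bigr),\quad E_\mu=\sum_{\chi\in\mathcal O(\mu)}E_\chi,\quad \mathcal H^\mu=\mathcal H_{\mu_1}\otimes\dots\otimes\mathcal H_{\mu_d}.$$ For a permutation $w$ with reduced expression $s_{i_1}\cdots s_{i_r}$ put $\widetilde g_w=u^{-r}g_{i_1}\cdots g_{i_r}$ and $\widetilde T_w=u^{-r}T_{i_1}\cdots T_{i_r}$, and for $(w_1,\dots,w_d)\in\mathfrak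 S_{\mu_1}\times\dots\times\mathfrak S_{\mu_d}$ put $\widetilde T_{(w_1,\dots,w_d)}=\widetilde T_{w_1}\otimes\dots\otimes\widetilde T_{w_d}$. Let $\Psi_\mu:E_\mu Y_{d,n}\to\operatorname{Mat}_{\mathcal O(\mu)}(\mathcal H^\mu)$ be the linear map sending $E_\chi\widetilde g_w$ ($\chi\in\mathcal O(\mu)$, $w\in\mathfrak S_n$) to the matrix whose only non-zero entry is $\widetilde T_{\pi_\chi^{-1}w\pi_{\chi'}}$ in position $(\chi,\chi')$, where $\chi'=w^{-1}(\chi)$ and $\pi_\chi$ is the permutation of minimal length that maps to $\chi$ the character with values $\xi_1$ ($\mu_1$ times), …, $\xi_d$ ($\mu_d$ times) in this order; here $\pi_\chi^{-1}w\pi_{\chi'}$ lies in the Young subgroup $\mathfrak S_{\mu_1}\times\dots\times\mathfrak S_{\mu_d}$. A family $\{\rho_n\}_{n\ge1}$ *has parameters* $(\alpha_{\mu^0})_{\mu^0\in\operatorname{Comp}^0_d}\subset k_S$ if, for all $n\ge1$ and $x\in Y_{d,n}$, $$\rho_n(x)=\sum_{\mu\in\operatorname{Comp}_d(n)}\alpha_{[\mu]}\,(\tau_{\mu_1}\otimes\dots\otimes\tau_{\mu_d})\bigl(\operatorname{Tr}\Psi_\mu(E_\mu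 x)\bigr).$$ **Proposition.** The formulas $g_i\mapsto\sqrt{\lambda_S}\bigl(\sqrt q+(1-\sqrt q)e_i\bigr)G_i$, $t_j\mapsto t_j$ define isomorphisms $Y_{d,n}\cong\widetilde Y_{d,n}$; the trace $\operatorname{tr}_S$ exists and is unique; and, seen on $Y_{d,n}$ through these isomorphisms, the maps $\widetilde\rho_{S,n}=D_S^{\,n-1}\operatorname{tr}_S$ form a Markov trace on $\{Y_{d,n}\}_{n\ge1}$. It has parameters, they are unique, and they are $$\alpha_{\mu^0}=\begin{cases}0&\text{if }\mu^0_a>0\text{ for some }a\notin S,\\[2pt] \dfrac{D_S^{|\mu^0|-1}}{|S|^{|\mu^0|}}&\text{otherwise.}\end{cases}$$ Consequently, if $\{\rho_{\mu^0,n}\}_{n\ge1}$ denotes the Markov trace whose parameter at $\mu^0$ is $1$ and whose other parameters are $0$, then $\widetilde\rho_{S,n}=\sum_{\mu^0\in\operatorname{Comp}_d^0}\alpha_{\mu^0}\,\rho_{\mu^0,n}$ for all $n\ge 1$; and for every $n\ge1$ and every element $\beta$ of the $\mathbb Z/d\mathbb Z$-framed braid group on $n$ strands (generators $\sigma_i,t_j$;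 relations those above, with $\sigma_i$ for $g_i$, other than the quadratic one), $$D_S^{\,n-1}\operatorname{tr}_S\bigl(\widetilde\delta_n(\beta)\bigr)=\sum_{\mu^0\in\operatorname{Comp}^0_d}\alpha_{\mu^0}\,\rho_{\mu^0,n}\bigl(\delta_n(\beta)\bigr),$$ where $\widetilde\delta_n,\delta_n$ are the multiplicative maps to $\widetilde Y_{d,n}$ and $Y_{d,n}$ with $\widetilde\delta_n(\sigma_i)=\sqrt{\lambda_S}\,G_i$, $\delta_n(\sigma_i)=\bigl(\gamma+(1-\gamma)e_i\bigr)g_i$ for $\gamma=\sqrt q^{\,-1}$, and $\widetilde\delta_n(t_j)=\delta_n(t_j)=t_j$. The left-hand side is the value of the Juyumaya–Lambropoulou invariant attached to $S$ on the framed link obtained by closing $\beta$. -/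

import Mathlib

open scoped TensorProduct BigOperators

noncomputable section

namespace JL

/-! ### Generators, simple transpositions, reduced words

All indices are shifted by one: the generators `g_1, …, g_{n-1}` are indexed by `Fin (n - 1)`, the
generators `t_1, …, t_n` by `Fin n`, and the `d` parts of a composition by `Fin d`. -/

/-- Names of the generators `g_i` (also used for `G_i`, `σ_i`) and `t_j` on `n` strands. -/
inductive Gen (n : ℕ) : Type
  | g (i : Fin (n - 1)) : Gen n
  | t (j : Fin n) : Gen n

/-- The left strand of the `i`-th crossing. -/
def lft {n : ℕ} (i : Fin (n - 1)) : Fin n := ⟨i, by omega⟩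

/-- The right strand of the `i`-th crossing. -/
def rgt {n : ℕ} (i : Fin (n - 1)) : Fin n := ⟨i + 1, by omega⟩

/-- The simple transposition `s_i = (i, i + 1)`. -/
def simpleT {n : ℕ} (i : Fin (n - 1)) : Equiv.Perm (Fin n) := Equiv.swap (lft i) (rgt i)

/-- `L` is a reduced expression of `w`: its product is `w` and no shorter word has product `w`. -/
def IsReducedWord {n : ℕ} (w : Equiv.Perm (Fin n)) (L : List (Fin (n - 1))) : Prop :=
  (L.map simpleT).prod = w ∧
    ∀ L' : List (Fin (n - 1)), (L'.map simpleT).prod = w → L.length ≤ L'.length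

theorem exists_word {n : ℕ} (w : Equiv.Perm (Fin n)) :
    ∃ L : List (Fin (n - 1)), (L.map simpleT).prod = w := by
  cases n with
  | zero => exact ⟨[], Subsingleton.elim _ _⟩
  | succ m =>
    have h : w ∈ Submonoid.closure
        (Set.range fun i : Fin m => Equiv.swap i.castSucc i.succ) := by
      rw [Equiv.Perm.mclosure_swap_castSucc_succ]; trivial
    induction h using Submonoid.closure_induction with
    | mem x hx =>
      obtain ⟨i, rfl⟩ := hx
      exact ⟨[i], by simp [simpleT]; rfl⟩
    | one => exact ⟨[], rfl⟩
    | mul x y _ _ hx hy =>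
      obtain ⟨L, rfl⟩ := hx
      obtain ⟨L', rfl⟩ := hy
      exact ⟨L ++ L', by simp⟩

theorem exists_isReducedWord {n : ℕ} (w : Equiv.Perm (Fin n)) :
    ∃ L : List (Fin (n - 1)), IsReducedWord w L := by
  classical
  have h : ∃ k, ∃ L : List (Fin (n - 1)), (L.map simpleT).prod = w ∧ L.length = k := by
    obtain ⟨L, hL⟩ := exists_word w
    exact ⟨_, L, hL, rfl⟩
  obtain ⟨L, hL, hk⟩ := Nat.find_spec h
  exact ⟨L, hL, fun L' hL' => hk ▸ Nat.find_min' h ⟨L', hL', rfl⟩⟩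

/-- A reduced expression of `w`. -/
def reducedWord {n : ℕ} (w : Equiv.Perm (Fin n)) : List (Fin (n - 1)) :=
  (exists_isReducedWord w).choose

/-! ### Iwahori–Hecke algebras of type `A` -/

section Hecke

variable (K : Type) [Field K] (u v : K)

/-- The defining relations of the Iwahori–Hecke algebra of type `A_{n-1}`. -/
inductive HeckeRel (n : ℕ) :
    FreeAlgebra K (Fin (n - 1)) → FreeAlgebra K (Fin (n - 1)) → Prop
  | far (i j : Fin (n - 1)) (h : (i : ℕ) + 1 < j) : HeckeRel n
      (FreeAlgebra.ι K i * FreeAlgebra.ι K j)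
      (FreeAlgebra.ι K j * FreeAlgebra.ι K i)
  | braid (i j : Fin (n - 1)) (h : (i : ℕ) + 1 = j) : HeckeRel n
      (FreeAlgebra.ι K i * FreeAlgebra.ι K j * FreeAlgebra.ι K i)
      (FreeAlgebra.ι K j * FreeAlgebra.ι K i * FreeAlgebra.ι K j)
  | quad (i : Fin (n - 1)) : HeckeRel n
      (FreeAlgebra.ι K i * FreeAlgebra.ι K i)
      (algebraMap K _ (u ^ 2) + v • FreeAlgebra.ι K i)

/-- The Iwahori–Hecke algebra `H_n` with `T_i ^ 2 = u ^ 2 + v T_i`. For `n = 0` and `n = 1` there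
are no generators and this is the ground field. -/
abbrev Hecke (n : ℕ) : Type := RingQuot (HeckeRel K u v n)

/-- The generator `T_i` of `H_n`. -/
def Hecke.T {n : ℕ} (i : Fin (n - 1)) : Hecke K u v n :=
  RingQuot.mkAlgHom K (HeckeRel K u v n) (FreeAlgebra.ι K i)

/-- The natural map `H_n → H_{n+1}`, `T_i ↦ T_i`. -/
def Hecke.incl (n : ℕ) : Hecke K u v n →ₐ[K] Hecke K u v (n + 1) :=
  RingQuot.liftAlgHom K ⟨FreeAlgebra.lift K fun i : Fin (n - 1) =>
    Hecke.T K u v (n := n + 1) (Fin.castLE (by omega) i), by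
    intro x y h
    cases h with
    | far i j h =>
      have := RingQuot.mkAlgHom_rel K (HeckeRel.far (K := K) (u := u) (v := v) (n := n + 1)
        (Fin.castLE (by omega) i) (Fin.castLE (by omega) j) h)
      simpa [Hecke.T] using this
    | braid i j h =>
      have := RingQuot.mkAlgHom_rel K (HeckeRel.braid (K := K) (u := u) (v := v) (n := n + 1)
        (Fin.castLE (by omega) i) (Fin.castLE (by omega) j) h)
      simpa [Hecke.T] using this
    | quad i =>
      have := RingQuot.mkAlgHom_rel K (HeckeRel.quad (K := K) (u := u) (v := v) (n := n + 1)
        (Fin.castLE (by omega) i))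
      simpa [Hecke.T] using this⟩

/-- The basis element `u^{-ℓ(w)} T_w` of `H_n`, where `T_w = T_{i_1} ⋯ T_{i_r}` for a reduced
expression `w = s_{i_1} ⋯ s_{i_r}`. -/
def Hecke.Tt {n : ℕ} (w : Equiv.Perm (Fin n)) : Hecke K u v n :=
  (u⁻¹ ^ (reducedWord w).length) • ((reducedWord w).map (Hecke.T K u v)).prod

/-- The normalized Markov trace `{τ_n}` on the family of Iwahori–Hecke algebras, together with the
convention that `τ_0` is the identity of the ground field. -/
structure IsNormalizedMarkovTrace (τ : ∀ n, Hecke K u v n →ₗ[K] K) : Prop where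
  trace : ∀ n (x y : Hecke K u v n), τ n (x * y) = τ n (y * x)
  markov : ∀ n (x : Hecke K u v (n + 1)),
    τ (n + 2) (Hecke.incl K u v (n + 1) x * Hecke.T K u v (n := n + 2) (Fin.last n))
      = τ (n + 1) x
  markov_inv : ∀ n (x : Hecke K u v (n + 1)),
    τ (n + 2) (Hecke.incl K u v (n + 1) x *
      Ring.inverse (Hecke.T K u v (n := n + 2) (Fin.last n))) = τ (n + 1) x
  norm : τ 1 1 = 1
  zero : τ 0 1 = 1

variable {d : ℕ}

/-- The algebra `H^μ = H_{μ_1} ⊗ ⋯ ⊗ H_{μ_d}`, identified with the subalgebra of `H_n` attached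
to the Young subgroup of the composition `μ` of `n` (only its underlying module is used). -/
abbrev HeckeComp (μ : Fin d → ℕ) : Type := ⨂[K] a, Hecke K u v (μ a)

variable {K u v}

/-- The linear form `τ_{μ_1} ⊗ ⋯ ⊗ τ_{μ_d}` on `H^μ`. -/
def tensorTrace (τ : ∀ n, Hecke K u v n →ₗ[K] K) (μ : Fin d → ℕ) : HeckeComp K u v μ →ₗ[K] K :=
  PiTensorProduct.lift
    ((MultilinearMap.mkPiAlgebra K (Fin d) K).compLinearMap fun a => τ (μ a))

end Hecke

/-! ### Yokonuma–Hecke algebras -/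

section Yokonuma

variable (K : Type) [Field K]

/-- `(1 / d) ∑_{0 ≤ s ≤ d-1} x ^ s y ^ {-s}` for elements `x`, `y` with `y ^ d = 1`, so that
`y ^ {-s} = y ^ (d - s)`. For `x = t_i`, `y = t_{i+1}` this is the element `e_i`. -/
def idem {A : Type} [Ring A] [Algebra K A] (d : ℕ) (x y : A) : A :=
  (d : K)⁻¹ • ∑ s ∈ Finset.range d, x ^ s * y ^ (d - s)

variable (d : ℕ)

/-- The relations of a Yokonuma–Hecke algebra with quadratic relation
`g_i ^ 2 = a + b e_i + c e_i g_i`. -/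
inductive YRel (a b c : K) (n : ℕ) :
    FreeAlgebra K (Gen n) → FreeAlgebra K (Gen n) → Prop
  | far (i j : Fin (n - 1)) (h : (i : ℕ) + 1 < j) : YRel a b c n
      (FreeAlgebra.ι K (Gen.g i) * FreeAlgebra.ι K (Gen.g j))
      (FreeAlgebra.ι K (Gen.g j) * FreeAlgebra.ι K (Gen.g i))
  | braid (i j : Fin (n - 1)) (h : (i : ℕ) + 1 = j) : YRel a b c n
      (FreeAlgebra.ι K (Gen.g i) * FreeAlgebra.ι K (Gen.g j) * FreeAlgebra.ι K (Gen.g i))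
      (FreeAlgebra.ι K (Gen.g j) * FreeAlgebra.ι K (Gen.g i) * FreeAlgebra.ι K (Gen.g j))
  | tt (i j : Fin n) : YRel a b c n
      (FreeAlgebra.ι K (Gen.t i) * FreeAlgebra.ι K (Gen.t j))
      (FreeAlgebra.ι K (Gen.t j) * FreeAlgebra.ι K (Gen.t i))
  | gt (i : Fin (n - 1)) (j : Fin n) : YRel a b c n
      (FreeAlgebra.ι K (Gen.g i) * FreeAlgebra.ι K (Gen.t j))
      (FreeAlgebra.ι K (Gen.t (simpleT i j)) * FreeAlgebra.ι K (Gen.g i))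
  | tpow (j : Fin n) : YRel a b c n (FreeAlgebra.ι K (Gen.t j) ^ d) 1
  | quad (i : Fin (n - 1)) : YRel a b c n
      (FreeAlgebra.ι K (Gen.g i) * FreeAlgebra.ι K (Gen.g i))
      (algebraMap K _ a
        + b • idem K d (FreeAlgebra.ι K (Gen.t (lft i))) (FreeAlgebra.ι K (Gen.t (rgt i)))
        + c • (idem K d (FreeAlgebra.ι K (Gen.t (lft i))) (FreeAlgebra.ι K (Gen.t (rgt i)))
            * FreeAlgebra.ι K (Gen.g i)))

/-- The algebra generated by the `g_i` and `t_j` with quadratic relation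
`g_i ^ 2 = a + b e_i + c e_i g_i`. -/
abbrev YAlg (a b c : K) (n : ℕ) : Type := RingQuot (YRel K d a b c n)

/-- The Yokonuma–Hecke algebra `Y_{d,n}` over `K`: `g_i ^ 2 = u ^ 2 + v e_i g_i`. -/
abbrev Y (u v : K) (n : ℕ) : Type := YAlg K d (u ^ 2) 0 v n

/-- Juyumaya's presentation of the Yokonuma–Hecke algebra over `K`:
`G_i ^ 2 = 1 + (q - 1) e_i + (q - 1) e_i G_i`. -/
abbrev YJ (q : K) (n : ℕ) : Type := YAlg K d 1 (q - 1) (q - 1) n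

variable {K d}

/-- The generator `g_i` (or `G_i`). -/
def gg {a b c : K} {n : ℕ} (i : Fin (n - 1)) : YAlg K d a b c n :=
  RingQuot.mkAlgHom K (YRel K d a b c n) (FreeAlgebra.ι K (Gen.g i))

/-- The generator `t_j`. -/
def tt {a b c : K} {n : ℕ} (j : Fin n) : YAlg K d a b c n :=
  RingQuot.mkAlgHom K (YRel K d a b c n) (FreeAlgebra.ι K (Gen.t j))

/-- The idempotent `e_i`. -/
def ee {a b c : K} {n : ℕ} (i : Fin (n - 1)) : YAlg K d a b c n :=
  idem K d (tt (lft i)) (tt (rgt i))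

theorem simpleT_castSucc {n : ℕ} (i : Fin (n - 1)) (j : Fin n) :
    simpleT (n := n + 1) (Fin.castLE (by omega) i) j.castSucc = (simpleT i j).castSucc := by
  simp only [simpleT, lft, rgt, Equiv.swap_apply_def, Fin.ext_iff]
  split_ifs <;> simp_all

theorem map_idem {A B : Type} [Ring A] [Algebra K A] [Ring B] [Algebra K B] (f : A →ₐ[K] B)
    (x y : A) : f (idem K d x y) = idem K d (f x) (f y) := by
  simp [idem, map_sum]

/-- The natural map from the algebra on `n` strands to the one on `n + 1` strands, sending each
generator to the generator of the same name. -/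
def incl (a b c : K) (n : ℕ) : YAlg K d a b c n →ₐ[K] YAlg K d a b c (n + 1) :=
  RingQuot.liftAlgHom K ⟨FreeAlgebra.lift K fun x : Gen n => match x with
    | Gen.g i => gg (n := n + 1) (Fin.castLE (by omega) i)
    | Gen.t j => tt (n := n + 1) j.castSucc, by
    intro x y h
    cases h with
    | far i j h =>
      have := RingQuot.mkAlgHom_rel K (YRel.far (K := K) (d := d) (a := a) (b := b) (c := c)
        (n := n + 1) (Fin.castLE (by omega) i) (Fin.castLE (by omega) j) h)
      simpa [gg] using this
    | braid i j h =>
      have := RingQuot.mkAlgHom_rel K (YRel.braid (K := K) (d := d) (a := a) (b := b) (c := c)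
        (n := n + 1) (Fin.castLE (by omega) i) (Fin.castLE (by omega) j) h)
      simpa [gg] using this
    | tt i j =>
      have := RingQuot.mkAlgHom_rel K (YRel.tt (K := K) (d := d) (a := a) (b := b) (c := c)
        (n := n + 1) i.castSucc j.castSucc)
      simpa [tt] using this
    | gt i j =>
      have := RingQuot.mkAlgHom_rel K (YRel.gt (K := K) (d := d) (a := a) (b := b) (c := c)
        (n := n + 1) (Fin.castLE (by omega) i) j.castSucc)
      rw [simpleT_castSucc] at this
      simpa [gg, tt] using this
    | tpow j =>
      have := RingQuot.mkAlgHom_rel K (YRel.tpow (K := K) (d := d) (a := a) (b := b) (c := c)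
        (n := n + 1) j.castSucc)
      simpa [tt] using this
    | quad i =>
      have := RingQuot.mkAlgHom_rel K (YRel.quad (K := K) (d := d) (a := a) (b := b) (c := c)
        (n := n + 1) (Fin.castLE (by omega) i))
      simp only [map_add, map_mul, map_smul, map_idem, AlgHom.commutes] at this
      simp only [map_add, map_mul, map_smul, map_idem, AlgHom.commutes, FreeAlgebra.lift_ι_apply]
      exact this⟩

/-- The element `u^{-ℓ(w)} g_w`, where `g_w = g_{i_1} ⋯ g_{i_r}` for a reduced expression
`w = s_{i_1} ⋯ s_{i_r}`. -/
def gt (u v : K) {n : ℕ} (w : Equiv.Perm (Fin n)) : Y K d u v n :=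
  (u⁻¹ ^ (reducedWord w).length) • ((reducedWord w).map gg).prod

/-- A Markov trace on the family `{Y_{d,n}}_{n ≥ 1}`. (A family indexed by all `n` is used; its
member at `n = 0` plays no role.) -/
structure IsMarkovTrace (u v : K) (ρ : ∀ n, Y K d u v n →ₗ[K] K) : Prop where
  trace : ∀ n, 1 ≤ n → ∀ x y : Y K d u v n, ρ n (x * y) = ρ n (y * x)
  markov : ∀ n (x : Y K d u v (n + 1)),
    ρ (n + 2) (incl _ _ _ (n + 1) x * gg (n := n + 2) (Fin.last n)) = ρ (n + 1) x
  markov_inv : ∀ n (x : Y K d u v (n + 1)),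
    ρ (n + 2) (incl _ _ _ (n + 1) x * Ring.inverse (gg (n := n + 2) (Fin.last n))) = ρ (n + 1) x

/-! ### Characters, central idempotents and the maps `Ψ_μ` -/

/-- The positions at which the character `χ` of `(ℤ/dℤ)^n` has colour `a`. A character is given by
its colours: `χ : Fin n → Fin d` stands for the character with `χ(t_j) = ξ (χ j)`. -/
def positions {n : ℕ} (χ : Fin n → Fin d) (a : Fin d) : Finset (Fin n) :=
  Finset.univ.filter fun j => χ j = a

/-- The orbit `O(μ)`: the characters `χ` with `Comp(χ) = μ`. Its cardinality is `m_μ`. -/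
abbrev Orbit (n : ℕ) (μ : Fin d → ℕ) : Type :=
  {χ : Fin n → Fin d // ∀ a, (positions χ a).card = μ a}

theorem card_positions_comp {n : ℕ} (χ : Fin n → Fin d) (w : Equiv.Perm (Fin n)) (a : Fin d) :
    (positions (χ ∘ w) a).card = (positions χ a).card := by
  refine Finset.card_bij (fun j _ => w j) ?_ (fun _ _ _ _ h => w.injective h) ?_
  · intro j hj; simpa [positions] using hj
  · intro j hj; exact ⟨w.symm j, by simpa [positions] using hj, by simp⟩

/-- The character `w⁻¹(χ)`, whose colour at `j` is `χ (w j)`; it lies in the same orbit. -/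
def Orbit.act {n : ℕ} {μ : Fin d → ℕ} (χ : Orbit n μ) (w : Equiv.Perm (Fin n)) : Orbit n μ :=
  ⟨χ.1 ∘ w, fun a => (card_positions_comp χ.1 w a).trans (χ.2 a)⟩

/-- `w` maps the positions of colour `a` of `w⁻¹(χ)` bijectively to those of `χ`. -/
def restrictPositions {n : ℕ} (χ : Fin n → Fin d) (w : Equiv.Perm (Fin n)) (a : Fin d) :
    positions (χ ∘ w) a ≃ positions χ a :=
  w.subtypeEquiv fun j => by simp [positions]

/-- The component in `S_{μ_a}` of `π_χ⁻¹ w π_{χ'} ∈ S_{μ_1} × ⋯ × S_{μ_d}`, where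
`χ' = w⁻¹(χ)`. Here `π_χ` is the element of minimal length which maps the block-ordered character
of `O(μ)` to `χ`, i.e. the permutation which sends the `a`-th block
increasingly onto the positions of colour `a` of `χ`. -/
def blockPerm {n : ℕ} {μ : Fin d → ℕ} (χ : Orbit n μ) (w : Equiv.Perm (Fin n)) (a : Fin d) :
    Equiv.Perm (Fin (μ a)) :=
  ((Finset.orderIsoOfFin (positions (χ.1 ∘ w) a) ((χ.act w).2 a)).toEquiv.trans
    (restrictPositions χ.1 w a)).trans
      (Finset.orderIsoOfFin (positions χ.1 a) (χ.2 a)).toEquiv.symm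

/-- The primitive idempotent
`E_χ = ∏_i ((1 / d) ∑_{0 ≤ s ≤ d-1} χ(t_i) ^ s t_i ^ {-s})`. -/
def Echi (ξ : Fin d → K) (u v : K) {n : ℕ} (χ : Fin n → Fin d) : Y K d u v n :=
  (List.ofFn fun i : Fin n => idem K d (algebraMap K (Y K d u v n) (ξ (χ i))) (tt i)).prod

/-- The central idempotent `E_μ = ∑_{χ ∈ O(μ)} E_χ`. -/
def Emu (ξ : Fin d → K) (u v : K) (n : ℕ) (μ : Fin d → ℕ) : Y K d u v n :=
  ∑ χ : Orbit n μ, Echi ξ u v χ.1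

/-- `f` is the linear map `Ψ_μ : E_μ Y_{d,n} → Mat_{m_μ}(H^μ)` preceded by the projection of
`Y_{d,n}` onto its direct summand `E_μ Y_{d,n}`. The rows and columns of the matrices are indexed by
the orbit `O(μ)`. The map is prescribed on the basis `E_χ g̃_w` of `Y_{d,n}`: for `χ ∈ O(μ)` the
image is `T̃_{π_χ⁻¹ w π_{χ'}}` in position `(χ, χ')`, where `χ' = w⁻¹(χ)`. -/
structure IsPsi (ξ : Fin d → K) (u v : K) (n : ℕ) (μ : Fin d → ℕ)
    (f : Y K d u v n →ₗ[K] Matrix (Orbit n μ) (Orbit n μ) (HeckeComp K u v μ)) : Prop where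
  on_summand : ∀ (χ : Orbit n μ) (w : Equiv.Perm (Fin n)),
    f (Echi ξ u v χ.1 * gt u v w) = Matrix.single χ (χ.act w)
      (PiTensorProduct.tprod K fun a => Hecke.Tt K u v (blockPerm χ w a))
  off_summand : ∀ (χ : Fin n → Fin d) (w : Equiv.Perm (Fin n)),
    (¬ ∀ a, (positions χ a).card = μ a) → f (Echi ξ u v χ * gt u v w) = 0

/-- The base `[μ]` of a composition. -/
def base (μ : Fin d → ℕ) : Fin d → ℕ := fun a => if μ a = 0 then 0 else 1

/-- The set `Comp_d^0` of nonzero `d`-compositions all of whose parts are `0` or `1`. -/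
def Comp0 (d : ℕ) : Finset (Fin d → ℕ) := (Fintype.piFinset fun _ => {0, 1}).erase 0

/-- The family `{ρ_n}_{n ≥ 1}` is given by the parameters `α_{μ^0}`, `μ^0 ∈ Comp_d^0` (only these
values of `α` are used), in the classification of Markov traces:
`ρ_n(x) = ∑_{μ ∈ Comp_d(n)} α_{[μ]} (τ_{μ_1} ⊗ ⋯ ⊗ τ_{μ_d}) (Tr (Ψ_μ (E_μ x)))`. -/
def HasParameters (ξ : Fin d → K) (u v : K) (ρ : ∀ n, Y K d u v n →ₗ[K] K)
    (α : (Fin d → ℕ) → K) : Prop :=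
  ∃ τ : ∀ n, Hecke K u v n →ₗ[K] K, IsNormalizedMarkovTrace K u v τ ∧
  ∃ Ψ : ∀ (n : ℕ) (μ : Fin d → ℕ),
      Y K d u v n →ₗ[K] Matrix (Orbit n μ) (Orbit n μ) (HeckeComp K u v μ),
    (∀ n μ, IsPsi ξ u v n μ (Ψ n μ)) ∧
    ∀ n, 1 ≤ n → ∀ x : Y K d u v n,
      ρ n x = ∑ μ ∈ Finset.piAntidiag Finset.univ n,
        α (base μ) * tensorTrace τ μ (Matrix.trace (Ψ n μ (Emu ξ u v n μ * x)))

/-! ### Juyumaya's trace -/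

/-- Juyumaya's trace `tr` with parameters `z`, `c_0, …, c_{d-1}` on the chain of algebras in the
presentation with generators `G_i`, given by its restrictions to the members of the chain. (That
the restrictions are compatible is the last condition for `b = 0`, where `c_0 = 1`.) -/
structure IsJuyumayaTrace (q z : K) (c : ℕ → K) (tr : ∀ n, YJ K d q n →ₗ[K] K) : Prop where
  one : ∀ n, tr n 1 = 1
  trace : ∀ n (x y : YJ K d q n), tr n (x * y) = tr n (y * x)
  markov : ∀ n (x : YJ K d q (n + 1)),
    tr (n + 2) (incl _ _ _ (n + 1) x * gg (n := n + 2) (Fin.last n)) = z * tr (n + 1) x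
  framing : ∀ n (x : YJ K d q n) (b : ℕ), b < d →
    tr (n + 1) (incl _ _ _ n x * tt (Fin.last n) ^ b) = c b * tr n x

/-- The solution `c_b = (1 / |S|) ∑_{a ∈ S} ξ_a ^ b` of the E-system attached to `S`. -/
def eSystem (ξ : Fin d → K) (S : Finset (Fin d)) (b : ℕ) : K :=
  (S.card : K)⁻¹ * ∑ a ∈ S, ξ a ^ b

/-- The change of generators `g_i = √λ (√q + (1 - √q) e_i) G_i`, for square roots `s` of `q` and
`r` of `λ`; here `u = √q √λ` and `v = (q - 1) √λ`. -/
def IsChangeOfGenerators (s r : K)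
    (θ : ∀ n, Y K d (s * r) ((s ^ 2 - 1) * r) n ≃ₐ[K] YJ K d (s ^ 2) n) : Prop :=
  ∀ n, (∀ i : Fin (n - 1),
      θ n (gg i) = r • ((algebraMap K _ s + (1 - s) • ee i) * gg i)) ∧
    ∀ j : Fin n, θ n (tt j) = tt j

/-- `ρ̃_{S,n} = D ^ (n - 1) tr_n`, seen on `Y_{d,n}` through the change of generators. -/
def rescaled {s r : K} (D : K)
    (θ : ∀ n, Y K d (s * r) ((s ^ 2 - 1) * r) n ≃ₐ[K] YJ K d (s ^ 2) n)
    (tr : ∀ n, YJ K d (s ^ 2) n →ₗ[K] K) (n : ℕ) : Y K d (s * r) ((s ^ 2 - 1) * r) n →ₗ[K] K :=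
  D ^ (n - 1) • (tr n ∘ₗ (θ n).toLinearMap)

/-- The parameters `α_{μ^0}` attached to `S`. -/
def alphaS (D : K) (S : Finset (Fin d)) (μ : Fin d → ℕ) : K :=
  open Classical in
  if ∃ a, a ∉ S ∧ 0 < μ a then 0 else D ^ ((∑ a, μ a) - 1) / (S.card : K) ^ (∑ a, μ a)

/-! ### Framed braids -/

/-- The defining relations of the `ℤ/dℤ`-framed braid group (with `σ_i` written `Gen.g i`). -/
inductive FBRel (d n : ℕ) : FreeGroup (Gen n) → FreeGroup (Gen n) → Prop
  | far (i j : Fin (n - 1)) (h : (i : ℕ) + 1 < j) : FBRel d n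
      (FreeGroup.of (Gen.g i) * FreeGroup.of (Gen.g j))
      (FreeGroup.of (Gen.g j) * FreeGroup.of (Gen.g i))
  | braid (i j : Fin (n - 1)) (h : (i : ℕ) + 1 = j) : FBRel d n
      (FreeGroup.of (Gen.g i) * FreeGroup.of (Gen.g j) * FreeGroup.of (Gen.g i))
      (FreeGroup.of (Gen.g j) * FreeGroup.of (Gen.g i) * FreeGroup.of (Gen.g j))
  | tt (i j : Fin n) : FBRel d n
      (FreeGroup.of (Gen.t i) * FreeGroup.of (Gen.t j))
      (FreeGroup.of (Gen.t j) * FreeGroup.of (Gen.t i))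
  | gt (i : Fin (n - 1)) (j : Fin n) : FBRel d n
      (FreeGroup.of (Gen.g i) * FreeGroup.of (Gen.t j))
      (FreeGroup.of (Gen.t (simpleT i j)) * FreeGroup.of (Gen.g i))
  | tpow (j : Fin n) : FBRel d n (FreeGroup.of (Gen.t j) ^ d) 1

/-- The `ℤ/dℤ`-framed braid group on `n` strands. -/
abbrev FramedBraid (d n : ℕ) : Type :=
  PresentedGroup {r : FreeGroup (Gen n) | ∃ x y, FBRel d n x y ∧ r = x * y⁻¹}

/-- The morphisms `σ_i ↦ √λ G_i`, `t_j ↦ t_j` from framed braids to the algebras in the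
presentation with generators `G_i`. -/
def IsDeltaJL {q : K} (r : K) (δ : ∀ n, FramedBraid d n →* YJ K d q n) : Prop :=
  ∀ n, (∀ i : Fin (n - 1), δ n (PresentedGroup.of (Gen.g i)) = r • gg i) ∧
    ∀ j : Fin n, δ n (PresentedGroup.of (Gen.t j)) = tt j

/-- The morphisms `σ_i ↦ (γ + (1 - γ) e_i) g_i`, `t_j ↦ t_j` from framed braids to `Y_{d,n}`. -/
def IsDelta {u v : K} (γ : K) (δ : ∀ n, FramedBraid d n →* Y K d u v n) : Prop :=
  ∀ n, (∀ i : Fin (n - 1),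
      δ n (PresentedGroup.of (Gen.g i)) = (algebraMap K _ γ + (1 - γ) • ee i) * gg i) ∧
    ∀ j : Fin n, δ n (PresentedGroup.of (Gen.t j)) = tt j

end Yokonuma

/-! ### The field `k_S` -/

/-- The field `k = ℂ(√q, z)` of rational functions in two indeterminates. -/
abbrev kField : Type := FractionRing (MvPolynomial (Fin 2) ℂ)

/-- The indeterminate `√q` in `k`. -/
def sqrtQ : kField := algebraMap (MvPolynomial (Fin 2) ℂ) kField (MvPolynomial.X 0)

/-- The indeterminate `z` in `k`. -/
def zVar : kField := algebraMap (MvPolynomial (Fin 2) ℂ) kField (MvPolynomial.X 1)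

/-- `λ_S = (z + (1 - q) E_S) / (q z)` in `k`, where `E_S = 1 / m` and `m = |S|`. -/
def lam (m : ℕ) : kField :=
  (zVar + (1 - sqrtQ ^ 2) * (1 / (m : kField))) / (sqrtQ ^ 2 * zVar)

/-- The field `k_S`, obtained from `k` by adjoining the square roots of `λ_S`, where `m = |S|`. -/
abbrev kS (m : ℕ) : Type :=
  Polynomial.SplittingField (Polynomial.X ^ 2 - Polynomial.C (lam m) : Polynomial kField)

end JL

end

/-!
The traces are computed on the basis `E_χ g̃_w` of `Y_{d,n}`, where `χ` runs over the sequences of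
`n` colours in `{1, …, d}` and `w` over the permutations of the strands. That these elements are
linearly independent is seen on the regular representation on pairs `(χ, w)` (`yRep`), whose braid
relation is an identity between the coefficients `coef`; that they span follows from Matsumoto's
theorem (`IsBraid.matsumoto`).

*Traces with given parameters.* For parameters `α`, the formula of the classification of Markov
traces becomes explicit (`sum_param_basis`): the value at `E_χ g̃_w` is `0` unless `w` preserves the
colours `χ`, and is then `α_{[μ]} ∏_a τ_{μ_a}(T̃_{w_a})`, where `w_a` is the permutation that `w`
induces on the strands of colour `a` and `μ` counts the colours. It is checked on the basis that
this is a trace (`rho_trace`) with the Markov property (`isMarkovTrace_rho`): multiplication by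
`g_i` with `χ_i = χ_{i+1} = a` is multiplication by a generator of the `a`-th Hecke algebra
(`weight_comm`), a last strand of colour `a` is a last strand for `τ_{μ_a}` (`weight_snoc`,
`weight_snoc_mul`), and `τ` is the Ocneanu trace, which is constructed by its conditional
expectations `H_{n+1} → H_n` (`isNormalizedMarkovTrace_ocneanu`). The parameters are recovered by
evaluation at `E_χ` for sequences `χ` of distinct colours (`hasParameters_iff`).

*Juyumaya's trace.* Write `κ = (1 - u^2) / v` for the factor by which a vertical strand changes the
normalized Markov trace of a non-trivial Hecke algebra. Adding a vertical strand of colour `c` to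
`E_χ g̃_w` replaces `α_{[μ]}` by `α_{[μ + c]}`, with a factor `κ` if `c` has occurred before. The
value of `D_S` is such that `κ = D_S / |S|` (`kappa_eq`). For the parameters attached to `S` this
means that a strand of any colour `c ∈ S`, new or not, contributes `D_S / |S|`, and a strand of
another colour `0` (`alphaS_snoc`). Hence a last strand with framing `b` contributes
`D_S / |S| · ∑_{c ∈ S} ξ_c^b = D_S c_b` (`rho_alphaS_framing`), so that after division by
`D_S^{n-1}` the trace with these parameters satisfies the framing condition of Juyumaya's trace.

*Change of generators.* The elements `r (p + (1 - p) e_i) g_i` satisfy the same relations as the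
`g_i`, up to the coefficients of the quadratic relation (`IsFramed.twist`,
`IsFramed.twist_mul_self`), and these substitutions compose multiplicatively in `r` and `p`, hence
the isomorphisms. The conditions of Juyumaya's trace are transported, with `z` replaced by `r z`
(`IsChainTrace.comp_twistHom`), because `e_n g_n` is an average of conjugates of `g_n` by powers of
`t_n`. This gives the existence of `tr_S`. It is unique because `Y_{d,n+1}` is spanned by the
elements `x t_{n+1}^b` and `x g_n y` with `x`, `y` in `Y_{d,n}` (`linearMap_ext_succ`).
-/

noncomputable section

namespace JL

/-! ### Length and reduced words in the symmetric group -/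

section Sym

variable {n : ℕ}

theorem lft_lt_rgt (i : Fin (n - 1)) : lft i < rgt i := by
  simp [lft, rgt, Fin.lt_def]

@[simp] theorem simpleT_lft (i : Fin (n - 1)) : simpleT i (lft i) = rgt i := by simp [simpleT]

@[simp] theorem simpleT_rgt (i : Fin (n - 1)) : simpleT i (rgt i) = lft i := by simp [simpleT]

theorem simpleT_of_ne {i : Fin (n - 1)} {j : Fin n} (h1 : j ≠ lft i) (h2 : j ≠ rgt i) :
    simpleT i j = j := by simp [simpleT, Equiv.swap_apply_of_ne_of_ne h1 h2]

@[simp] theorem simpleT_mul_self (i : Fin (n - 1)) : simpleT i * simpleT i = 1 := by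
  simp [simpleT]

@[simp] theorem simpleT_mul_self_mul (i : Fin (n - 1)) (w : Equiv.Perm (Fin n)) :
    simpleT i * (simpleT i * w) = w := by
  rw [← mul_assoc, simpleT_mul_self, one_mul]

@[simp] theorem mul_simpleT_mul_self (i : Fin (n - 1)) (w : Equiv.Perm (Fin n)) :
    w * simpleT i * simpleT i = w := by
  rw [mul_assoc, simpleT_mul_self, mul_one]

@[simp] theorem simpleT_inv (i : Fin (n - 1)) : (simpleT i)⁻¹ = simpleT i := by
  simp [simpleT]

@[simp] theorem simpleT_simpleT (i : Fin (n - 1)) (j : Fin n) :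
    simpleT i (simpleT i j) = j := by simp [simpleT]

/-- `i` is a left ascent of `w`, i.e. `ℓ(s_i w) > ℓ(w)`. -/
def Asc (i : Fin (n - 1)) (w : Equiv.Perm (Fin n)) : Prop := w⁻¹ (lft i) < w⁻¹ (rgt i)

instance (i : Fin (n - 1)) (w : Equiv.Perm (Fin n)) : Decidable (Asc i w) := by
  unfold Asc; infer_instance

theorem asc_simpleT_mul (i : Fin (n - 1)) (w : Equiv.Perm (Fin n)) :
    Asc i (simpleT i * w) ↔ ¬ Asc i w := by
  have : w⁻¹ (lft i) ≠ w⁻¹ (rgt i) := fun h => (lft_lt_rgt i).ne (w⁻¹.injective h)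
  simp only [Asc, mul_inv_rev, simpleT_inv, Equiv.Perm.mul_apply, simpleT_lft, simpleT_rgt]
  omega

/-- The inversions of `w⁻¹`: pairs `x < y` of values that occur in the wrong order in `w`. -/
def invSet (w : Equiv.Perm (Fin n)) : Finset (Fin n × Fin n) :=
  Finset.univ.filter fun p => p.1 < p.2 ∧ w⁻¹ p.2 < w⁻¹ p.1

theorem simpleT_lt_simpleT {i : Fin (n - 1)} {x y : Fin n} (h : x < y)
    (hne : ¬ (x = lft i ∧ y = rgt i)) : simpleT i x < simpleT i y := by
  simp only [simpleT, Equiv.swap_apply_def, lft, rgt, Fin.ext_iff, Fin.lt_def] at *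
  split_ifs <;> simp_all <;> omega

theorem card_invSet_of_asc {i : Fin (n - 1)} {w : Equiv.Perm (Fin n)} (h : Asc i w) :
    (invSet (simpleT i * w)).card = (invSet w).card + 1 := by
  have key : invSet (simpleT i * w) = insert (lft i, rgt i)
      ((invSet w).map ((simpleT i).prodCongr (simpleT i)).toEmbedding) := by
    ext ⟨x, y⟩
    simp only [Finset.mem_insert, Finset.mem_map_equiv, invSet, Finset.mem_filter,
      Finset.mem_univ, true_and, Prod.mk.injEq, mul_inv_rev, simpleT_inv, Equiv.Perm.mul_apply]
    have hs : ((simpleT i).prodCongr (simpleT i)).symm (x, y) = (simpleT i x, simpleT i y) := by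
      simp [Equiv.prodCongr, simpleT]
    rw [hs]
    by_cases hxy : x = lft i ∧ y = rgt i
    · obtain ⟨rfl, rfl⟩ := hxy
      simp only [simpleT_lft, simpleT_rgt, lft_lt_rgt, true_and, and_self, true_or, iff_true]
      exact h
    · simp only [hxy, false_or]
      refine and_congr_left fun h2 => ⟨fun h1 => simpleT_lt_simpleT h1 hxy, fun h1 => ?_⟩
      have := simpleT_lt_simpleT (i := i) h1 ?_
      · simpa using this
      · rintro ⟨h3, h4⟩
        rw [h3, h4] at h2
        exact absurd h (not_lt.2 h2.le)
  rw [key, Finset.card_insert_of_notMem, Finset.card_map]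
  simp only [Finset.mem_map_equiv, invSet, Finset.mem_filter, Finset.mem_univ, true_and]
  rintro ⟨h1, _⟩
  have hs : ((simpleT i).prodCongr (simpleT i)).symm (lft i, rgt i) = (rgt i, lft i) := by
    simp [Equiv.prodCongr, simpleT]
  rw [hs] at h1
  exact absurd h1 (not_lt.2 (lft_lt_rgt i).le)

theorem card_invSet_of_not_asc {i : Fin (n - 1)} {w : Equiv.Perm (Fin n)} (h : ¬ Asc i w) :
    (invSet (simpleT i * w)).card + 1 = (invSet w).card := by
  have := card_invSet_of_asc ((asc_simpleT_mul i w).2 h)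
  simpa using this.symm

theorem card_invSet_prod_le (L : List (Fin (n - 1))) :
    (invSet (L.map simpleT).prod).card ≤ L.length := by
  induction L with
  | nil =>
    simp only [List.map_nil, List.prod_nil, List.length_nil, invSet, inv_one, Equiv.Perm.one_apply,
      Nat.le_zero, Finset.card_eq_zero]
    ext p
    simp only [Finset.mem_filter, Finset.mem_univ, true_and, Finset.notMem_empty, iff_false]
    omega
  | cons i L ih =>
    simp only [List.map_cons, List.prod_cons, List.length_cons]
    by_cases h : Asc i (L.map simpleT).prod
    · rw [card_invSet_of_asc h]; omega
    · have := card_invSet_of_not_asc h; omega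

theorem eq_one_of_forall_asc {w : Equiv.Perm (Fin n)} (h : ∀ i, Asc i w) : w = 1 := by
  cases n with
  | zero => exact Subsingleton.elim _ _
  | succ m =>
    have hm : StrictMono ⇑w⁻¹ := Fin.strictMono_iff_lt_succ.2 fun i => h i
    have : (hm.orderIsoOfSurjective _ w⁻¹.surjective) = OrderIso.refl _ := Subsingleton.elim _ _
    have h2 : w⁻¹ = 1 := by
      ext x
      have := congrArg (fun f => f x) this
      simpa using congrArg Fin.val this
    simpa using h2

theorem exists_word_length_eq (k : ℕ) : ∀ w : Equiv.Perm (Fin n), (invSet w).card = k →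
    ∃ L : List (Fin (n - 1)), (L.map simpleT).prod = w ∧ L.length = k := by
  induction k with
  | zero =>
    intro w hw
    refine ⟨[], ?_, rfl⟩
    refine (eq_one_of_forall_asc fun i => ?_).symm
    by_contra hi
    have := card_invSet_of_not_asc hi
    omega
  | succ k ih =>
    intro w hw
    have : ∃ i, ¬ Asc i w := by
      by_contra! hall
      rw [eq_one_of_forall_asc hall] at hw
      have := card_invSet_prod_le ([] : List (Fin (n - 1)))
      simp [hw] at this
    obtain ⟨i, hi⟩ := this
    have h1 := card_invSet_of_not_asc hi
    obtain ⟨L, hL, hk⟩ := ih (simpleT i * w) (by omega)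
    exact ⟨i :: L, by simp [hL], by simp [hk]⟩

theorem isReducedWord_iff {w : Equiv.Perm (Fin n)} {L : List (Fin (n - 1))} :
    IsReducedWord w L ↔ (L.map simpleT).prod = w ∧ L.length = (invSet w).card := by
  obtain ⟨L₀, h₀, hl₀⟩ := exists_word_length_eq _ w rfl
  constructor
  · rintro ⟨h1, h2⟩
    refine ⟨h1, le_antisymm (hl₀ ▸ h2 L₀ h₀) ?_⟩
    rw [← h1]; exact card_invSet_prod_le L
  · rintro ⟨h1, h2⟩
    refine ⟨h1, fun L' h' => ?_⟩
    rw [h2, ← h']; exact card_invSet_prod_le L'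

/-- The length of a permutation, as the length of the chosen reduced expression. -/
def ell (w : Equiv.Perm (Fin n)) : ℕ := (reducedWord w).length

theorem reducedWord_spec (w : Equiv.Perm (Fin n)) : IsReducedWord w (reducedWord w) :=
  (exists_isReducedWord w).choose_spec

theorem ell_eq (w : Equiv.Perm (Fin n)) : ell w = (invSet w).card :=
  (isReducedWord_iff.1 (reducedWord_spec w)).2

theorem IsReducedWord.length_eq {w : Equiv.Perm (Fin n)} {L : List (Fin (n - 1))}
    (h : IsReducedWord w L) : L.length = ell w := by
  rw [(isReducedWord_iff.1 h).2, ell_eq]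

theorem ell_simpleT_mul {i : Fin (n - 1)} {w : Equiv.Perm (Fin n)} (h : Asc i w) :
    ell (simpleT i * w) = ell w + 1 := by
  rw [ell_eq, ell_eq, card_invSet_of_asc h]

theorem IsReducedWord.cons {i : Fin (n - 1)} {w : Equiv.Perm (Fin n)} (h : Asc i w)
    {L : List (Fin (n - 1))} (hL : IsReducedWord w L) : IsReducedWord (simpleT i * w) (i :: L) := by
  rw [isReducedWord_iff] at hL ⊢
  refine ⟨by simp [hL.1], ?_⟩
  rw [card_invSet_of_asc h, List.length_cons, hL.2]

theorem IsReducedWord.of_cons {i : Fin (n - 1)} {w : Equiv.Perm (Fin n)}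
    {L : List (Fin (n - 1))} (hL : IsReducedWord w (i :: L)) :
    ¬ Asc i w ∧ IsReducedWord (simpleT i * w) L := by
  rw [isReducedWord_iff] at hL
  obtain ⟨h1, h2⟩ := hL
  have h3 : (L.map simpleT).prod = simpleT i * w := by rw [← h1]; simp
  have h4 := card_invSet_prod_le L
  rw [h3] at h4
  have hna : ¬ Asc i w := by
    intro h
    have := card_invSet_of_asc h
    simp at h2
    omega
  refine ⟨hna, isReducedWord_iff.2 ⟨h3, ?_⟩⟩
  have := card_invSet_of_not_asc hna
  simp at h2
  omega

theorem reducedWord_one : reducedWord (1 : Equiv.Perm (Fin n)) = [] := by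
  have := (reducedWord_spec (1 : Equiv.Perm (Fin n))).2 [] rfl
  exact List.length_eq_zero_iff.1 (Nat.le_zero.1 this)

@[simp] theorem ell_one : ell (1 : Equiv.Perm (Fin n)) = 0 := by
  simp [ell, reducedWord_one]

theorem prod_reverse_simpleT (L : List (Fin (n - 1))) :
    (L.reverse.map simpleT).prod = ((L.map simpleT).prod)⁻¹ := by
  induction L with
  | nil => simp
  | cons i L ih => rw [List.reverse_cons, List.map_append, List.prod_append, ih]; simp

theorem IsReducedWord.reverse {w : Equiv.Perm (Fin n)} {L : List (Fin (n - 1))}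
    (h : IsReducedWord w L) : IsReducedWord w⁻¹ L.reverse := by
  refine ⟨by rw [prod_reverse_simpleT, h.1], fun L' h' => ?_⟩
  have := h.2 L'.reverse (by rw [prod_reverse_simpleT, h', inv_inv])
  simpa using this

theorem ell_inv (w : Equiv.Perm (Fin n)) : ell w⁻¹ = ell w := by
  rw [← (reducedWord_spec w).reverse.length_eq, List.length_reverse]; rfl

theorem ell_mul_simpleT {i : Fin (n - 1)} {w : Equiv.Perm (Fin n)} (h : w (lft i) < w (rgt i)) :
    ell (w * simpleT i) = ell w + 1 := by
  rw [← ell_inv, mul_inv_rev, simpleT_inv, ell_simpleT_mul (by simpa [Asc] using h), ell_inv]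

theorem IsReducedWord.concat {i : Fin (n - 1)} {w : Equiv.Perm (Fin n)}
    (h : w (lft i) < w (rgt i)) {L : List (Fin (n - 1))} (hL : IsReducedWord w L) :
    IsReducedWord (w * simpleT i) (L ++ [i]) := by
  have := (hL.reverse.cons (i := i) (by simpa [Asc] using h)).reverse
  simpa using this

/-- Every permutation is reached from the identity by left multiplications at ascents. -/
theorem asc_induction {P : Equiv.Perm (Fin n) → Prop} (one : P 1)
    (step : ∀ i w, Asc i w → P w → P (simpleT i * w)) (w : Equiv.Perm (Fin n)) : P w := by
  obtain ⟨L, hL⟩ := exists_isReducedWord w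
  induction L generalizing w with
  | nil => rw [← hL.1]; exact one
  | cons i L ih =>
    obtain ⟨h1, h2⟩ := hL.of_cons
    have := step i _ ((asc_simpleT_mul i w).2 h1) (ih _ h2)
    simpa using this

end Sym

/-! ### Matsumoto's theorem for the symmetric group -/

section Matsumoto

variable {n : ℕ} {A : Type*} [Monoid A]

/-- The family `g` satisfies the braid relations of type `A_{n-1}`. -/
structure IsBraid (g : Fin (n - 1) → A) : Prop where
  far : ∀ i j : Fin (n - 1), (i : ℕ) + 1 < j → g i * g j = g j * g i
  braid : ∀ i j : Fin (n - 1), (i : ℕ) + 1 = j → g i * g j * g i = g j * g i * g j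

theorem rgt_eq_lft {i j : Fin (n - 1)} (h : (i : ℕ) + 1 = j) : rgt i = lft j := by
  simp [lft, rgt, h]

theorem simpleT_far {i j : Fin (n - 1)} (h : (i : ℕ) + 1 < j ∨ (j : ℕ) + 1 < i) :
    simpleT i (lft j) = lft j ∧ simpleT i (rgt j) = rgt j := by
  constructor <;> apply simpleT_of_ne <;> simp [lft, rgt] <;> omega

theorem simpleT_adj {i j : Fin (n - 1)} (h : (i : ℕ) + 1 = j) :
    simpleT i (rgt j) = rgt j ∧ simpleT j (lft i) = lft i := by
  constructor <;> apply simpleT_of_ne <;> simp [lft, rgt] <;> omega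

theorem isBraid_simpleT : IsBraid (simpleT : Fin (n - 1) → Equiv.Perm (Fin n)) where
  far i j h := by
    conv_lhs => rw [simpleT.eq_1 j, Equiv.mul_swap_eq_swap_mul, (simpleT_far (Or.inl h)).1,
      (simpleT_far (Or.inl h)).2]
    rfl
  braid i j h := by
    have h1 : simpleT i * simpleT j = Equiv.swap (lft i) (rgt j) * simpleT i := by
      conv_lhs => rw [simpleT.eq_1 j, Equiv.mul_swap_eq_swap_mul, (simpleT_adj h).1,
        ← rgt_eq_lft h, simpleT_rgt]
    have h2 : simpleT j * simpleT i = Equiv.swap (lft i) (rgt j) * simpleT j := by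
      conv_lhs => rw [simpleT.eq_1 i, Equiv.mul_swap_eq_swap_mul, (simpleT_adj h).2,
        rgt_eq_lft h, simpleT_lft]
    rw [h1, h2, mul_simpleT_mul_self, mul_simpleT_mul_self]

/-- **Matsumoto's theorem**: for a family that satisfies the braid relations, the product along a
reduced expression only depends on the permutation. -/
theorem IsBraid.matsumoto {g : Fin (n - 1) → A} (hg : IsBraid g) (k : ℕ) :
    ∀ (w : Equiv.Perm (Fin n)) (L L' : List (Fin (n - 1))), L.length ≤ k → IsReducedWord w L →
      IsReducedWord w L' → (L.map g).prod = (L'.map g).prod := by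
  induction k with
  | zero =>
    intro w L L' hk hL hL'
    have h1 := hL.length_eq.trans hL'.length_eq.symm
    rw [List.length_eq_zero_iff.1 (by omega : L.length = 0),
      List.length_eq_zero_iff.1 (by omega : L'.length = 0)]
  | succ k ih =>
    -- Two reduced words that start with `i`, `j` are both compared with reduced words that start
    -- with the longest element of the parabolic subgroup generated by `s_i` and `s_j`.
    have far : ∀ (i j : Fin (n - 1)) (w) (L L'), (i : ℕ) + 1 < j → L.length ≤ k →
        IsReducedWord w (i :: L) → IsReducedWord w (j :: L') →
        g i * (L.map g).prod = g j * (L'.map g).prod := by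
      intro i j w L L' hij hk hL hL'
      obtain ⟨hi, hL⟩ := hL.of_cons
      obtain ⟨hj, hL'⟩ := hL'.of_cons
      have hk' : L'.length ≤ k := by
        have h1 := hL.length_eq
        have h2 := hL'.length_eq
        have h3 := ell_simpleT_mul ((asc_simpleT_mul i w).2 hi)
        have h4 := ell_simpleT_mul ((asc_simpleT_mul j w).2 hj)
        simp only [simpleT_mul_self_mul] at h3 h4
        omega
      have hs := isBraid_simpleT.far i j hij
      have hj2 : ¬ Asc j (simpleT i * w) := by
        simpa [Asc, simpleT_far (Or.inl hij)] using hj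
      obtain ⟨M, hM⟩ := exists_isReducedWord (simpleT j * (simpleT i * w))
      have h1 := hM.cons ((asc_simpleT_mul j _).2 hj2)
      have h2 : Asc i (simpleT j * (simpleT i * w)) := by
        have : ¬ Asc i (simpleT j * w) := by simpa [Asc, simpleT_far (Or.inr hij)] using hi
        rw [← mul_assoc, ← hs, mul_assoc, asc_simpleT_mul]; exact this
      have h3 := hM.cons h2
      rw [simpleT_mul_self_mul] at h1
      rw [← mul_assoc (simpleT j), ← hs, mul_assoc, simpleT_mul_self_mul] at h3
      rw [ih _ _ _ hk hL h1, ih _ _ _ hk' hL' h3]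
      simp only [List.map_cons, List.prod_cons, ← mul_assoc, hg.far i j hij]
    have adj : ∀ (i j : Fin (n - 1)) (w) (L L'), (i : ℕ) + 1 = j → L.length ≤ k →
        IsReducedWord w (i :: L) → IsReducedWord w (j :: L') →
        g i * (L.map g).prod = g j * (L'.map g).prod := by
      intro i j w L L' hij hk hL hL'
      obtain ⟨hi, hL⟩ := hL.of_cons
      obtain ⟨hj, hL'⟩ := hL'.of_cons
      have hk' : L'.length ≤ k := by
        have h1 := hL.length_eq
        have h2 := hL'.length_eq
        have h3 := ell_simpleT_mul ((asc_simpleT_mul i w).2 hi)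
        have h4 := ell_simpleT_mul ((asc_simpleT_mul j w).2 hj)
        simp only [simpleT_mul_self_mul] at h3 h4
        omega
      have hs := isBraid_simpleT.braid i j hij
      have e1 := rgt_eq_lft hij
      have e2 := simpleT_adj hij
      have e3 : simpleT i (lft j) = lft i := by rw [← e1]; simp
      have e4 : simpleT j (rgt i) = rgt j := by rw [e1]; simp
      have hi' : w⁻¹ (rgt i) < w⁻¹ (lft i) :=
        lt_of_le_of_ne (not_lt.1 hi) fun h => (lft_lt_rgt i).ne (w⁻¹.injective h).symm
      have hj' : w⁻¹ (rgt j) < w⁻¹ (lft j) :=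
        lt_of_le_of_ne (not_lt.1 hj) fun h => (lft_lt_rgt j).ne (w⁻¹.injective h).symm
      have hij' : w⁻¹ (rgt j) < w⁻¹ (lft i) := by rw [← e1] at hj'; exact hj'.trans hi'
      -- the common tail `s_i s_j s_i w`
      obtain ⟨M, hM⟩ := exists_isReducedWord (simpleT i * (simpleT j * (simpleT i * w)))
      have a1 : Asc i (simpleT i * (simpleT j * (simpleT i * w))) := by
        rw [asc_simpleT_mul]
        simp only [Asc, mul_inv_rev, simpleT_inv, Equiv.Perm.mul_apply, e2, simpleT_lft, e1]
        exact not_lt.2 hj'.le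
      have a2 : Asc j (simpleT j * (simpleT i * w)) := by
        rw [asc_simpleT_mul]
        simp only [Asc, mul_inv_rev, simpleT_inv, Equiv.Perm.mul_apply, e2, e3]
        exact not_lt.2 hij'.le
      have b1 := hM.cons a1
      rw [simpleT_mul_self_mul] at b1
      have b2 := b1.cons a2
      rw [simpleT_mul_self_mul] at b2
      have hs' : simpleT i * (simpleT j * (simpleT i * w)) =
          simpleT j * (simpleT i * (simpleT j * w)) := by
        simp only [← mul_assoc, hs]
      rw [hs'] at hM
      have a3 : Asc j (simpleT j * (simpleT i * (simpleT j * w))) := by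
        rw [asc_simpleT_mul]
        simp only [Asc, mul_inv_rev, simpleT_inv, Equiv.Perm.mul_apply, e2, simpleT_rgt, ← e1]
        exact not_lt.2 hi'.le
      have a4 : Asc i (simpleT i * (simpleT j * w)) := by
        rw [asc_simpleT_mul]
        simp only [Asc, mul_inv_rev, simpleT_inv, Equiv.Perm.mul_apply, e2, e4]
        exact not_lt.2 hij'.le
      have b3 := hM.cons a3
      rw [simpleT_mul_self_mul] at b3
      have b4 := b3.cons a4
      rw [simpleT_mul_self_mul] at b4
      rw [ih _ _ _ hk hL b2, ih _ _ _ hk' hL' b4]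
      simp only [List.map_cons, List.prod_cons, ← mul_assoc, hg.braid i j hij]
    intro w L L' hk hL hL'
    match L, L' with
    | [], L' =>
      have h1 := hL.length_eq.trans hL'.length_eq.symm
      rw [List.length_eq_zero_iff.1 (by simpa using h1.symm : L'.length = 0)]
    | i :: L, [] => simpa using hL.length_eq.trans hL'.length_eq.symm
    | i :: L, j :: L' =>
      have hlen := hL.length_eq.trans hL'.length_eq.symm
      simp only [List.length_cons, List.map_cons, List.prod_cons] at hk hlen ⊢
      rcases lt_trichotomy ((i : ℕ) + 1) j with h | h | h
      · exact far i j w L L' h (by omega) hL hL'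
      · exact adj i j w L L' h (by omega) hL hL'
      · rcases lt_trichotomy ((j : ℕ) + 1) i with h' | h' | h'
        · exact (far j i w L' L h' (by omega) hL' hL).symm
        · exact (adj j i w L' L h' (by omega) hL' hL).symm
        · obtain rfl : i = j := Fin.ext (by omega)
          rw [ih _ _ _ (by omega) hL.of_cons.2 hL'.of_cons.2]

/-- The product `g_{i_1} ⋯ g_{i_r}` along a reduced expression of `w`. -/
def wordProd (g : Fin (n - 1) → A) (w : Equiv.Perm (Fin n)) : A :=
  ((reducedWord w).map g).prod

@[simp] theorem wordProd_one (g : Fin (n - 1) → A) : wordProd g 1 = 1 := by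
  simp [wordProd, reducedWord_one]

theorem IsBraid.wordProd_eq {g : Fin (n - 1) → A} (hg : IsBraid g) {w : Equiv.Perm (Fin n)}
    {L : List (Fin (n - 1))} (hL : IsReducedWord w L) : wordProd g w = (L.map g).prod :=
  hg.matsumoto _ w _ _ le_rfl (reducedWord_spec w) hL

theorem IsBraid.wordProd_simpleT_mul {g : Fin (n - 1) → A} (hg : IsBraid g) {i : Fin (n - 1)}
    {w : Equiv.Perm (Fin n)} (h : Asc i w) : wordProd g (simpleT i * w) = g i * wordProd g w := by
  rw [hg.wordProd_eq ((reducedWord_spec w).cons h)]; simp [wordProd]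

theorem IsBraid.wordProd_mul_simpleT {g : Fin (n - 1) → A} (hg : IsBraid g) {i : Fin (n - 1)}
    {w : Equiv.Perm (Fin n)} (h : w (lft i) < w (rgt i)) :
    wordProd g (w * simpleT i) = wordProd g w * g i := by
  rw [hg.wordProd_eq ((reducedWord_spec w).concat h)]; simp [wordProd]

theorem map_wordProd {B F : Type*} [Monoid B] [FunLike F A B] [MonoidHomClass F A B] (f : F)
    (g : Fin (n - 1) → A) (w : Equiv.Perm (Fin n)) :
    f (wordProd g w) = wordProd (fun i => f (g i)) w := by
  simp [wordProd, map_list_prod, Function.comp_def]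

end Matsumoto

/-! ### Adding a strand to a permutation -/

section Extend

variable {n : ℕ}

/-- The permutation `w` of `n` letters, seen as a permutation of `n + 1` letters. -/
def extPerm (w : Equiv.Perm (Fin n)) : Equiv.Perm (Fin (n + 1)) where
  toFun := Fin.lastCases (Fin.last n) fun j => (w j).castSucc
  invFun := Fin.lastCases (Fin.last n) fun j => (w⁻¹ j).castSucc
  left_inv x := by induction x using Fin.lastCases <;> simp
  right_inv x := by induction x using Fin.lastCases <;> simp

@[simp] theorem extPerm_last (w : Equiv.Perm (Fin n)) : extPerm w (Fin.last n) = Fin.last n := by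
  simp [extPerm]

@[simp] theorem extPerm_castSucc (w : Equiv.Perm (Fin n)) (j : Fin n) :
    extPerm w j.castSucc = (w j).castSucc := by
  simp [extPerm]

@[simp] theorem extPerm_one : extPerm (1 : Equiv.Perm (Fin n)) = 1 := by
  ext x; induction x using Fin.lastCases <;> simp

theorem extPerm_mul (w w' : Equiv.Perm (Fin n)) : extPerm (w * w') = extPerm w * extPerm w' := by
  ext x; induction x using Fin.lastCases <;> simp

theorem extPerm_inv (w : Equiv.Perm (Fin n)) : (extPerm w)⁻¹ = extPerm w⁻¹ := by
  rw [inv_eq_iff_mul_eq_one, ← extPerm_mul]; simp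

/-- The generator index `i`, seen on one more strand. -/
def extGen (i : Fin (n - 1)) : Fin (n + 1 - 1) := Fin.castLE (by omega) i

theorem lft_extGen (i : Fin (n - 1)) : lft (extGen i) = (lft i).castSucc := rfl

theorem rgt_extGen (i : Fin (n - 1)) : rgt (extGen i) = (rgt i).castSucc := rfl

theorem extPerm_simpleT (i : Fin (n - 1)) : extPerm (simpleT i) = simpleT (extGen i) := by
  ext x
  induction x using Fin.lastCases with
  | last =>
    rw [extPerm_last, simpleT_of_ne] <;>
      simp only [ne_eq, lft, rgt, extGen, Fin.ext_iff, Fin.val_last, Fin.val_castLE] <;> omega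
  | cast j => rw [extPerm_castSucc, extGen, simpleT_castSucc]

theorem asc_extGen (i : Fin (n - 1)) (w : Equiv.Perm (Fin n)) :
    Asc (extGen i) (extPerm w) ↔ Asc i w := by
  simp [Asc, extPerm_inv, lft_extGen, rgt_extGen]

theorem wordProd_extPerm {A : Type*} [Monoid A] {g : Fin (n + 1 - 1) → A} (hg : IsBraid g)
    (w : Equiv.Perm (Fin n)) :
    wordProd g (extPerm w) = wordProd (fun i => g (extGen i)) w := by
  have hg' : IsBraid fun i => g (extGen i) :=
    ⟨fun i j h => hg.far _ _ h, fun i j h => hg.braid _ _ h⟩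
  induction w using asc_induction with
  | one => simp
  | step i w h ih =>
    rw [extPerm_mul, extPerm_simpleT, hg.wordProd_simpleT_mul ((asc_extGen i w).2 h),
      hg'.wordProd_simpleT_mul h, ih]

theorem ell_extPerm (w : Equiv.Perm (Fin n)) : ell (extPerm w) = ell w := by
  induction w using asc_induction with
  | one => simp
  | step i w h ih =>
    rw [extPerm_mul, extPerm_simpleT, ell_simpleT_mul ((asc_extGen i w).2 h),
      ell_simpleT_mul h, ih]

end Extend

/-! ### Roots of unity and idempotents -/

section Roots

variable {K : Type} [Field K] {d : ℕ}

/-- `ξ` enumerates the `d`-th roots of unity of `K`, of which there are `d`; the vanishing of the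
power sums is recorded instead of the completeness of the enumeration. -/
structure IsRootFamily (ξ : Fin d → K) : Prop where
  ne_zero : (d : K) ≠ 0
  inj : Function.Injective ξ
  pow : ∀ a, ξ a ^ d = 1
  sum : ∀ s, 0 < s → s < d → ∑ a, ξ a ^ s = 0

theorem idem_scalar {ξ : Fin d → K} (hξ : IsRootFamily ξ) (a b : Fin d) :
    idem K d (ξ a) (ξ b) = if a = b then 1 else 0 := by
  unfold idem
  split_ifs with h
  · subst h
    rw [Finset.sum_congr rfl (g := fun _ => (1 : K))]
    · simp [hξ.ne_zero]
    · intro s hs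
      rw [← pow_add, Nat.add_sub_cancel' (Finset.mem_range.1 hs).le, hξ.pow]
  · have h1 : (∑ s ∈ Finset.range d, ξ a ^ s * ξ b ^ (d - s)) =
        (∑ s ∈ Finset.range d, ξ a ^ s * ξ b ^ (d - 1 - s)) * ξ b := by
      rw [Finset.sum_mul]
      refine Finset.sum_congr rfl fun s hs => ?_
      have := Finset.mem_range.1 hs
      rw [mul_assoc, ← pow_succ, show d - 1 - s + 1 = d - s by omega]
    have h2 := Commute.geom_sum₂_mul (Commute.all (ξ a) (ξ b)) d
    rw [hξ.pow, hξ.pow, sub_self, mul_eq_zero, sub_eq_zero] at h2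
    rw [h1, h2.resolve_right fun h' => h (hξ.inj h')]
    simp

theorem idem_commute {A : Type} [Ring A] [Algebra K A] {x y z : A} (hx : Commute z x)
    (hy : Commute z y) : Commute z (idem K d x y) :=
  (Commute.sum_right _ _ _ fun _ _ => (hx.pow_right _).mul_right (hy.pow_right _)).smul_right _

theorem idem_intertwine {A : Type} [Ring A] [Algebra K A] {g x y x' y' : A} (hx : g * x = x' * g)
    (hy : g * y = y' * g) : g * idem K d x y = idem K d x' y' * g := by
  have hx' : SemiconjBy g x x' := hx
  have hy' : SemiconjBy g y y' := hy
  simp only [idem, mul_smul_comm, smul_mul_assoc, Finset.mul_sum, Finset.sum_mul]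
  congr 1
  exact Finset.sum_congr rfl fun s _ => ((hx'.pow_right s).mul_right (hy'.pow_right (d - s)))

/-- `idem` is symmetric in two commuting `d`-torsion units. -/
theorem idem_comm {A : Type} [Ring A] [Algebra K A] {x y : A} (hxy : Commute x y)
    (hx : x ^ d = 1) (hy : y ^ d = 1) : idem K d x y = idem K d y x := by
  unfold idem
  congr 1
  rcases Nat.eq_zero_or_pos d with rfl | hd
  · simp
  have hd1 : Finset.range d = insert 0 (Finset.Ico 1 d) := by
    ext s; simp; omega
  rw [hd1, Finset.sum_insert (by simp), Finset.sum_insert (by simp)]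
  congr 1
  · simp [hx, hy]
  · refine Finset.sum_nbij' (fun s => d - s) (fun s => d - s) ?_ ?_ ?_ ?_ ?_
    · intro s hs; simp at hs ⊢; omega
    · intro s hs; simp at hs ⊢; omega
    · intro s hs; simp at hs ⊢; omega
    · intro s hs; simp at hs ⊢; omega
    · intro s hs
      have : d - (d - s) = s := by simp at hs; omega
      rw [this, (hxy.pow_pow s (d - s)).eq]

variable {A : Type} [Ring A] [Algebra K A] {M : Type*} [AddCommGroup M] [Module K M]

theorem pow_apply_eigen (f : A →ₐ[K] Module.End K M) {x : A} {m : M} {a : K}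
    (h : f x m = a • m) (s : ℕ) : f (x ^ s) m = a ^ s • m := by
  induction s with
  | zero => simp
  | succ s ih => rw [pow_succ, map_mul, Module.End.mul_apply, h, map_smul, ih, smul_smul, pow_succ,
      mul_comm]

theorem idem_apply_eigen (f : A →ₐ[K] Module.End K M) {x y : A} {m : M} {a b : K}
    (hx : f x m = a • m) (hy : f y m = b • m) : f (idem K d x y) m = idem K d a b • m := by
  simp only [idem, map_smul, map_sum, map_mul, LinearMap.smul_apply, LinearMap.sum_apply,
    Module.End.mul_apply, pow_apply_eigen f hx, pow_apply_eigen f hy, smul_smul, Finset.sum_smul,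
    smul_assoc, mul_comm]

end Roots

/-! ### The regular representation on coloured permutations -/

section Rep

variable {K : Type} [Field K] {d n : ℕ} (u v : K)

/-- The basis of the regular representation of `Y_{d,n}`: `(χ, w)` stands for `E_χ g̃_w`. -/
abbrev St (n d : ℕ) : Type := (Fin n → Fin d) × Equiv.Perm (Fin n)

/-- The left action of a permutation on pairs `(χ, w)`. -/
def St.act (σ : Equiv.Perm (Fin n)) (x : St n d) : St n d := (x.1 ∘ ⇑σ⁻¹, σ * x.2)

theorem St.act_act (σ τ : Equiv.Perm (Fin n)) (x : St n d) :
    (x.act τ).act σ = x.act (σ * τ) := by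
  simp only [St.act, mul_inv_rev, Equiv.Perm.coe_mul, Function.comp_assoc, mul_assoc]

/-- `v` if the values `i`, `j` have the same colour and are in the wrong order, and `0` if not. -/
def coef (x : St n d) (i j : Fin n) : K :=
  if x.1 i = x.1 j ∧ x.2⁻¹ j < x.2⁻¹ i then v else 0

theorem coef_act (σ : Equiv.Perm (Fin n)) (x : St n d) (i j : Fin n) :
    coef v (x.act σ) i j = coef v x (σ⁻¹ i) (σ⁻¹ j) := by
  simp only [coef, St.act, mul_inv_rev, Equiv.Perm.mul_apply, Function.comp_apply]

theorem coef_mul_coef (x : St n d) {i j k : Fin n} (hij : i ≠ j) (hjk : j ≠ k) (hik : i ≠ k) :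
    coef v x i k * coef v x j i + coef v x i j * coef v x j k = coef v x j k * coef v x i k ∧
      coef v x i k * coef v x k j + coef v x i j * coef v x j k =
        coef v x i j * coef v x i k := by
  have h1 : x.2⁻¹ i ≠ x.2⁻¹ j := fun h => hij (x.2⁻¹.injective h)
  have h2 : x.2⁻¹ j ≠ x.2⁻¹ k := fun h => hjk (x.2⁻¹.injective h)
  have h3 : x.2⁻¹ i ≠ x.2⁻¹ k := fun h => hik (x.2⁻¹.injective h)
  unfold coef
  generalize x.2⁻¹ i = a at *
  generalize x.2⁻¹ j = b at *
  generalize x.2⁻¹ k = c at *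
  by_cases e1 : x.1 i = x.1 j <;> by_cases e2 : x.1 j = x.1 k
  · rcases lt_or_gt_of_ne h1 with l1 | l1 <;> rcases lt_or_gt_of_ne h2 with l2 | l2 <;>
      rcases lt_or_gt_of_ne h3 with l3 | l3 <;>
      first
        | (exfalso; order)
        | simp [e1, e2, l1, l2, l3, l1.not_gt, l2.not_gt, l3.not_gt]
  · have e3 : ¬ x.1 i = x.1 k := by rw [e1]; exact e2
    simp [e2, e3]
  · have e3 : ¬ x.1 i = x.1 k := by rw [← e2]; exact e1
    simp [e1, e3]
  · simp [e1, e2, Ne.symm e1, Ne.symm e2]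

theorem coef_sq (x : St n d) (i j : Fin n) : coef v x i j * coef v x i j = v * coef v x i j := by
  unfold coef; split_ifs <;> simp

theorem coef_add_coef (x : St n d) {i j : Fin n} (hij : i ≠ j) :
    coef v x i j + coef v x j i = if x.1 i = x.1 j then v else 0 := by
  have h1 : x.2⁻¹ i ≠ x.2⁻¹ j := fun h => hij (x.2⁻¹.injective h)
  unfold coef
  generalize x.2⁻¹ i = a at *
  generalize x.2⁻¹ j = b at *
  by_cases e : x.1 i = x.1 j
  · rcases lt_or_gt_of_ne h1 with l | l <;> simp [e, l, l.not_gt]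
  · simp [e, Ne.symm e]

/-- The operator by which `g_i` acts. -/
def opG (i : Fin (n - 1)) : Module.End K (St n d →₀ K) :=
  Finsupp.linearCombination K fun x =>
    u • Finsupp.single (x.act (simpleT i)) 1 + coef v x (lft i) (rgt i) • Finsupp.single x 1

theorem opG_single (i : Fin (n - 1)) (x : St n d) :
    opG u v i (Finsupp.single x 1) =
      u • Finsupp.single (x.act (simpleT i)) 1 + coef v x (lft i) (rgt i) • Finsupp.single x 1 := by
  simp [opG]

/-- The diagonal operator with the given eigenvalues. -/
def opDiag (f : St n d → K) : Module.End K (St n d →₀ K) :=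
  Finsupp.linearCombination K fun x => f x • Finsupp.single x 1

theorem opDiag_single (f : St n d → K) (x : St n d) :
    opDiag f (Finsupp.single x 1) = f x • Finsupp.single x 1 := by
  simp [opDiag]

theorem end_ext {f g : Module.End K (St n d →₀ K)}
    (h : ∀ x, f (Finsupp.single x 1) = g (Finsupp.single x 1)) : f = g :=
  Finsupp.lhom_ext' fun x => LinearMap.ext_ring (h x)

theorem isBraid_opG : IsBraid (opG u v : Fin (n - 1) → Module.End K (St n d →₀ K)) where
  far i j h := by
    refine end_ext fun x => ?_
    obtain ⟨h1, h2⟩ := simpleT_far (Or.inl h)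
    obtain ⟨h3, h4⟩ := simpleT_far (Or.inr h)
    have hs := isBraid_simpleT.far i j h
    simp only [Module.End.mul_apply, opG_single, map_add, map_smul, coef_act, simpleT_inv, h1, h2,
      h3, h4, St.act_act, hs]
    module
  braid i j h := by
    refine end_ext fun x => ?_
    have hb := rgt_eq_lft h
    obtain ⟨h1, h2⟩ := simpleT_adj h
    have h3 : simpleT i (lft j) = lft i := by rw [← hb]; simp
    have h4 : simpleT j (lft j) = rgt j := simpleT_lft j
    have hs := isBraid_simpleT.braid i j h
    have hs' : simpleT i * (simpleT j * simpleT i) = simpleT j * (simpleT i * simpleT j) := by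
      simpa [mul_assoc] using hs
    have n1 : lft i ≠ lft j := by rw [← hb]; exact (lft_lt_rgt i).ne
    have n2 : lft j ≠ rgt j := (lft_lt_rgt j).ne
    have n3 : lft i ≠ rgt j := by
      refine ((lft_lt_rgt i).trans ?_).ne
      rw [hb]; exact lft_lt_rgt j
    obtain ⟨c1, c2⟩ := coef_mul_coef v x n1 n2 n3
    have q1 := coef_sq v x (lft i) (lft j)
    have q2 := coef_sq v x (lft j) (rgt j)
    have h1x : x.act 1 = x := rfl
    simp only [Module.End.mul_apply, opG_single, map_add, map_smul, coef_act, simpleT_inv, h1, h2,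
      h3, h4, St.act_act, simpleT_lft, simpleT_rgt, simpleT_mul_self, hs', hb, h1x, mul_inv_rev,
      Equiv.Perm.mul_apply]
    linear_combination (norm := module)
      (u * c1) • Finsupp.single (x.act (simpleT i)) (1 : K)
      - (u * c2) • Finsupp.single (x.act (simpleT j)) (1 : K)
      + (coef v x (lft j) (rgt j) * q1 - coef v x (lft i) (lft j) * q2) • Finsupp.single x (1 : K)

theorem opG_mul_self (i : Fin (n - 1)) :
    (opG u v i * opG u v i : Module.End K (St n d →₀ K)) = algebraMap K _ (u ^ 2) +
      v • (opDiag (fun x => if x.1 (lft i) = x.1 (rgt i) then 1 else 0) * opG u v i) := by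
  refine end_ext fun x => ?_
  have a := coef_add_coef v x (lft_lt_rgt i).ne
  have b := coef_sq v x (lft i) (rgt i)
  have hc : ¬ x.1 (lft i) = x.1 (rgt i) → coef v x (lft i) (rgt i) = 0 := fun h => by
    simp [coef, h]
  have hact : (x.act (simpleT i)).act (simpleT i) = x := by
    rw [St.act_act, simpleT_mul_self]; rfl
  have e1 : (x.act (simpleT i)).1 (lft i) = x.1 (rgt i) := by
    simp only [St.act, Function.comp_apply, simpleT_inv, simpleT_lft]
  have e2 : (x.act (simpleT i)).1 (rgt i) = x.1 (lft i) := by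
    simp only [St.act, Function.comp_apply, simpleT_inv, simpleT_rgt]
  simp only [Module.End.mul_apply, opG_single, map_add, map_smul, coef_act, simpleT_inv, hact,
      simpleT_lft, simpleT_rgt, LinearMap.add_apply, LinearMap.smul_apply, opDiag_single,
      Module.algebraMap_end_apply, e1, e2]
  by_cases h : x.1 (lft i) = x.1 (rgt i)
  · simp only [h, if_true] at a ⊢
    linear_combination (norm := module) (u * a) • Finsupp.single (x.act (simpleT i)) (1 : K) +
      b • Finsupp.single x (1 : K)
  · simp only [h, Ne.symm h, if_false] at a ⊢
    rw [hc h] at a ⊢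
    linear_combination (norm := module) (u * a) • Finsupp.single (x.act (simpleT i)) (1 : K)

end Rep

/-! ### Universal properties -/

section Lift

/-- The families `g`, `t` satisfy the relations of the `ℤ/dℤ`-framed braid monoid. -/
structure IsFramed {A : Type*} [Monoid A] (d : ℕ) {n : ℕ} (g : Fin (n - 1) → A) (t : Fin n → A) :
    Prop extends IsBraid g where
  tt : ∀ i j, t i * t j = t j * t i
  gt : ∀ i j, g i * t j = t (simpleT i j) * g i
  tpow : ∀ j, t j ^ d = 1

variable {K : Type} [Field K] {d n : ℕ} {A : Type} [Ring A] [Algebra K A]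

section Y

variable {a b c : K}

theorem isFramed_gens : IsFramed d (gg : Fin (n - 1) → YAlg K d a b c n) tt where
  far i j h := by
    simpa [gg] using RingQuot.mkAlgHom_rel K (YRel.far (d := d) (a := a) (b := b) (c := c) i j h)
  braid i j h := by
    simpa [gg] using RingQuot.mkAlgHom_rel K (YRel.braid (d := d) (a := a) (b := b) (c := c) i j h)
  tt i j := by
    simpa [tt] using RingQuot.mkAlgHom_rel K (YRel.tt (d := d) (a := a) (b := b) (c := c) i j)
  gt i j := by
    simpa [tt, gg] using RingQuot.mkAlgHom_rel K (YRel.gt (d := d) (a := a) (b := b) (c := c) i j)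
  tpow j := by
    simpa [tt] using RingQuot.mkAlgHom_rel K (YRel.tpow (d := d) (a := a) (b := b) (c := c) j)

theorem gg_mul_self (i : Fin (n - 1)) : (gg i * gg i : YAlg K d a b c n) =
    algebraMap K _ a + b • ee i + c • (ee i * gg i) := by
  have := RingQuot.mkAlgHom_rel K (YRel.quad (d := d) (a := a) (b := b) (c := c) i)
  simp only [map_add, map_mul, map_smul, map_idem, AlgHom.commutes] at this
  exact this

/-- The universal property of `YAlg`. -/
def YAlg.lift {g : Fin (n - 1) → A} {t : Fin n → A} (h : IsFramed d g t)
    (hq : ∀ i, g i * g i = algebraMap K A a + b • idem K d (t (lft i)) (t (rgt i)) +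
      c • (idem K d (t (lft i)) (t (rgt i)) * g i)) : YAlg K d a b c n →ₐ[K] A :=
  RingQuot.liftAlgHom K ⟨FreeAlgebra.lift K fun x : Gen n => match x with
    | Gen.g i => g i
    | Gen.t j => t j, by
    intro x y hr
    cases hr with
    | far i j hij => simpa using h.far i j hij
    | braid i j hij => simpa using h.braid i j hij
    | tt i j => simpa using h.tt i j
    | gt i j => simpa using h.gt i j
    | tpow j => simpa using h.tpow j
    | quad i =>
      simp only [map_add, map_mul, map_smul, map_idem, AlgHom.commutes, FreeAlgebra.lift_ι_apply]
      exact hq i⟩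

theorem YAlg.lift_gg {g : Fin (n - 1) → A} {t : Fin n → A} (h : IsFramed d g t)
    (hq : ∀ i, g i * g i = algebraMap K A a + b • idem K d (t (lft i)) (t (rgt i)) +
      c • (idem K d (t (lft i)) (t (rgt i)) * g i)) (i : Fin (n - 1)) :
    YAlg.lift h hq (gg i) = g i := by
  simp [YAlg.lift, gg]

theorem YAlg.lift_tt {g : Fin (n - 1) → A} {t : Fin n → A} (h : IsFramed d g t)
    (hq : ∀ i, g i * g i = algebraMap K A a + b • idem K d (t (lft i)) (t (rgt i)) +
      c • (idem K d (t (lft i)) (t (rgt i)) * g i)) (j : Fin n) :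
    YAlg.lift h hq (tt j) = t j := by
  simp [YAlg.lift, tt]

theorem YAlg.hom_ext {f f' : YAlg K d a b c n →ₐ[K] A} (hg : ∀ i, f (gg i) = f' (gg i))
    (ht : ∀ j, f (tt j) = f' (tt j)) : f = f' := by
  refine RingQuot.ringQuot_ext' K _ _ (FreeAlgebra.hom_ext (funext fun x => ?_))
  cases x with
  | g i => exact hg i
  | t j => exact ht j

/-- Induction on the construction of an element from the generators by left multiplication. -/
theorem YAlg.induction_left {P : YAlg K d a b c n → Prop} (one : P 1)
    (add : ∀ x y, P x → P y → P (x + y)) (smul : ∀ (k : K) x, P x → P (k • x))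
    (g : ∀ i x, P x → P (gg i * x)) (t : ∀ j x, P x → P (tt j * x)) (x : YAlg K d a b c n) :
    P x := by
  obtain ⟨x, rfl⟩ := RingQuot.mkAlgHom_surjective K (YRel K d a b c n) x
  have : ∀ y, P y → P (RingQuot.mkAlgHom K (YRel K d a b c n) x * y) := by
    induction x using FreeAlgebra.induction with
    | grade0 r =>
      intro y hy
      rw [AlgHom.commutes, ← Algebra.smul_def]
      exact smul r y hy
    | grade1 x =>
      cases x with
      | g i => exact g i
      | t j => exact t j
    | mul x x' ih ih' =>
      intro y hy
      rw [map_mul, mul_assoc]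
      exact ih _ (ih' _ hy)
    | add x x' ih ih' =>
      intro y hy
      rw [map_add, add_mul]
      exact add _ _ (ih _ hy) (ih' _ hy)
  simpa using this 1 one

@[simp] theorem incl_gg (i : Fin (n - 1)) : incl a b c n (gg i : YAlg K d a b c n) =
    gg (extGen i) := by
  simp [incl, gg, extGen]

@[simp] theorem incl_tt (j : Fin n) : incl a b c n (tt j : YAlg K d a b c n) =
    tt j.castSucc := by
  simp [incl, tt]

end Y

section H

variable {u v : K}

theorem isBraid_T : IsBraid (Hecke.T K u v : Fin (n - 1) → Hecke K u v n) where
  far i j h := by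
    simpa [Hecke.T] using RingQuot.mkAlgHom_rel K (HeckeRel.far (u := u) (v := v) i j h)
  braid i j h := by
    simpa [Hecke.T] using RingQuot.mkAlgHom_rel K (HeckeRel.braid (u := u) (v := v) i j h)

theorem T_mul_self (i : Fin (n - 1)) : Hecke.T K u v i * Hecke.T K u v i =
    algebraMap K _ (u ^ 2) + v • Hecke.T K u v i := by
  have := RingQuot.mkAlgHom_rel K (HeckeRel.quad (u := u) (v := v) i)
  simp only [map_add, map_mul, map_smul, AlgHom.commutes] at this
  exact this

/-- The universal property of the Hecke algebra. -/
def Hecke.lift {g : Fin (n - 1) → A} (h : IsBraid g)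
    (hq : ∀ i, g i * g i = algebraMap K A (u ^ 2) + v • g i) : Hecke K u v n →ₐ[K] A :=
  RingQuot.liftAlgHom K ⟨FreeAlgebra.lift K g, by
    intro x y hr
    cases hr with
    | far i j hij => simpa using h.far i j hij
    | braid i j hij => simpa using h.braid i j hij
    | quad i =>
      simp only [map_add, map_mul, map_smul, AlgHom.commutes, FreeAlgebra.lift_ι_apply]
      exact hq i⟩

theorem Hecke.lift_T {g : Fin (n - 1) → A} (h : IsBraid g)
    (hq : ∀ i, g i * g i = algebraMap K A (u ^ 2) + v • g i) (i : Fin (n - 1)) :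
    Hecke.lift h hq (Hecke.T K u v i) = g i := by
  simp [Hecke.lift, Hecke.T]

theorem Hecke.induction_left {P : Hecke K u v n → Prop} (one : P 1)
    (add : ∀ x y, P x → P y → P (x + y)) (smul : ∀ (k : K) x, P x → P (k • x))
    (T : ∀ i x, P x → P (Hecke.T K u v i * x)) (x : Hecke K u v n) : P x := by
  obtain ⟨x, rfl⟩ := RingQuot.mkAlgHom_surjective K (HeckeRel K u v n) x
  have : ∀ y, P y → P (RingQuot.mkAlgHom K (HeckeRel K u v n) x * y) := by
    induction x using FreeAlgebra.induction with
    | grade0 r =>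
      intro y hy
      rw [AlgHom.commutes, ← Algebra.smul_def]
      exact smul r y hy
    | grade1 x => exact T x
    | mul x x' ih ih' =>
      intro y hy
      rw [map_mul, mul_assoc]
      exact ih _ (ih' _ hy)
    | add x x' ih ih' =>
      intro y hy
      rw [map_add, add_mul]
      exact add _ _ (ih _ hy) (ih' _ hy)
  simpa using this 1 one

@[simp] theorem Hecke.incl_T (i : Fin (n - 1)) :
    Hecke.incl K u v n (Hecke.T K u v i) = Hecke.T K u v (extGen i) := by
  simp [Hecke.incl, Hecke.T, extGen]

end H

end Lift

/-! ### The regular representations of the two families of algebras -/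

section RegRep

variable {K : Type} [Field K] {d n : ℕ} {u v : K}

theorem opDiag_idem {ξ : Fin d → K} (hξ : IsRootFamily ξ) (i j : Fin n) :
    idem K d (opDiag fun x : St n d => ξ (x.1 i)) (opDiag fun x : St n d => ξ (x.1 j)) =
      opDiag fun x => if x.1 i = x.1 j then 1 else 0 := by
  refine end_ext fun x => ?_
  have := idem_apply_eigen (d := d) (A := Module.End K (St n d →₀ K))
    (AlgHom.id K (Module.End K (St n d →₀ K)))
    (x := opDiag fun x : St n d => ξ (x.1 i)) (y := opDiag fun x : St n d => ξ (x.1 j))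
    (opDiag_single (fun x => ξ (x.1 i)) x) (opDiag_single (fun x => ξ (x.1 j)) x)
  rw [AlgHom.id_apply, idem_scalar hξ] at this
  rw [this, opDiag_single]

theorem isFramed_op (u v : K) {ξ : Fin d → K} (hξ : IsRootFamily ξ) :
    IsFramed d (opG u v : Fin (n - 1) → Module.End K (St n d →₀ K))
      (fun j => opDiag fun x => ξ (x.1 j)) where
  toIsBraid := isBraid_opG u v
  tt i j := end_ext fun x => by
    simp only [Module.End.mul_apply, opDiag_single, map_smul, smul_smul, mul_comm]
  gt i j := end_ext fun x => by
    simp only [Module.End.mul_apply, opDiag_single, map_smul, opG_single, map_add]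
    have h1 : (x.act (simpleT i)).1 (simpleT i j) = x.1 j := by
      simp only [St.act, Function.comp_apply, simpleT_inv, simpleT_simpleT]
    rw [h1]
    by_cases h : x.1 (lft i) = x.1 (rgt i)
    · have h2 : x.1 (simpleT i j) = x.1 j := by
        by_cases e1 : j = lft i
        · rw [e1, simpleT_lft, h]
        · by_cases e2 : j = rgt i
          · rw [e2, simpleT_rgt, h]
          · rw [simpleT_of_ne e1 e2]
      rw [h2]
      module
    · have : coef v x (lft i) (rgt i) = 0 := by simp [coef, h]
      rw [this]
      module
  tpow j := end_ext fun x => by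
    have := pow_apply_eigen (A := Module.End K (St n d →₀ K))
      (AlgHom.id K (Module.End K (St n d →₀ K)))
      (x := opDiag fun x : St n d => ξ (x.1 j)) (opDiag_single (fun x => ξ (x.1 j)) x) d
    rw [AlgHom.id_apply, hξ.pow] at this
    simpa using this

/-- The regular representation of `Y_{d,n}`. -/
def yRep (u v : K) {ξ : Fin d → K} (hξ : IsRootFamily ξ) (n : ℕ) :
    Y K d u v n →ₐ[K] Module.End K (St n d →₀ K) :=
  YAlg.lift (A := Module.End K (St n d →₀ K)) (isFramed_op u v hξ) fun i => by
    rw [opDiag_idem hξ, opG_mul_self]; simp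

/-- The regular representation of `H_n`. -/
def hRep (u v : K) (n : ℕ) : Hecke K u v n →ₐ[K] Module.End K (St n 1 →₀ K) :=
  Hecke.lift (A := Module.End K (St n 1 →₀ K)) (isBraid_opG u v) fun i => by
    rw [opG_mul_self]
    congr 2
    refine end_ext fun x => ?_
    have : ∀ c : St n 1, c.1 (lft i) = c.1 (rgt i) := fun c => Subsingleton.elim _ _
    have h1 : (opDiag fun x : St n 1 => if x.1 (lft i) = x.1 (rgt i) then (1 : K) else 0) = 1 :=
      end_ext fun x => by simp [opDiag_single, this]
    rw [h1, one_mul]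

/-- A word of minimal length acts on the identity coloured by `χ` without correction terms. -/
theorem wordProd_opG (u v : K) (w : Equiv.Perm (Fin n)) (χ : Fin n → Fin d) :
    wordProd (opG u v) w (Finsupp.single (χ ∘ w, 1) 1) =
      u ^ ell w • Finsupp.single (χ, w) (1 : K) := by
  induction w using asc_induction generalizing χ with
  | one => simp
  | step i w h ih =>
    have e1 : χ ∘ ⇑(simpleT i * w) = (χ ∘ simpleT i) ∘ w := rfl
    have e2 : St.act (simpleT i) (χ ∘ simpleT i, w) = (χ, simpleT i * w) := by
      simp [St.act, Function.comp_assoc]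
      ext; simp
    have e3 : coef v (χ ∘ simpleT i, w) (lft i) (rgt i) = 0 := if_neg fun h' => h'.2.not_gt h
    rw [(isBraid_opG u v).wordProd_simpleT_mul h, Module.End.mul_apply, e1, ih, map_smul,
      opG_single, e2, e3, ell_simpleT_mul h, smul_add, smul_smul, pow_succ]
    simp

end RegRep

/-! ### The basis `E_χ g̃_w` of the Yokonuma–Hecke algebra -/

section Proj

variable {K : Type} [Field K] {d : ℕ} {A : Type} [Ring A] [Algebra K A] {ξ : Fin d → K}

theorem mul_idem_algebraMap (hξ : IsRootFamily ξ) (a : Fin d) {t : A} (ht : t ^ d = 1) :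
    t * idem K d (algebraMap K A (ξ a)) t = ξ a • idem K d (algebraMap K A (ξ a)) t := by
  have h1 : (∑ s ∈ Finset.range d, algebraMap K A (ξ a) ^ s * t ^ (d - s)) =
      (∑ s ∈ Finset.range d, algebraMap K A (ξ a) ^ s * t ^ (d - 1 - s)) * t := by
    rw [Finset.sum_mul]
    refine Finset.sum_congr rfl fun s hs => ?_
    have := Finset.mem_range.1 hs
    rw [mul_assoc, ← pow_succ, show d - 1 - s + 1 = d - s by omega]
  have hc : Commute (algebraMap K A (ξ a)) t := Algebra.commutes _ _
  have h2 := hc.mul_geom_sum₂ d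
  rw [← map_pow, hξ.pow, ht, map_one, sub_self, sub_mul, sub_eq_zero, ← Algebra.smul_def] at h2
  rw [idem, h1, mul_smul_comm, ← mul_assoc, ← h2, smul_mul_assoc, smul_comm]

theorem sum_idem_algebraMap (hξ : IsRootFamily ξ) {t : A} (ht : t ^ d = 1) :
    ∑ a, idem K d (algebraMap K A (ξ a)) t = 1 := by
  have hd : 0 < d := Nat.pos_of_ne_zero fun h => hξ.ne_zero (by simp [h])
  simp only [idem, ← Finset.smul_sum]
  rw [Finset.sum_comm]
  simp only [← map_pow, ← Algebra.smul_def, ← Finset.sum_smul]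
  rw [Finset.sum_eq_single_of_mem 0 (Finset.mem_range.2 hd)]
  · simp [ht, smul_smul, hξ.ne_zero]
  · intro s hs h0
    rw [hξ.sum s (Nat.pos_of_ne_zero h0) (Finset.mem_range.1 hs), zero_smul]

theorem commute_prod_ofFn {n : ℕ} {F : Fin n → A} {z : A} (h : ∀ i, Commute z (F i)) :
    Commute z (List.ofFn F).prod := by
  induction n with
  | zero => simp
  | succ n ih =>
    rw [List.ofFn_succ, List.prod_cons]
    exact (h 0).mul_right (ih fun i => h i.succ)

theorem mul_prod_ofFn {n : ℕ} {F : Fin n → A} {z : A} (h : ∀ i, Commute z (F i)) {c : K}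
    {j : Fin n} (hj : z * F j = c • F j) : z * (List.ofFn F).prod = c • (List.ofFn F).prod := by
  induction n with
  | zero => exact j.elim0
  | succ n ih =>
    rw [List.ofFn_succ, List.prod_cons]
    cases j using Fin.cases with
    | zero => rw [← mul_assoc, hj, smul_mul_assoc]
    | succ j =>
      rw [← mul_assoc, (h 0).eq, mul_assoc, ih (fun i => h i.succ) hj, mul_smul_comm]

theorem sum_prod_ofFn {n : ℕ} (F : Fin n → Fin d → A) :
    ∑ χ : Fin n → Fin d, (List.ofFn fun i => F i (χ i)).prod =
      (List.ofFn fun i => ∑ a, F i a).prod := by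
  induction n with
  | zero => simp
  | succ n ih =>
    rw [← (Fin.consEquiv fun _ => Fin d).sum_comp, Fintype.sum_prod_type, List.ofFn_succ,
      List.prod_cons, ← ih, Finset.sum_mul_sum]
    simp [Fin.consEquiv, List.ofFn_succ]

theorem prod_ofFn_apply_eigen {n : ℕ} {M : Type*} [AddCommGroup M] [Module K M]
    (f : A →ₐ[K] Module.End K M) {F : Fin n → A} {c : Fin n → K} {m : M}
    (h : ∀ i, f (F i) m = c i • m) : f (List.ofFn F).prod m = (∏ i, c i) • m := by
  induction n with
  | zero => simp
  | succ n ih =>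
    rw [List.ofFn_succ, List.prod_cons, map_mul, Module.End.mul_apply, ih fun i => h i.succ,
      map_smul, h 0, smul_smul, Fin.prod_univ_succ, mul_comm]

end Proj

section YBasis

variable {K : Type} [Field K] {d n : ℕ} {u v : K} {ξ : Fin d → K}

/-- `E_ψ` is the projection onto the simultaneous eigenspace of the `t_j` with eigenvalues `ψ`. -/
theorem Echi_apply (hξ : IsRootFamily ξ) {M : Type*} [AddCommGroup M] [Module K M]
    (f : Y K d u v n →ₐ[K] Module.End K M) {χ : Fin n → Fin d} {m : M}
    (h : ∀ j, f (tt j) m = ξ (χ j) • m) (ψ : Fin n → Fin d) :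
    f (Echi ξ u v ψ) m = if ψ = χ then m else 0 := by
  rw [Echi, prod_ofFn_apply_eigen f (c := fun i => if ψ i = χ i then 1 else 0)]
  · split_ifs with he
    · simp [he]
    · obtain ⟨j, hj⟩ := Function.ne_iff.1 he
      rw [Finset.prod_eq_zero (Finset.mem_univ j) (if_neg hj), zero_smul]
  · intro i
    rw [← idem_scalar hξ]
    exact idem_apply_eigen f (by simp) (h i)

theorem commute_tt_Echi (j : Fin n) (χ : Fin n → Fin d) :
    Commute (tt j : Y K d u v n) (Echi ξ u v χ) :=
  commute_prod_ofFn fun i => idem_commute (Algebra.commutes _ _).symm (isFramed_gens.tt j i)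

theorem tt_mul_Echi (hξ : IsRootFamily ξ) (j : Fin n) (χ : Fin n → Fin d) :
    tt j * Echi ξ u v χ = ξ (χ j) • Echi ξ u v χ :=
  mul_prod_ofFn (fun i => idem_commute (Algebra.commutes _ _).symm (isFramed_gens.tt j i))
    (j := j) (mul_idem_algebraMap hξ _ (isFramed_gens.tpow j))

theorem Echi_mul_tt (hξ : IsRootFamily ξ) (j : Fin n) (χ : Fin n → Fin d) :
    Echi ξ u v χ * tt j = ξ (χ j) • Echi ξ u v χ := by
  rw [← (commute_tt_Echi j χ).eq, tt_mul_Echi hξ]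

theorem sum_Echi (hξ : IsRootFamily ξ) : ∑ χ : Fin n → Fin d, Echi ξ u v χ = 1 := by
  simp only [Echi]
  rw [sum_prod_ofFn fun i a => idem K d (algebraMap K (Y K d u v n) (ξ a)) (tt i)]
  simp only [sum_idem_algebraMap hξ (isFramed_gens.tpow _)]
  simp

theorem Echi_mul_of_eigen (hξ : IsRootFamily ξ) {χ : Fin n → Fin d} {y : Y K d u v n}
    (h : ∀ j, tt j * y = ξ (χ j) • y) (ψ : Fin n → Fin d) :
    Echi ξ u v ψ * y = if ψ = χ then y else 0 :=
  Echi_apply hξ (Algebra.lmul K _) h ψ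

theorem Echi_mul_Echi (hξ : IsRootFamily ξ) (ψ χ : Fin n → Fin d) :
    Echi ξ u v ψ * Echi ξ u v χ = if ψ = χ then Echi ξ u v χ else 0 :=
  Echi_mul_of_eigen hξ (fun j => tt_mul_Echi hξ j χ) ψ

theorem Emu_mul_Echi (hξ : IsRootFamily ξ) (μ : Fin d → ℕ) (χ : Fin n → Fin d) :
    Emu ξ u v n μ * Echi ξ u v χ =
      if ∀ a, (positions χ a).card = μ a then Echi ξ u v χ else 0 := by
  rw [Emu, Finset.sum_mul]
  simp only [Echi_mul_Echi hξ]
  split_ifs with h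
  · rw [Finset.sum_eq_single (⟨χ, h⟩ : Orbit n μ)]
    · simp
    · intro ψ _ hne
      exact if_neg fun he => hne (Subtype.ext he)
    · simp
  · exact Finset.sum_eq_zero fun ψ _ => if_neg fun he => h fun a => by rw [← he]; exact ψ.2 a

theorem gg_mul_Echi (hξ : IsRootFamily ξ) (i : Fin (n - 1)) (χ : Fin n → Fin d) :
    gg i * Echi ξ u v χ = Echi ξ u v (χ ∘ simpleT i) * gg i := by
  have h1 : ∀ ψ, Echi ξ u v ψ * (gg i * Echi ξ u v χ) =
      if ψ = χ ∘ simpleT i then gg i * Echi ξ u v χ else 0 := by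
    refine Echi_mul_of_eigen hξ fun j => ?_
    have : tt j * gg i = gg i * (tt (simpleT i j) : Y K d u v n) := by
      rw [isFramed_gens.gt, simpleT_simpleT]
    rw [← mul_assoc, this, mul_assoc, tt_mul_Echi hξ, mul_smul_comm]; rfl
  have h2 : ∀ ψ ≠ χ, Echi ξ u v (χ ∘ simpleT i) * gg i * Echi ξ u v ψ = 0 := by
    intro ψ hψ
    have : ∀ φ, Echi ξ u v φ * (gg i * Echi ξ u v ψ) =
        if φ = ψ ∘ simpleT i then gg i * Echi ξ u v ψ else 0 := by
      refine Echi_mul_of_eigen hξ fun j => ?_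
      have : tt j * gg i = gg i * (tt (simpleT i j) : Y K d u v n) := by
        rw [isFramed_gens.gt, simpleT_simpleT]
      rw [← mul_assoc, this, mul_assoc, tt_mul_Echi hξ, mul_smul_comm]; rfl
    rw [mul_assoc, this, if_neg]
    intro he
    exact hψ ((simpleT i).surjective.injective_comp_right he).symm
  calc gg i * Echi ξ u v χ = Echi ξ u v (χ ∘ simpleT i) * gg i * Echi ξ u v χ := by
        rw [mul_assoc, h1, if_pos rfl]
    _ = Echi ξ u v (χ ∘ simpleT i) * gg i * ∑ ψ, Echi ξ u v ψ := by
        rw [Finset.mul_sum, Finset.sum_eq_single χ (fun ψ _ h => h2 ψ h) (by simp)]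
    _ = _ := by rw [sum_Echi hξ, mul_one]

theorem Echi_mul_gg (hξ : IsRootFamily ξ) (i : Fin (n - 1)) (χ : Fin n → Fin d) :
    Echi ξ u v χ * gg i = gg i * Echi ξ u v (χ ∘ simpleT i) := by
  rw [gg_mul_Echi hξ]
  congr 2
  ext; simp

theorem ee_mul_Echi (hξ : IsRootFamily ξ) (i : Fin (n - 1)) (χ : Fin n → Fin d) :
    ee i * Echi ξ u v χ =
      (if χ (lft i) = χ (rgt i) then (1 : K) else 0) • Echi ξ u v χ := by
  rw [← idem_scalar hξ]
  exact idem_apply_eigen (Algebra.lmul K (Y K d u v n)) (tt_mul_Echi hξ _ χ) (tt_mul_Echi hξ _ χ)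

theorem commute_ee_Echi (i : Fin (n - 1)) (χ : Fin n → Fin d) :
    Commute (ee i : Y K d u v n) (Echi ξ u v χ) :=
  (idem_commute (commute_tt_Echi _ χ).symm (commute_tt_Echi _ χ).symm).symm

theorem commute_ee_gg {a b c : K} (i : Fin (n - 1)) :
    Commute (ee i : YAlg K d a b c n) (gg i) := by
  have h := isFramed_gens (K := K) (d := d) (a := a) (b := b) (c := c) (n := n)
  have := idem_intertwine (K := K) (d := d) (h.gt i (lft i)) (h.gt i (rgt i))
  rw [simpleT_lft, simpleT_rgt, idem_comm (h.tt _ _) (h.tpow (rgt i)) (h.tpow (lft i))] at this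
  exact this.symm

theorem gt_eq (w : Equiv.Perm (Fin n)) :
    gt u v w = (u⁻¹ ^ ell w) • wordProd (gg : Fin (n - 1) → Y K d u v n) w := rfl

@[simp] theorem gt_one : gt u v (1 : Equiv.Perm (Fin n)) = (1 : Y K d u v n) := by
  simp [gt_eq]

theorem gg_mul_gt_of_asc (hu : u ≠ 0) {i : Fin (n - 1)} {w : Equiv.Perm (Fin n)} (h : Asc i w) :
    (gg i * gt u v w : Y K d u v n) = u • gt u v (simpleT i * w) := by
  rw [gt_eq, gt_eq, isFramed_gens.wordProd_simpleT_mul h, ell_simpleT_mul h, mul_smul_comm,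
    smul_smul, pow_succ' u⁻¹, mul_inv_cancel_left₀ hu]

theorem gt_mul_gg_of_asc (hu : u ≠ 0) {i : Fin (n - 1)} {w : Equiv.Perm (Fin n)}
    (h : w (lft i) < w (rgt i)) :
    (gt u v w * gg i : Y K d u v n) = u • gt u v (w * simpleT i) := by
  rw [gt_eq, gt_eq, isFramed_gens.wordProd_mul_simpleT h, ell_mul_simpleT h, smul_mul_assoc,
    smul_smul, pow_succ' u⁻¹, mul_inv_cancel_left₀ hu]

theorem gg_mul_gt (hu : u ≠ 0) (i : Fin (n - 1)) (w : Equiv.Perm (Fin n)) :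
    (gg i * gt u v w : Y K d u v n) = u • gt u v (simpleT i * w) +
      (if Asc i w then 0 else v) • (ee i * gt u v w) := by
  split_ifs with h
  · rw [gg_mul_gt_of_asc hu h, zero_smul, add_zero]
  · have h1 := gg_mul_gt_of_asc (d := d) (v := v) hu ((asc_simpleT_mul i w).2 h)
    rw [simpleT_mul_self_mul] at h1
    have h2 : gt u v w = u⁻¹ • (gg i * gt u v (simpleT i * w) : Y K d u v n) := by
      rw [h1, smul_smul, inv_mul_cancel₀ hu, one_smul]
    have hu2 : u⁻¹ * u ^ 2 = u := by field_simp
    rw [h2, mul_smul_comm, mul_smul_comm, ← mul_assoc, gg_mul_self, zero_smul, add_zero, add_mul,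
      ← Algebra.smul_def, smul_mul_assoc, smul_add, smul_smul, ← mul_assoc, hu2,
      smul_comm]

theorem gt_mul_gg (hu : u ≠ 0) (i : Fin (n - 1)) (w : Equiv.Perm (Fin n)) :
    (gt u v w * gg i : Y K d u v n) = u • gt u v (w * simpleT i) +
      (if w (lft i) < w (rgt i) then 0 else v) • (gt u v w * ee i) := by
  split_ifs with h
  · rw [gt_mul_gg_of_asc hu h, zero_smul, add_zero]
  · have h' : (w * simpleT i) (lft i) < (w * simpleT i) (rgt i) := by
      simp only [Equiv.Perm.mul_apply, simpleT_lft, simpleT_rgt]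
      exact lt_of_le_of_ne (not_lt.1 h) fun h => (lft_lt_rgt i).ne (w.injective h).symm
    have h1 := gt_mul_gg_of_asc (d := d) (v := v) hu h'
    rw [mul_simpleT_mul_self] at h1
    have h2 : gt u v w = u⁻¹ • (gt u v (w * simpleT i) * gg i : Y K d u v n) := by
      rw [h1, smul_smul, inv_mul_cancel₀ hu, one_smul]
    have hu2 : u⁻¹ * u ^ 2 = u := by field_simp
    rw [h2, smul_mul_assoc, smul_mul_assoc, mul_assoc, gg_mul_self, zero_smul, add_zero, mul_add,
      ← Algebra.commutes, ← Algebra.smul_def, mul_smul_comm, smul_add, smul_smul, mul_assoc,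
      (commute_ee_gg i).eq, hu2, smul_comm]

theorem Echi_mul_gt (hξ : IsRootFamily ξ) (hu : u ≠ 0) (χ : Fin n → Fin d)
    (w : Equiv.Perm (Fin n)) : Echi ξ u v χ * gt u v w = gt u v w * Echi ξ u v (χ ∘ w) := by
  induction w using asc_induction generalizing χ with
  | one => simp
  | step i w h ih =>
    have h2 : gt u v (simpleT i * w) = u⁻¹ • (gg i * gt u v w : Y K d u v n) := by
      rw [gg_mul_gt_of_asc hu h, smul_smul, inv_mul_cancel₀ hu, one_smul]
    rw [h2, mul_smul_comm, smul_mul_assoc, ← mul_assoc, Echi_mul_gg hξ, mul_assoc, ih, mul_assoc]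
    rfl

theorem tt_mul_basis (hξ : IsRootFamily ξ) (j : Fin n) (χ : Fin n → Fin d)
    (w : Equiv.Perm (Fin n)) :
    tt j * (Echi ξ u v χ * gt u v w) = ξ (χ j) • (Echi ξ u v χ * gt u v w) := by
  rw [← mul_assoc, tt_mul_Echi hξ, smul_mul_assoc]

theorem basis_mul_tt (hξ : IsRootFamily ξ) (hu : u ≠ 0) (j : Fin n) (χ : Fin n → Fin d)
    (w : Equiv.Perm (Fin n)) :
    Echi ξ u v χ * gt u v w * tt j = ξ (χ (w j)) • (Echi ξ u v χ * gt u v w) := by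
  rw [Echi_mul_gt hξ hu, mul_assoc, Echi_mul_tt hξ, mul_smul_comm]; rfl

theorem basis_mul_ee (hξ : IsRootFamily ξ) (hu : u ≠ 0) (i : Fin (n - 1)) (χ : Fin n → Fin d)
    (w : Equiv.Perm (Fin n)) : Echi ξ u v χ * gt u v w * ee i =
      (if χ (w (lft i)) = χ (w (rgt i)) then (1 : K) else 0) • (Echi ξ u v χ * gt u v w) := by
  rw [Echi_mul_gt hξ hu, mul_assoc, ← (commute_ee_Echi i _).eq, ee_mul_Echi hξ, mul_smul_comm]; rfl

theorem gg_mul_basis (hξ : IsRootFamily ξ) (hu : u ≠ 0) (i : Fin (n - 1)) (χ : Fin n → Fin d)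
    (w : Equiv.Perm (Fin n)) : gg i * (Echi ξ u v χ * gt u v w) =
      u • (Echi ξ u v (χ ∘ simpleT i) * gt u v (simpleT i * w)) +
      (if χ (lft i) = χ (rgt i) ∧ ¬ Asc i w then v else 0) • (Echi ξ u v χ * gt u v w) := by
  rw [← mul_assoc, gg_mul_Echi hξ, mul_assoc, gg_mul_gt hu, mul_add, mul_smul_comm, mul_smul_comm,
    ← mul_assoc _ (ee i), ← (commute_ee_Echi i _).eq, ee_mul_Echi hξ, smul_mul_assoc]
  simp only [Function.comp_apply, simpleT_lft, simpleT_rgt]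
  by_cases h1 : χ (lft i) = χ (rgt i)
  · have : χ ∘ simpleT i = χ := by
      funext j
      by_cases e1 : j = lft i
      · simp [e1, h1]
      · by_cases e2 : j = rgt i
        · simp [e2, h1]
        · simp [simpleT_of_ne e1 e2]
    by_cases h2 : Asc i w <;> simp [h1, h2, this]
  · simp [h1, Ne.symm h1]

theorem basis_mul_gg (hξ : IsRootFamily ξ) (hu : u ≠ 0) (i : Fin (n - 1)) (χ : Fin n → Fin d)
    (w : Equiv.Perm (Fin n)) : Echi ξ u v χ * gt u v w * gg i =
      u • (Echi ξ u v χ * gt u v (w * simpleT i)) +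
      (if χ (w (lft i)) = χ (w (rgt i)) ∧ ¬ w (lft i) < w (rgt i) then v else 0) •
        (Echi ξ u v χ * gt u v w) := by
  rw [mul_assoc, gt_mul_gg hu, mul_add, mul_smul_comm, mul_smul_comm, ← mul_assoc _ _ (ee i),
    basis_mul_ee hξ hu]
  by_cases h1 : χ (w (lft i)) = χ (w (rgt i)) <;> by_cases h2 : w (lft i) < w (rgt i) <;>
    simp [h1, h2]

theorem mem_span_basis (hξ : IsRootFamily ξ) (hu : u ≠ 0) (x : Y K d u v n) :
    x ∈ Submodule.span K (Set.range fun p : St n d => Echi ξ u v p.1 * gt u v p.2) := by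
  have hb : ∀ χ w, Echi ξ u v χ * gt u v w ∈
      Submodule.span K (Set.range fun p : St n d => Echi ξ u v p.1 * gt u v p.2) :=
    fun χ w => Submodule.subset_span ⟨(χ, w), rfl⟩
  induction x using YAlg.induction_left with
  | one =>
    rw [← sum_Echi hξ]
    refine Submodule.sum_mem _ fun χ _ => ?_
    simpa using hb χ 1
  | add x y hx hy => exact Submodule.add_mem _ hx hy
  | smul k x hx => exact Submodule.smul_mem _ k hx
  | g i x hx =>
    induction hx using Submodule.span_induction with
    | mem x hx =>
      obtain ⟨p, rfl⟩ := hx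
      simp only
      rw [gg_mul_basis hξ hu]
      exact Submodule.add_mem _ (Submodule.smul_mem _ _ (hb _ _)) (Submodule.smul_mem _ _ (hb _ _))
    | zero => simp
    | add x y _ _ hx hy => rw [mul_add]; exact Submodule.add_mem _ hx hy
    | smul k x _ hx => rw [mul_smul_comm]; exact Submodule.smul_mem _ k hx
  | t j x hx =>
    induction hx using Submodule.span_induction with
    | mem x hx =>
      obtain ⟨p, rfl⟩ := hx
      simp only
      rw [tt_mul_basis hξ]
      exact Submodule.smul_mem _ _ (hb _ _)
    | zero => simp
    | add x y _ _ hx hy => rw [mul_add]; exact Submodule.add_mem _ hx hy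
    | smul k x _ hx => rw [mul_smul_comm]; exact Submodule.smul_mem _ k hx

theorem linearMap_ext_basis (hξ : IsRootFamily ξ) (hu : u ≠ 0) {N : Type*} [AddCommGroup N]
    [Module K N] {f f' : Y K d u v n →ₗ[K] N}
    (h : ∀ χ w, f (Echi ξ u v χ * gt u v w) = f' (Echi ξ u v χ * gt u v w)) : f = f' := by
  ext x
  exact LinearMap.eqOn_span (s := Set.range fun p : St n d => Echi ξ u v p.1 * gt u v p.2)
    (by rintro _ ⟨p, rfl⟩; exact h p.1 p.2) (mem_span_basis hξ hu x)

/-- The coordinates with respect to the basis `E_χ g̃_w`: an element acts on the vector that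
represents `1`. -/
def coords (u v : K) {ξ : Fin d → K} (hξ : IsRootFamily ξ) (n : ℕ) :
    Y K d u v n →ₗ[K] (St n d →₀ K) :=
  (LinearMap.applyₗ (∑ χ : Fin n → Fin d, Finsupp.single ((χ, 1) : St n d) (1 : K))) ∘ₗ
    (yRep u v hξ n).toLinearMap

theorem coords_basis (hξ : IsRootFamily ξ) (hu : u ≠ 0) (χ : Fin n → Fin d)
    (w : Equiv.Perm (Fin n)) : coords u v hξ n (Echi ξ u v χ * gt u v w) =
      Finsupp.single (χ, w) 1 := by
  have h1 : ∀ i, yRep u v hξ n (gg i) = opG u v i := YAlg.lift_gg _ _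
  have h2 : ∀ j, yRep u v hξ n (tt j) = opDiag fun x => ξ (x.1 j) := YAlg.lift_tt _ _
  have h3 : yRep u v hξ n (gt u v w)
      (∑ χ : Fin n → Fin d, Finsupp.single ((χ, 1) : St n d) (1 : K)) =
      ∑ χ : Fin n → Fin d, Finsupp.single ((χ, w) : St n d) (1 : K) := by
    have hw := map_wordProd (yRep u v hξ n) (gg : Fin (n - 1) → _) w
    simp only [h1] at hw
    rw [gt_eq, map_smul, hw, LinearMap.smul_apply, map_sum, Finset.smul_sum,
      ← (w.arrowCongr (Equiv.refl (Fin d))).symm.sum_comp]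
    refine Finset.sum_congr rfl fun χ _ => ?_
    have := wordProd_opG u v w χ
    have e : (w.arrowCongr (Equiv.refl (Fin d))).symm χ = χ ∘ w := by ext; simp
    rw [e]
    refine (congrArg _ this).trans ?_
    rw [smul_smul, ← mul_pow, inv_mul_cancel₀ hu, one_pow, one_smul]
  have h4 : coords u v hξ n (Echi ξ u v χ * gt u v w) = yRep u v hξ n (Echi ξ u v χ)
      (∑ χ : Fin n → Fin d, Finsupp.single ((χ, w) : St n d) (1 : K)) := by
    rw [← h3]
    simp [coords]
  rw [h4, map_sum, Finset.sum_eq_single χ]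
  · rw [Echi_apply hξ _ (χ := χ) fun j => by rw [h2, opDiag_single], if_pos rfl]
  · intro ψ _ hne
    rw [Echi_apply hξ _ (χ := ψ) fun j => by rw [h2, opDiag_single], if_neg hne.symm]
  · simp

/-- The linear map on `Y_{d,n}` with the given values on the basis `E_χ g̃_w`. -/
def constr (u v : K) {ξ : Fin d → K} (hξ : IsRootFamily ξ) {N : Type*} [AddCommGroup N]
    [Module K N] (F : (Fin n → Fin d) → Equiv.Perm (Fin n) → N) : Y K d u v n →ₗ[K] N :=
  Finsupp.linearCombination K (fun p : St n d => F p.1 p.2) ∘ₗ coords u v hξ n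

theorem constr_basis (hξ : IsRootFamily ξ) (hu : u ≠ 0) {N : Type*} [AddCommGroup N]
    [Module K N] (F : (Fin n → Fin d) → Equiv.Perm (Fin n) → N) (χ : Fin n → Fin d)
    (w : Equiv.Perm (Fin n)) : constr u v hξ F (Echi ξ u v χ * gt u v w) = F χ w := by
  rw [constr, LinearMap.comp_apply, coords_basis hξ hu]
  simp

/-- On no strands the only basis element is `1`. -/
theorem basis_zero (hξ : IsRootFamily ξ) (χ : Fin 0 → Fin d) (w : Equiv.Perm (Fin 0)) :
    (Echi ξ u v χ * gt u v w : Y K d u v 0) = 1 := by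
  rw [Subsingleton.elim w 1, gt_one, mul_one, ← sum_Echi hξ, Fintype.sum_unique,
    Subsingleton.elim χ default]

theorem Echi_snoc (χ : Fin n → Fin d) (c : Fin d) :
    Echi ξ u v (Fin.snoc χ c : Fin (n + 1) → Fin d) = incl _ _ _ n (Echi ξ u v χ) *
      idem K d (algebraMap K (Y K d u v (n + 1)) (ξ c)) (tt (Fin.last n)) := by
  rw [Echi, List.ofFn_succ', List.prod_concat, Fin.snoc_last, Echi, map_list_prod, List.map_ofFn]
  congr 3
  funext i
  simp [map_idem]

theorem incl_Echi (hξ : IsRootFamily ξ) (χ : Fin n → Fin d) :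
    incl _ _ _ n (Echi ξ u v χ) =
      ∑ c, Echi ξ u v (Fin.snoc χ c : Fin (n + 1) → Fin d) := by
  simp only [Echi_snoc]
  rw [← Finset.mul_sum, sum_idem_algebraMap hξ (isFramed_gens.tpow _), mul_one]

theorem incl_gt (w : Equiv.Perm (Fin n)) :
    incl _ _ _ n (gt u v w : Y K d u v n) = gt u v (extPerm w) := by
  rw [gt_eq, gt_eq, map_smul, ell_extPerm, wordProd_extPerm isFramed_gens.toIsBraid]
  have hw := map_wordProd (incl (d := d) (u ^ 2) 0 v n) (gg : Fin (n - 1) → _) w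
  simp only [incl_gg] at hw
  rw [hw]

theorem incl_basis (hξ : IsRootFamily ξ) (χ : Fin n → Fin d) (w : Equiv.Perm (Fin n)) :
    incl _ _ _ n (Echi ξ u v χ * gt u v w) =
      ∑ c, Echi ξ u v (Fin.snoc χ c : Fin (n + 1) → Fin d) * gt u v (extPerm w) := by
  rw [map_mul, incl_Echi hξ, incl_gt, Finset.sum_mul]

end YBasis

/-! ### The Ocneanu trace on Iwahori–Hecke algebras -/

section HeckeBasis

variable {K : Type} [Field K] {n : ℕ} {u v : K}

theorem Tt_eq (w : Equiv.Perm (Fin n)) :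
    Hecke.Tt K u v w = (u⁻¹ ^ ell w) • wordProd (Hecke.T K u v) w := rfl

@[simp] theorem Tt_one : Hecke.Tt K u v (1 : Equiv.Perm (Fin n)) = 1 := by
  simp [Tt_eq]

theorem T_mul_Tt_of_asc (hu : u ≠ 0) {i : Fin (n - 1)} {w : Equiv.Perm (Fin n)} (h : Asc i w) :
    Hecke.T K u v i * Hecke.Tt K u v w = u • Hecke.Tt K u v (simpleT i * w) := by
  rw [Tt_eq, Tt_eq, isBraid_T.wordProd_simpleT_mul h, ell_simpleT_mul h, mul_smul_comm,
    smul_smul, pow_succ' u⁻¹, mul_inv_cancel_left₀ hu]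

theorem Tt_mul_T_of_asc (hu : u ≠ 0) {i : Fin (n - 1)} {w : Equiv.Perm (Fin n)}
    (h : w (lft i) < w (rgt i)) :
    Hecke.Tt K u v w * Hecke.T K u v i = u • Hecke.Tt K u v (w * simpleT i) := by
  rw [Tt_eq, Tt_eq, isBraid_T.wordProd_mul_simpleT h, ell_mul_simpleT h, smul_mul_assoc,
    smul_smul, pow_succ' u⁻¹, mul_inv_cancel_left₀ hu]

theorem T_mul_Tt (hu : u ≠ 0) (i : Fin (n - 1)) (w : Equiv.Perm (Fin n)) :
    Hecke.T K u v i * Hecke.Tt K u v w = u • Hecke.Tt K u v (simpleT i * w) +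
      (if Asc i w then 0 else v) • Hecke.Tt K u v w := by
  split_ifs with h
  · rw [T_mul_Tt_of_asc hu h, zero_smul, add_zero]
  · have h1 := T_mul_Tt_of_asc (v := v) hu ((asc_simpleT_mul i w).2 h)
    rw [simpleT_mul_self_mul] at h1
    have h2 : Hecke.Tt K u v w = u⁻¹ • (Hecke.T K u v i * Hecke.Tt K u v (simpleT i * w)) := by
      rw [h1, smul_smul, inv_mul_cancel₀ hu, one_smul]
    have hu2 : u⁻¹ * u ^ 2 = u := by field_simp
    rw [h2, mul_smul_comm, ← mul_assoc, T_mul_self, add_mul, ← Algebra.smul_def, smul_mul_assoc,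
      smul_add, smul_smul, hu2, smul_comm]

theorem Tt_mul_T (hu : u ≠ 0) (i : Fin (n - 1)) (w : Equiv.Perm (Fin n)) :
    Hecke.Tt K u v w * Hecke.T K u v i = u • Hecke.Tt K u v (w * simpleT i) +
      (if w (lft i) < w (rgt i) then 0 else v) • Hecke.Tt K u v w := by
  split_ifs with h
  · rw [Tt_mul_T_of_asc hu h, zero_smul, add_zero]
  · have h' : (w * simpleT i) (lft i) < (w * simpleT i) (rgt i) := by
      simp only [Equiv.Perm.mul_apply, simpleT_lft, simpleT_rgt]
      exact lt_of_le_of_ne (not_lt.1 h) fun h => (lft_lt_rgt i).ne (w.injective h).symm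
    have h1 := Tt_mul_T_of_asc (v := v) hu h'
    rw [mul_simpleT_mul_self] at h1
    have h2 : Hecke.Tt K u v w = u⁻¹ • (Hecke.Tt K u v (w * simpleT i) * Hecke.T K u v i) := by
      rw [h1, smul_smul, inv_mul_cancel₀ hu, one_smul]
    have hu2 : u⁻¹ * u ^ 2 = u := by field_simp
    rw [h2, smul_mul_assoc, mul_assoc, T_mul_self, mul_add, ← Algebra.commutes, ← Algebra.smul_def,
      mul_smul_comm, smul_add, smul_smul, hu2, smul_comm]

theorem mem_span_Tt (hu : u ≠ 0) (x : Hecke K u v n) :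
    x ∈ Submodule.span K (Set.range (Hecke.Tt K u v (n := n))) := by
  have hb : ∀ w, Hecke.Tt K u v w ∈ Submodule.span K (Set.range (Hecke.Tt K u v (n := n))) :=
    fun w => Submodule.subset_span ⟨w, rfl⟩
  induction x using Hecke.induction_left with
  | one => simpa using hb 1
  | add x y hx hy => exact Submodule.add_mem _ hx hy
  | smul k x hx => exact Submodule.smul_mem _ k hx
  | T i x hx =>
    induction hx using Submodule.span_induction with
    | mem x hx =>
      obtain ⟨w, rfl⟩ := hx
      rw [T_mul_Tt hu]
      exact Submodule.add_mem _ (Submodule.smul_mem _ _ (hb _)) (Submodule.smul_mem _ _ (hb _))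
    | zero => simp
    | add x y _ _ hx hy => rw [mul_add]; exact Submodule.add_mem _ hx hy
    | smul k x _ hx => rw [mul_smul_comm]; exact Submodule.smul_mem _ k hx

/-- The linear map on `H_n` with the given values on the basis `T̃_w`. -/
def Hecke.constr (u v : K) {N : Type*} [AddCommGroup N] [Module K N]
    (F : Equiv.Perm (Fin n) → N) : Hecke K u v n →ₗ[K] N :=
  Finsupp.linearCombination K (fun p : St n 1 => F p.2) ∘ₗ
    (LinearMap.applyₗ (Finsupp.single ((fun _ => 0, 1) : St n 1) (1 : K))) ∘ₗ
      (hRep u v n).toLinearMap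

theorem Hecke.constr_Tt (hu : u ≠ 0) {N : Type*} [AddCommGroup N] [Module K N]
    (F : Equiv.Perm (Fin n) → N) (w : Equiv.Perm (Fin n)) :
    Hecke.constr u v F (Hecke.Tt K u v w) = F w := by
  have h1 : ∀ i, hRep u v n (Hecke.T K u v i) = opG u v i := Hecke.lift_T _ _
  have hw := map_wordProd (hRep u v n) (Hecke.T K u v) w
  simp only [h1] at hw
  have h2 : hRep u v n (Hecke.Tt K u v w) (Finsupp.single ((fun _ => 0, 1) : St n 1) (1 : K)) =
      Finsupp.single ((fun _ => 0, w) : St n 1) (1 : K) := by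
    rw [Tt_eq, map_smul, hw, LinearMap.smul_apply]
    refine (congrArg _ (wordProd_opG u v w fun _ => (0 : Fin 1))).trans ?_
    rw [smul_smul, ← mul_pow, inv_mul_cancel₀ hu, one_pow, one_smul]
  simp only [Hecke.constr, LinearMap.comp_apply, LinearMap.applyₗ_apply_apply,
    AlgHom.toLinearMap_apply, h2]
  simp

theorem incl_Tt (w : Equiv.Perm (Fin n)) :
    Hecke.incl K u v n (Hecke.Tt K u v w) = Hecke.Tt K u v (extPerm w) := by
  rw [Tt_eq, Tt_eq, map_smul, ell_extPerm, wordProd_extPerm isBraid_T]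
  have hw := map_wordProd (Hecke.incl K u v n) (Hecke.T K u v) w
  simp only [Hecke.incl_T] at hw
  rw [hw]

end HeckeBasis

section Cosets

variable {K : Type} [Field K] {n : ℕ}

/-- The cycle `s_n s_{n-1} ⋯ s_{k+1}`, which moves the position `k`, counted from `0`, to the last
one. -/
def cyc (n : ℕ) (k : Fin (n + 1)) : Equiv.Perm (Fin (n + 1)) :=
  Fin.reverseInduction (motive := fun _ => Equiv.Perm (Fin (n + 1))) 1
    (fun k w => w * simpleT (n := n + 1) k) k

@[simp] theorem cyc_last : cyc n (Fin.last n) = 1 := by simp [cyc]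

theorem cyc_castSucc (k : Fin n) :
    cyc n k.castSucc = cyc n k.succ * simpleT (n := n + 1) k := by simp [cyc]

theorem cyc_self (k : Fin (n + 1)) : cyc n k k = Fin.last n := by
  induction k using Fin.reverseInduction with
  | last => simp
  | cast k ih =>
    rw [cyc_castSucc, Equiv.Perm.mul_apply]
    have : simpleT (n := n + 1) k k.castSucc = k.succ := simpleT_lft (n := n + 1) k
    rw [this, ih]

theorem coset_bijective : Function.Bijective
    (fun p : Equiv.Perm (Fin n) × Fin (n + 1) => extPerm p.1 * cyc n p.2) := by
  rw [Fintype.bijective_iff_injective_and_card]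
  constructor
  · rintro ⟨w, k⟩ ⟨w', k'⟩ h
    simp only at h
    have h1 : (extPerm w * cyc n k) k = Fin.last n := by simp [cyc_self]
    have h2 : (extPerm w' * cyc n k') k' = Fin.last n := by simp [cyc_self]
    rw [h] at h1
    obtain rfl : k = k' := (extPerm w' * cyc n k').injective (h1.trans h2.symm)
    have h3 : extPerm w = extPerm w' := mul_right_cancel h
    have : w = w' := by
      ext j
      have := congrArg (fun f : Equiv.Perm (Fin (n + 1)) => (f j.castSucc : ℕ)) h3
      simpa using this
    rw [this]
  · simp [Fintype.card_perm, Nat.factorial_succ, mul_comm]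

/-- Every permutation of `n + 1` letters is `w' s_n ⋯ s_k` for a unique `w'` that fixes the last
letter and a unique `k`. -/
def cosetEquiv (n : ℕ) : Equiv.Perm (Fin n) × Fin (n + 1) ≃ Equiv.Perm (Fin (n + 1)) :=
  Equiv.ofBijective _ coset_bijective

theorem cosetEquiv_apply (w : Equiv.Perm (Fin n)) (k : Fin (n + 1)) :
    cosetEquiv n (w, k) = extPerm w * cyc n k := rfl

variable {u v : K}

/-- The element `u^{k-n} T_n ⋯ T_{k+1}` of `H_{n+1}`, where `k` is counted from `0`. -/
def cosetT (u v : K) (n : ℕ) (k : Fin (n + 1)) : Hecke K u v (n + 1) :=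
  Fin.reverseInduction (motive := fun _ => Hecke K u v (n + 1)) 1
    (fun k x => u⁻¹ • (x * Hecke.T K u v (n := n + 1) k)) k

@[simp] theorem cosetT_last : cosetT u v n (Fin.last n) = 1 := by simp [cosetT]

theorem cosetT_castSucc (k : Fin n) : cosetT u v n k.castSucc =
    u⁻¹ • (cosetT u v n k.succ * Hecke.T K u v (n := n + 1) k) := by simp [cosetT]

theorem Tt_coset (hu : u ≠ 0) (w : Equiv.Perm (Fin n)) (k : Fin (n + 1)) :
    Hecke.Tt K u v (extPerm w * cyc n k) =
      Hecke.incl K u v n (Hecke.Tt K u v w) * cosetT u v n k := by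
  induction k using Fin.reverseInduction with
  | last => simp [incl_Tt]
  | cast k ih =>
    have h : (extPerm w * cyc n k.succ) (lft (n := n + 1) k) <
        (extPerm w * cyc n k.succ) (rgt (n := n + 1) k) := by
      have h1 : (extPerm w * cyc n k.succ) (rgt (n := n + 1) k) = Fin.last n := by
        have : rgt (n := n + 1) k = k.succ := rfl
        rw [this, Equiv.Perm.mul_apply, cyc_self, extPerm_last]
      refine lt_of_le_of_ne (h1 ▸ Fin.le_last _) fun he => ?_
      exact (lft_lt_rgt (n := n + 1) k).ne ((extPerm w * cyc n k.succ).injective he)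
    have h2 := Tt_mul_T_of_asc (v := v) hu h
    rw [ih, mul_assoc] at h2
    rw [cyc_castSucc, cosetT_castSucc, ← mul_assoc, mul_smul_comm, h2, smul_smul,
      inv_mul_cancel₀ hu, one_smul]

/-- `H_{n+1}` is spanned by the products of `H_n` with the coset elements. -/
theorem Hecke.induction_coset (hu : u ≠ 0) {P : Hecke K u v (n + 1) → Prop}
    (add : ∀ x y, P x → P y → P (x + y)) (smul : ∀ (k : K) x, P x → P (k • x))
    (coset : ∀ y k, P (Hecke.incl K u v n y * cosetT u v n k)) (x : Hecke K u v (n + 1)) :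
    P x := by
  induction mem_span_Tt hu x using Submodule.span_induction with
  | mem x hx =>
    obtain ⟨w, rfl⟩ := hx
    obtain ⟨⟨w, k⟩, rfl⟩ := (cosetEquiv n).surjective w
    rw [cosetEquiv_apply, Tt_coset hu]
    exact coset _ _
  | zero => simpa using smul 0 _ (coset 0 0)
  | add x y _ _ hx hy => exact add _ _ hx hy
  | smul k x _ hx => exact smul k _ hx

variable (K u v) in
/-- The last generator `T_{n+1}` of `H_{n+2}`. -/
abbrev Hecke.lastT (n : ℕ) : Hecke K u v (n + 2) := Hecke.T K u v (n := n + 2) (Fin.last n)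

theorem lastT_mul_incl_cosetT (hu : u ≠ 0) (k : Fin (n + 1)) :
    Hecke.lastT K u v n * Hecke.incl K u v (n + 1) (cosetT u v n k) =
      u • cosetT u v (n + 1) k.castSucc := by
  induction k using Fin.reverseInduction with
  | last =>
    rw [cosetT_castSucc, cosetT_last, map_one, mul_one, Fin.succ_last, cosetT_last, one_mul,
      smul_smul, mul_inv_cancel₀ hu, one_smul]
  | cast k ih =>
    rw [cosetT_castSucc k, map_smul, map_mul, mul_smul_comm, ← mul_assoc, ih, smul_mul_assoc,
      cosetT_castSucc (n := n + 1) k.castSucc, Fin.succ_castSucc, Hecke.incl_T, smul_comm]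
    rfl

theorem lastT_commute_incl_incl (x : Hecke K u v n) :
    Hecke.lastT K u v n * Hecke.incl K u v (n + 1) (Hecke.incl K u v n x) =
      Hecke.incl K u v (n + 1) (Hecke.incl K u v n x) * Hecke.lastT K u v n := by
  induction x using Hecke.induction_left with
  | one => simp
  | add x y hx hy => simp [mul_add, add_mul, hx, hy]
  | smul k x hx => simp [hx]
  | T i x hx =>
    have : Hecke.T K u v (extGen (extGen i)) * Hecke.lastT K u v n =
        Hecke.lastT K u v n * Hecke.T K u v (extGen (extGen i)) := by
      refine isBraid_T.far _ _ ?_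
      have := i.2
      simp [extGen]
      omega
    simp only [map_mul, Hecke.incl_T]
    rw [← mul_assoc, ← this, mul_assoc, hx, mul_assoc]

theorem Hecke.induction_bimodule (hu : u ≠ 0) {P : Hecke K u v (n + 2) → Prop}
    (add : ∀ x y, P x → P y → P (x + y)) (smul : ∀ (k : K) x, P x → P (k • x))
    (incl : ∀ x, P (Hecke.incl K u v (n + 1) x))
    (mid : ∀ x y, P (Hecke.incl K u v (n + 1) x * Hecke.lastT K u v n *
      Hecke.incl K u v (n + 1) y)) (x : Hecke K u v (n + 2)) : P x := by
  induction x using Hecke.induction_coset hu with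
  | add x y hx hy => exact add _ _ hx hy
  | smul k x hx => exact smul _ _ hx
  | coset y k =>
    cases k using Fin.lastCases with
    | last => simpa using incl y
    | cast k =>
      have := smul u⁻¹ _ (mid y (cosetT u v n k))
      rwa [mul_assoc, lastT_mul_incl_cosetT hu, mul_smul_comm, smul_smul, inv_mul_cancel₀ hu,
        one_smul] at this

theorem Hecke.exists_incl_of_one (hu : u ≠ 0) (x : Hecke K u v 1) :
    ∃ y, x = Hecke.incl K u v 0 y := by
  induction x using Hecke.induction_coset hu with
  | add x y hx hy =>
    obtain ⟨a, rfl⟩ := hx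
    obtain ⟨b, rfl⟩ := hy
    exact ⟨a + b, (map_add _ _ _).symm⟩
  | smul k x hx =>
    obtain ⟨a, rfl⟩ := hx
    exact ⟨k • a, (map_smul _ _ _).symm⟩
  | coset y k =>
    obtain rfl : k = Fin.last 0 := Fin.ext (by omega)
    exact ⟨y, by rw [cosetT_last, mul_one]⟩

end Cosets

section Ocneanu

variable {K : Type} [Field K] {n : ℕ} {u v : K}

/-- The factor `τ_{n+1}(x) / τ_n(x)` for the normalized Markov trace and `x ∈ H_n`, `n ≥ 1`. It is
forced by the two Markov conditions and the quadratic relation. For `n = 0` the factor is `1`. -/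
def kappa (u v : K) : K := (1 - u ^ 2) / v

/-- The conditional expectation `H_{n+2} → H_{n+1}`, characterized by `x ↦ κ x` and
`x T_{n+1} y ↦ x y` for `x, y ∈ H_{n+1}`. It is defined on the basis, whose elements are products of
an element of `H_{n+1}` with a coset element: this is `1`, or `u⁻¹ T_{n+1}` times a coset element of
`H_{n+1}`. -/
def condExp (u v : K) (n : ℕ) : Hecke K u v (n + 2) →ₗ[K] Hecke K u v (n + 1) :=
  Hecke.constr u v fun w =>
    Hecke.Tt K u v ((cosetEquiv (n + 1)).symm w).1 *
      Fin.lastCases (motive := fun _ => Hecke K u v (n + 1)) (algebraMap K _ (kappa u v))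
        (fun k => u⁻¹ • cosetT u v n k) ((cosetEquiv (n + 1)).symm w).2

theorem condExp_coset (hu : u ≠ 0) (y : Hecke K u v (n + 1)) (k : Fin (n + 2)) :
    condExp u v n (Hecke.incl K u v (n + 1) y * cosetT u v (n + 1) k) =
      y * Fin.lastCases (motive := fun _ => Hecke K u v (n + 1)) (algebraMap K _ (kappa u v))
        (fun k => u⁻¹ • cosetT u v n k) k := by
  induction mem_span_Tt hu y using Submodule.span_induction with
  | mem x hx =>
    obtain ⟨w, rfl⟩ := hx
    rw [← Tt_coset hu, ← cosetEquiv_apply, condExp, Hecke.constr_Tt hu, Equiv.symm_apply_apply]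
  | zero => simp
  | add x y _ _ hx hy => rw [map_add, add_mul, map_add, hx, hy, add_mul]
  | smul k x _ hx => rw [map_smul, smul_mul_assoc, map_smul, hx, smul_mul_assoc]

theorem condExp_incl (hu : u ≠ 0) (x : Hecke K u v (n + 1)) :
    condExp u v n (Hecke.incl K u v (n + 1) x) = kappa u v • x := by
  have := condExp_coset (v := v) hu x (Fin.last _)
  rw [cosetT_last, mul_one, Fin.lastCases_last, ← Algebra.commutes, ← Algebra.smul_def] at this
  exact this

theorem condExp_mid (hu : u ≠ 0) (x y : Hecke K u v (n + 1)) :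
    condExp u v n (Hecke.incl K u v (n + 1) x * Hecke.lastT K u v n *
      Hecke.incl K u v (n + 1) y) = x * y := by
  induction y using Hecke.induction_coset hu with
  | add y y' hy hy' => simp [mul_add, hy, hy']
  | smul k y hy => simp [hy]
  | coset y k =>
    rw [map_mul (Hecke.incl K u v (n + 1)), mul_assoc, ← mul_assoc (Hecke.lastT K u v n),
      lastT_commute_incl_incl, mul_assoc, lastT_mul_incl_cosetT hu, mul_smul_comm, mul_smul_comm,
      map_smul, ← mul_assoc,
      ← map_mul, condExp_coset hu, Fin.lastCases_castSucc, mul_smul_comm, smul_smul,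
      mul_inv_cancel₀ hu, one_smul, mul_assoc]

/-- The normalized Markov trace on the tower of Hecke algebras, as an iterated conditional
expectation. The algebras with indices `0` and `1` are both the ground field, and the trace is the
identity on them. -/
def ocneanu (u v : K) : ∀ n, Hecke K u v n →ₗ[K] K
  | 0 => Hecke.constr u v fun _ => 1
  | 1 => Hecke.constr u v fun _ => 1
  | n + 2 => ocneanu u v (n + 1) ∘ₗ condExp u v n

theorem ocneanu_zero_one (hu : u ≠ 0) : ocneanu u v 0 1 = 1 := by
  rw [← Tt_one]; exact Hecke.constr_Tt hu _ _

theorem ocneanu_one_one (hu : u ≠ 0) : ocneanu u v 1 1 = 1 := by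
  rw [← Tt_one]; exact Hecke.constr_Tt hu _ _

theorem ocneanu_incl (hu : u ≠ 0) (x : Hecke K u v (n + 1)) :
    ocneanu u v (n + 2) (Hecke.incl K u v (n + 1) x) = kappa u v * ocneanu u v (n + 1) x := by
  rw [ocneanu, LinearMap.comp_apply, condExp_incl hu, map_smul, smul_eq_mul]

theorem ocneanu_mid (hu : u ≠ 0) (x y : Hecke K u v (n + 1)) :
    ocneanu u v (n + 2) (Hecke.incl K u v (n + 1) x * Hecke.lastT K u v n *
      Hecke.incl K u v (n + 1) y) = ocneanu u v (n + 1) (x * y) := by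
  rw [ocneanu, LinearMap.comp_apply, condExp_mid hu]

theorem ocneanu_sq_mid (hu : u ≠ 0) (x y : Hecke K u v (n + 1)) :
    ocneanu u v (n + 2) (Hecke.incl K u v (n + 1) x *
      (Hecke.lastT K u v n * Hecke.lastT K u v n) * Hecke.incl K u v (n + 1) y) =
      (u ^ 2 * kappa u v + v) * ocneanu u v (n + 1) (x * y) := by
  rw [T_mul_self, mul_add, add_mul, map_add, mul_smul_comm, smul_mul_assoc, map_smul,
    ocneanu_mid hu, ← Algebra.commutes, ← Algebra.smul_def, smul_mul_assoc, map_smul, ← map_mul,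
    ocneanu_incl hu, smul_eq_mul, smul_eq_mul]
  ring

theorem ocneanu_sq (i : Fin (n - 1)) (x y : Hecke K u v n) :
    ocneanu u v n (x * Hecke.T K u v i * (Hecke.T K u v i * y)) =
      u ^ 2 * ocneanu u v n (x * y) + v * ocneanu u v n (x * Hecke.T K u v i * y) := by
  rw [← mul_assoc, mul_assoc x, T_mul_self, mul_add, add_mul, map_add, mul_smul_comm,
    smul_mul_assoc, map_smul, ← Algebra.commutes, ← Algebra.smul_def, smul_mul_assoc, map_smul,
    smul_eq_mul, smul_eq_mul]

theorem lastT_braid (n : ℕ) : Hecke.lastT K u v (n + 1) *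
    Hecke.incl K u v (n + 2) (Hecke.lastT K u v n) * Hecke.lastT K u v (n + 1) =
    Hecke.incl K u v (n + 2) (Hecke.lastT K u v n) * Hecke.lastT K u v (n + 1) *
      Hecke.incl K u v (n + 2) (Hecke.lastT K u v n) := by
  rw [Hecke.incl_T]
  refine (isBraid_T.braid _ _ ?_).symm
  simp [extGen]

theorem braid_rotate_left {A : Type*} [Monoid A] {T T' X₁ X₂ : A} (h₁ : T * X₁ = X₁ * T)
    (h₂ : T * X₂ = X₂ * T) (hb : T * T' * T = T' * T * T') (Y : A) :
    T * (X₁ * T' * X₂ * T * Y) = X₁ * T' * T * (T' * (X₂ * Y)) :=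
  calc T * (X₁ * T' * X₂ * T * Y) = T * X₁ * T' * (X₂ * T) * Y := by simp only [mul_assoc]
    _ = X₁ * (T * T' * T) * X₂ * Y := by rw [h₁, ← h₂]; simp only [mul_assoc]
    _ = _ := by rw [hb]; simp only [mul_assoc]

theorem braid_rotate_right {A : Type*} [Monoid A] {T T' Y₁ Y₂ : A} (h₁ : T * Y₁ = Y₁ * T)
    (h₂ : T * Y₂ = Y₂ * T) (hb : T * T' * T = T' * T * T') (X : A) :
    X * T * (Y₁ * T' * Y₂) * T = X * Y₁ * T' * T * (T' * Y₂) :=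
  calc X * T * (Y₁ * T' * Y₂) * T = X * (T * Y₁) * T' * (Y₂ * T) := by simp only [mul_assoc]
    _ = X * Y₁ * (T * T' * T) * Y₂ := by rw [h₁, ← h₂]; simp only [mul_assoc]
    _ = _ := by rw [hb]; simp only [mul_assoc]

/-- The last generator can be moved cyclically past `x T_{n+1} y`. Both sides are computed when `x`
and `y` are in `H_n` or of the form `x₁ T_n x₂` with `x₁, x₂ ∈ H_n`, by the quadratic relation in
the first case and the braid relation in the second. -/
theorem ocneanu_lastT_comm (hu : u ≠ 0) (x y : Hecke K u v (n + 1)) :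
    ocneanu u v (n + 2) (Hecke.lastT K u v n * (Hecke.incl K u v (n + 1) x *
      Hecke.lastT K u v n * Hecke.incl K u v (n + 1) y)) =
    ocneanu u v (n + 2) (Hecke.incl K u v (n + 1) x * Hecke.lastT K u v n *
      Hecke.incl K u v (n + 1) y * Hecke.lastT K u v n) := by
  -- The values when one of the factors comes from `H_n`.
  have hL : ∀ x₀ y, ocneanu u v (n + 2) (Hecke.lastT K u v n * (Hecke.incl K u v (n + 1)
      (Hecke.incl K u v n x₀) * Hecke.lastT K u v n * Hecke.incl K u v (n + 1) y)) =
      (u ^ 2 * kappa u v + v) * ocneanu u v (n + 1) (Hecke.incl K u v n x₀ * y) := by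
    intro x₀ y
    rw [← ocneanu_sq_mid hu]
    simp only [← mul_assoc]
    rw [lastT_commute_incl_incl]
  have hR : ∀ x y₀, ocneanu u v (n + 2) (Hecke.incl K u v (n + 1) x * Hecke.lastT K u v n *
      Hecke.incl K u v (n + 1) (Hecke.incl K u v n y₀) * Hecke.lastT K u v n) =
      (u ^ 2 * kappa u v + v) * ocneanu u v (n + 1) (x * Hecke.incl K u v n y₀) := by
    intro x y₀
    rw [← ocneanu_sq_mid hu]
    simp only [mul_assoc]
    rw [← lastT_commute_incl_incl]
  cases n with
  | zero =>
    obtain ⟨x, rfl⟩ := Hecke.exists_incl_of_one hu x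
    obtain ⟨y, rfl⟩ := Hecke.exists_incl_of_one hu y
    rw [hL, hR]
  | succ n =>
    -- The values when one of the factors is `x₁ T_n x₂`.
    have hL' : ∀ x₁ x₂ y, ocneanu u v (n + 3) (Hecke.lastT K u v (n + 1) *
        (Hecke.incl K u v (n + 2) (Hecke.incl K u v (n + 1) x₁ * Hecke.lastT K u v n *
          Hecke.incl K u v (n + 1) x₂) *
        Hecke.lastT K u v (n + 1) * Hecke.incl K u v (n + 2) y)) =
        u ^ 2 * ocneanu u v (n + 2) (Hecke.incl K u v (n + 1) (x₁ * x₂) * y) +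
        v * ocneanu u v (n + 2) (Hecke.incl K u v (n + 1) x₁ * Hecke.lastT K u v n *
          Hecke.incl K u v (n + 1) x₂ * y) := by
      intro x₁ x₂ y
      have h1 := lastT_commute_incl_incl x₁
      have h2 := lastT_commute_incl_incl x₂
      have e : Hecke.lastT K u v (n + 1) *
          (Hecke.incl K u v (n + 2) (Hecke.incl K u v (n + 1) x₁ * Hecke.lastT K u v n *
            Hecke.incl K u v (n + 1) x₂) *
          Hecke.lastT K u v (n + 1) * Hecke.incl K u v (n + 2) y) =
          Hecke.incl K u v (n + 2) (Hecke.incl K u v (n + 1) x₁ * Hecke.lastT K u v n) *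
          Hecke.lastT K u v (n + 1) * Hecke.incl K u v (n + 2)
            (Hecke.lastT K u v n * (Hecke.incl K u v (n + 1) x₂ * y)) := by
        simp only [map_mul]
        exact braid_rotate_left h1 h2 (lastT_braid n) _
      rw [e, ocneanu_mid hu, ocneanu_sq, map_mul (Hecke.incl K u v (n + 1))]
      simp only [mul_assoc]
    have hR' : ∀ x y₁ y₂, ocneanu u v (n + 3) (Hecke.incl K u v (n + 2) x *
        Hecke.lastT K u v (n + 1) * Hecke.incl K u v (n + 2) (Hecke.incl K u v (n + 1) y₁ *
          Hecke.lastT K u v n * Hecke.incl K u v (n + 1) y₂) * Hecke.lastT K u v (n + 1)) =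
        u ^ 2 * ocneanu u v (n + 2) (x * Hecke.incl K u v (n + 1) (y₁ * y₂)) +
        v * ocneanu u v (n + 2) (x * (Hecke.incl K u v (n + 1) y₁ * Hecke.lastT K u v n *
          Hecke.incl K u v (n + 1) y₂)) := by
      intro x y₁ y₂
      have h1 := lastT_commute_incl_incl y₁
      have h2 := lastT_commute_incl_incl y₂
      have e : Hecke.incl K u v (n + 2) x * Hecke.lastT K u v (n + 1) *
          Hecke.incl K u v (n + 2) (Hecke.incl K u v (n + 1) y₁ *
          Hecke.lastT K u v n * Hecke.incl K u v (n + 1) y₂) * Hecke.lastT K u v (n + 1) =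
          Hecke.incl K u v (n + 2) (x * Hecke.incl K u v (n + 1) y₁ * Hecke.lastT K u v n) *
          Hecke.lastT K u v (n + 1) * Hecke.incl K u v (n + 2)
            (Hecke.lastT K u v n * Hecke.incl K u v (n + 1) y₂) := by
        simp only [map_mul]
        exact braid_rotate_right h1 h2 (lastT_braid n) _
      rw [e, ocneanu_mid hu, ocneanu_sq, map_mul (Hecke.incl K u v (n + 1))]
      simp only [mul_assoc]
    induction x using Hecke.induction_bimodule hu with
    | add x x' hx hx' =>
      simp only [map_add, add_mul, mul_add] at hx hx' ⊢
      rw [hx, hx']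
    | smul k x hx =>
      simp only [map_smul, smul_mul_assoc, mul_smul_comm] at hx ⊢
      rw [hx]
    | incl x₀ =>
      rw [hL]
      induction y using Hecke.induction_bimodule hu with
      | add y y' hy hy' =>
        simp only [map_add, add_mul, mul_add] at hy hy' ⊢
        rw [hy, hy']
      | smul k y hy =>
        simp only [map_smul, smul_mul_assoc, mul_smul_comm, smul_eq_mul] at hy ⊢
        rw [← hy]; ring
      | incl y₀ => rw [hR]
      | mid y₁ y₂ =>
        rw [hR', ← map_mul, ocneanu_incl hu, ← mul_assoc, ← mul_assoc, ← map_mul, ocneanu_mid hu,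
          mul_assoc x₀]
        ring
    | mid x₁ x₂ =>
      rw [hL']
      induction y using Hecke.induction_bimodule hu with
      | add y y' hy hy' =>
        simp only [map_add, add_mul, mul_add] at hy hy' ⊢
        rw [← hy, ← hy']; ring
      | smul k y hy =>
        simp only [map_smul, smul_mul_assoc, mul_smul_comm, smul_eq_mul] at hy ⊢
        rw [← hy]; ring
      | incl y₀ =>
        rw [hR, ← map_mul, ocneanu_incl hu, mul_assoc _ _ (Hecke.incl K u v (n + 1) y₀),
          ← map_mul, ocneanu_mid hu, mul_assoc x₁]
        ring
      | mid y₁ y₂ =>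
        rw [hR', ← mul_assoc, ← mul_assoc, ← map_mul, ocneanu_mid hu, mul_assoc _ _
          (Hecke.incl K u v (n + 1) (y₁ * y₂)), ← map_mul, ocneanu_mid hu]
        simp only [mul_assoc]

theorem Hecke.mul_comm_of_le_one (hn : n ≤ 1) (x y : Hecke K u v n) : x * y = y * x := by
  induction x using Hecke.induction_left with
  | one => simp
  | add x x' hx hx' => rw [add_mul, mul_add, hx, hx']
  | smul k x hx => rw [smul_mul_assoc, mul_smul_comm, hx]
  | T i x hx => have := i.2; omega

theorem ocneanu_trace (hu : u ≠ 0) : ∀ n (x y : Hecke K u v n),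
    ocneanu u v n (x * y) = ocneanu u v n (y * x)
  | 0, x, y => by rw [Hecke.mul_comm_of_le_one (by omega)]
  | 1, x, y => by rw [Hecke.mul_comm_of_le_one (by omega)]
  | n + 2, x, y => by
    have ih := ocneanu_trace hu (n + 1)
    have gen : ∀ (i : Fin (n + 1)) a, ocneanu u v (n + 2)
        (Hecke.T K u v (n := n + 2) i * a) =
        ocneanu u v (n + 2) (a * Hecke.T K u v (n := n + 2) i) := by
      intro i a
      induction a using Hecke.induction_bimodule hu with
      | add a b ha hb => rw [mul_add, add_mul, map_add, map_add, ha, hb]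
      | smul k a ha => rw [mul_smul_comm, smul_mul_assoc, map_smul, map_smul, ha]
      | incl a =>
        cases i using Fin.lastCases with
        | last =>
          have h1 := ocneanu_mid (v := v) hu 1 a
          have h2 := ocneanu_mid (v := v) hu a 1
          rw [map_one, one_mul, one_mul] at h1
          rw [map_one, mul_one, mul_one] at h2
          rw [h1, h2]
        | cast j =>
          have hj : Hecke.T K u v (n := n + 2) j.castSucc =
              Hecke.incl K u v (n + 1) (Hecke.T K u v (n := n + 1) j) := by
            rw [Hecke.incl_T]; rfl
          rw [hj, ← map_mul, ← map_mul, ocneanu_incl hu, ocneanu_incl hu, ih]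
      | mid a b =>
        cases i using Fin.lastCases with
        | last => exact ocneanu_lastT_comm hu a b
        | cast j =>
          have hj : Hecke.T K u v (n := n + 2) j.castSucc =
              Hecke.incl K u v (n + 1) (Hecke.T K u v (n := n + 1) j) := by
            rw [Hecke.incl_T]; rfl
          rw [hj, ← mul_assoc, ← mul_assoc, ← map_mul, ocneanu_mid hu, mul_assoc _ _
            (Hecke.incl K u v (n + 1) (Hecke.T K u v (n := n + 1) j)), ← map_mul, ocneanu_mid hu,
            mul_assoc, ih, mul_assoc]
    induction x using Hecke.induction_left generalizing y with
    | one => simp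
    | add x x' hx hx' => rw [add_mul, mul_add, map_add, map_add, hx, hx']
    | smul k x hx => rw [smul_mul_assoc, mul_smul_comm, map_smul, map_smul, hx]
    | T i x hx => rw [mul_assoc, gen, mul_assoc, hx, mul_assoc]

theorem inverse_eq_of_mul {A : Type*} [MonoidWithZero A] {x y : A} (h : x * y = 1)
    (h' : y * x = 1) : Ring.inverse x = y :=
  Ring.inverse_unit ⟨x, y, h, h'⟩

theorem inverse_T (hu : u ≠ 0) (i : Fin (n - 1)) : Ring.inverse (Hecke.T K u v i) =
    (u ^ 2)⁻¹ • (Hecke.T K u v i - algebraMap K _ v) := by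
  have h1 : Hecke.T K u v i * Hecke.T K u v i - v • Hecke.T K u v i =
      (u ^ 2) • (1 : Hecke K u v n) := by
    rw [T_mul_self, add_sub_cancel_right, Algebra.algebraMap_eq_smul_one]
  have hu2 : (u ^ 2)⁻¹ * u ^ 2 = 1 := inv_mul_cancel₀ (pow_ne_zero 2 hu)
  apply inverse_eq_of_mul
  · rw [mul_smul_comm, mul_sub, ← Algebra.commutes, ← Algebra.smul_def, h1, smul_smul, hu2,
      one_smul]
  · rw [smul_mul_assoc, sub_mul, ← Algebra.smul_def, h1, smul_smul, hu2, one_smul]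

theorem isNormalizedMarkovTrace_ocneanu (hu : u ≠ 0) (hv : v ≠ 0) :
    IsNormalizedMarkovTrace K u v (ocneanu u v) where
  trace := ocneanu_trace hu
  markov n x := by
    have := ocneanu_mid (v := v) hu x 1
    rwa [map_one, mul_one, mul_one] at this
  markov_inv n x := by
    have := ocneanu_mid (v := v) hu x 1
    rw [map_one, mul_one, mul_one] at this
    rw [inverse_T hu, mul_smul_comm, mul_sub, map_smul, map_sub, this, ← Algebra.commutes,
      ← Algebra.smul_def, map_smul, ocneanu_incl hu, kappa, smul_eq_mul, smul_eq_mul]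
    field_simp
    ring
  norm := ocneanu_one_one hu
  zero := ocneanu_zero_one hu

end Ocneanu

/-! ### The block permutations -/

section Block

variable {d n : ℕ} {μ : Fin d → ℕ}

/-- The increasing enumeration of the positions of colour `a`. -/
def Orbit.pos (χ : Orbit n μ) (a : Fin d) : Fin (μ a) ↪o Fin n :=
  (positions χ.1 a).orderEmbOfFin (χ.2 a)

theorem mem_positions {χ : Fin n → Fin d} {a : Fin d} {j : Fin n} :
    j ∈ positions χ a ↔ χ j = a := by simp [positions]

theorem Orbit.colour_pos (χ : Orbit n μ) (a : Fin d) (k : Fin (μ a)) : χ.1 (χ.pos a k) = a :=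
  mem_positions.1 (Finset.orderEmbOfFin_mem _ _ _)

theorem Orbit.exists_pos (χ : Orbit n μ) {a : Fin d} {j : Fin n} (h : χ.1 j = a) :
    ∃ k, χ.pos a k = j := by
  have : j ∈ Set.range (χ.pos a) := by
    rw [Orbit.pos, Finset.range_orderEmbOfFin]; exact mem_positions.2 h
  exact this

theorem Orbit.pos_unique (χ : Orbit n μ) {a : Fin d} {f : Fin (μ a) → Fin n}
    (hf : ∀ k, χ.1 (f k) = a) (hm : StrictMono f) : f = χ.pos a :=
  Finset.orderEmbOfFin_unique _ (fun k => mem_positions.2 (hf k)) hm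

theorem pos_blockPerm (χ : Orbit n μ) (w : Equiv.Perm (Fin n)) (a : Fin d) (k : Fin (μ a)) :
    χ.pos a (blockPerm χ w a k) = w ((χ.act w).pos a k) := by
  unfold blockPerm Orbit.pos
  simp only [← Finset.coe_orderIsoOfFin_apply, Equiv.trans_apply]
  have := ((positions χ.1 a).orderIsoOfFin (χ.2 a)).apply_symm_apply (restrictPositions χ.1 w a
    ((positions (χ.1 ∘ w) a).orderIsoOfFin ((χ.act w).2 a) k))
  exact congrArg Subtype.val this

theorem blockPerm_unique (χ : Orbit n μ) (w : Equiv.Perm (Fin n)) (a : Fin d)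
    (σ : Equiv.Perm (Fin (μ a))) (h : ∀ k, χ.pos a (σ k) = w ((χ.act w).pos a k)) :
    blockPerm χ w a = σ :=
  Equiv.ext fun k => (χ.pos a).injective ((pos_blockPerm χ w a k).trans (h k).symm)

theorem blockPerm_mul (χ : Orbit n μ) (w w' : Equiv.Perm (Fin n)) (a : Fin d) :
    blockPerm χ (w * w') a = blockPerm χ w a * blockPerm (χ.act w) w' a := by
  refine blockPerm_unique _ _ _ _ fun k => ?_
  rw [Equiv.Perm.mul_apply, pos_blockPerm, pos_blockPerm]
  rfl

theorem blockPerm_one (χ : Orbit n μ) (a : Fin d) : blockPerm χ 1 a = 1 :=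
  blockPerm_unique _ _ _ _ fun _ => rfl

theorem blockPerm_simpleT_of_ne (χ : Orbit n μ) {i : Fin (n - 1)} {a : Fin d}
    (h : ¬ (χ.1 (lft i) = a ∧ χ.1 (rgt i) = a)) : blockPerm χ (simpleT i) a = 1 := by
  refine blockPerm_unique _ _ _ _ fun k => ?_
  have : (fun k => simpleT i ((χ.act (simpleT i)).pos a k)) = χ.pos a := by
    refine χ.pos_unique (fun k => (χ.act (simpleT i)).colour_pos a k) fun k k' hk => ?_
    refine simpleT_lt_simpleT ((OrderEmbedding.strictMono _) hk) ?_
    rintro ⟨h1, h2⟩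
    have e1 := (χ.act (simpleT i)).colour_pos a k
    have e2 := (χ.act (simpleT i)).colour_pos a k'
    rw [h1] at e1
    rw [h2] at e2
    simp only [Orbit.act, Function.comp_apply, simpleT_lft, simpleT_rgt] at e1 e2
    exact h ⟨e2, e1⟩
  exact (congrFun this k).symm

theorem comp_simpleT {χ : Fin n → Fin d} {i : Fin (n - 1)} (h : χ (lft i) = χ (rgt i)) :
    χ ∘ simpleT i = χ := by
  funext j
  by_cases e1 : j = lft i
  · simp [e1, h]
  · by_cases e2 : j = rgt i
    · simp [e2, h]
    · simp [simpleT_of_ne e1 e2]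

theorem Orbit.act_simpleT (χ : Orbit n μ) {i : Fin (n - 1)} (h : χ.1 (lft i) = χ.1 (rgt i)) :
    χ.act (simpleT i) = χ := Subtype.ext (comp_simpleT h)

/-- Two neighbouring strands of the same colour are neighbours in the block of that colour. -/
theorem Orbit.exists_block_gen (χ : Orbit n μ) {i : Fin (n - 1)} {a : Fin d}
    (hl : χ.1 (lft i) = a) (hr : χ.1 (rgt i) = a) :
    ∃ j : Fin (μ a - 1), χ.pos a (lft j) = lft i ∧ χ.pos a (rgt j) = rgt i := by
  obtain ⟨k, hk⟩ := χ.exists_pos hl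
  obtain ⟨k', hk'⟩ := χ.exists_pos hr
  have hlt : k < k' := (χ.pos a).lt_iff_lt.1 (by rw [hk, hk']; exact lft_lt_rgt i)
  have hlt' : (k : ℕ) < k' := hlt
  have hk2 := k'.2
  have hsucc : (k' : ℕ) = k + 1 := by
    by_contra hne
    have h1 : χ.pos a k < χ.pos a ⟨k + 1, by omega⟩ := (χ.pos a).lt_iff_lt.2 (by simp [Fin.lt_def])
    have h2 : χ.pos a ⟨k + 1, by omega⟩ < χ.pos a k' :=
      (χ.pos a).lt_iff_lt.2 (by simp [Fin.lt_def]; omega)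
    rw [hk, Fin.lt_def] at h1
    rw [hk', Fin.lt_def] at h2
    simp only [lft, rgt] at h1 h2
    omega
  refine ⟨⟨k, by omega⟩, ?_, ?_⟩
  · rw [← hk]; rfl
  · rw [← hk']; congr 1; exact Fin.ext hsucc.symm

theorem blockPerm_simpleT_of_eq (χ : Orbit n μ) {i : Fin (n - 1)} {a : Fin d}
    {j : Fin (μ a - 1)} (hl : χ.pos a (lft j) = lft i) (hr : χ.pos a (rgt j) = rgt i) :
    blockPerm χ (simpleT i) a = simpleT j := by
  refine blockPerm_unique _ _ _ _ fun k => ?_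
  have h1 := χ.colour_pos a (lft j)
  have h2 := χ.colour_pos a (rgt j)
  rw [hl] at h1
  rw [hr] at h2
  rw [χ.act_simpleT (h1.trans h2.symm)]
  by_cases e1 : k = lft j
  · rw [e1, simpleT_lft, hl, hr, simpleT_lft]
  · by_cases e2 : k = rgt j
    · rw [e2, simpleT_rgt, hl, hr, simpleT_rgt]
    · rw [simpleT_of_ne e1 e2, simpleT_of_ne]
      · rw [← hl]; exact fun h => e1 ((χ.pos a).injective h)
      · rw [← hr]; exact fun h => e2 ((χ.pos a).injective h)

theorem pos_blockPerm_inv (χ : Orbit n μ) (w : Equiv.Perm (Fin n)) (a : Fin d) (k : Fin (μ a)) :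
    (χ.act w).pos a ((blockPerm χ w a)⁻¹ k) = w⁻¹ (χ.pos a k) := by
  rw [Equiv.Perm.eq_inv_iff_eq, ← pos_blockPerm]
  exact congrArg _ (Equiv.apply_symm_apply _ _)

theorem asc_blockPerm (χ : Orbit n μ) (w : Equiv.Perm (Fin n)) {i : Fin (n - 1)} {a : Fin d}
    {j : Fin (μ a - 1)} (hl : χ.pos a (lft j) = lft i) (hr : χ.pos a (rgt j) = rgt i) :
    Asc j (blockPerm χ w a) ↔ Asc i w := by
  unfold Asc
  rw [← hl, ← hr, ← pos_blockPerm_inv, ← pos_blockPerm_inv, OrderEmbedding.lt_iff_lt]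

theorem blockPerm_lt_blockPerm (χ : Orbit n μ) (w : Equiv.Perm (Fin n)) {i : Fin (n - 1)}
    {a : Fin d} {j : Fin (μ a - 1)} (hl : (χ.act w).pos a (lft j) = lft i)
    (hr : (χ.act w).pos a (rgt j) = rgt i) :
    blockPerm χ w a (lft j) < blockPerm χ w a (rgt j) ↔ w (lft i) < w (rgt i) := by
  rw [← hl, ← hr, ← pos_blockPerm, ← pos_blockPerm, OrderEmbedding.lt_iff_lt]

end Block

/-! ### The weight of a coloured permutation -/

section Weight

variable {K : Type} [Field K] {d n : ℕ} {μ : Fin d → ℕ} {u v : K}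

/-- The composition that counts the colours. -/
def colourCount (χ : Fin n → Fin d) (a : Fin d) : ℕ := (positions χ a).card

/-- The function `χ`, as an element of the orbit of its composition. -/
abbrev toOrbit (χ : Fin n → Fin d) : Orbit n (colourCount χ) := ⟨χ, fun _ => rfl⟩

/-- The value of `τ_{μ_1} ⊗ ⋯ ⊗ τ_{μ_d}` on the tensor product of the `T̃` of the blocks. -/
def weightOrbit (u v : K) (χ : Orbit n μ) (w : Equiv.Perm (Fin n)) : K :=
  ∏ a, ocneanu u v (μ a) (Hecke.Tt K u v (blockPerm χ w a))

/-- `weightOrbit` for the composition of `χ`. -/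
def weight (u v : K) (χ : Fin n → Fin d) (w : Equiv.Perm (Fin n)) : K :=
  weightOrbit u v (toOrbit χ) w

theorem weightOrbit_eq (χ : Orbit n μ) (w : Equiv.Perm (Fin n)) :
    weightOrbit u v χ w = weight u v χ.1 w := by
  obtain ⟨χ, h⟩ := χ
  obtain rfl : colourCount χ = μ := funext h
  rfl

/-- The trace property of the weight, for strands of different colours: a crossing of such strands
is not seen by the blocks. -/
theorem weight_simpleT_mul_of_ne {χ : Fin n → Fin d} {i : Fin (n - 1)}
    (h : χ (lft i) ≠ χ (rgt i)) (w : Equiv.Perm (Fin n)) (hw : χ ∘ w = χ ∘ simpleT i) :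
    weight u v (χ ∘ simpleT i) (simpleT i * w) = weight u v χ (w * simpleT i) := by
  have e1 : weight u v (χ ∘ simpleT i) (simpleT i * w) =
      weightOrbit u v ((toOrbit χ).act (simpleT i)) (simpleT i * w) :=
    (weightOrbit_eq ((toOrbit χ).act (simpleT i)) (simpleT i * w)).symm
  rw [e1]
  refine Finset.prod_congr rfl fun a _ => ?_
  have hact : ((toOrbit χ).act (simpleT i)).act (simpleT i) = toOrbit χ :=
    Subtype.ext (by funext j; simp [Orbit.act])
  have hact' : (toOrbit χ).act w = (toOrbit χ).act (simpleT i) := Subtype.ext hw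
  rw [blockPerm_mul, blockPerm_mul, hact, hact', blockPerm_simpleT_of_ne, one_mul, mul_one]
  simp only [Orbit.act, Function.comp_apply, simpleT_lft, simpleT_rgt]
  exact fun ⟨h1, h2⟩ => h (h2.trans h1.symm)

/-- The trace property of the weight, for strands of the same colour. -/
theorem weight_comm (hu : u ≠ 0) {χ : Fin n → Fin d} {i : Fin (n - 1)}
    (h : χ (lft i) = χ (rgt i)) {w : Equiv.Perm (Fin n)} (hw : χ ∘ w = χ) :
    u * weight u v χ (simpleT i * w) + (if Asc i w then 0 else v) * weight u v χ w =
      u * weight u v χ (w * simpleT i) +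
        (if w (lft i) < w (rgt i) then 0 else v) * weight u v χ w := by
  have hs : (toOrbit χ).act (simpleT i) = toOrbit χ := (toOrbit χ).act_simpleT h
  have hw' : (toOrbit χ).act w = toOrbit χ := Subtype.ext hw
  set b := χ (rgt i) with hb
  obtain ⟨j, hl, hr⟩ := (toOrbit χ).exists_block_gen h hb.symm
  have hne : ∀ a ∈ Finset.univ.erase b, ¬ (χ (lft i) = a ∧ χ (rgt i) = a) := by
    intro a ha ⟨_, h2⟩
    exact (Finset.ne_of_mem_erase ha) (h2.symm.trans hb.symm)
  have key : ∀ w', weight u v χ w' =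
      ocneanu u v _ (Hecke.Tt K u v (blockPerm (toOrbit χ) w' b)) *
        ∏ a ∈ Finset.univ.erase b,
          ocneanu u v _ (Hecke.Tt K u v (blockPerm (toOrbit χ) w' a)) :=
    fun w' => (Finset.mul_prod_erase _ _ (Finset.mem_univ b)).symm
  have k1 : ∏ a ∈ Finset.univ.erase b,
      ocneanu u v _ (Hecke.Tt K u v (blockPerm (toOrbit χ) (simpleT i * w) a)) =
      ∏ a ∈ Finset.univ.erase b,
        ocneanu u v _ (Hecke.Tt K u v (blockPerm (toOrbit χ) w a)) := by
    refine Finset.prod_congr rfl fun a ha => ?_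
    rw [blockPerm_mul, hs, blockPerm_simpleT_of_ne _ (hne a ha), one_mul]
  have k2 : ∏ a ∈ Finset.univ.erase b,
      ocneanu u v _ (Hecke.Tt K u v (blockPerm (toOrbit χ) (w * simpleT i) a)) =
      ∏ a ∈ Finset.univ.erase b,
        ocneanu u v _ (Hecke.Tt K u v (blockPerm (toOrbit χ) w a)) := by
    refine Finset.prod_congr rfl fun a ha => ?_
    rw [blockPerm_mul, hw', blockPerm_simpleT_of_ne _ (hne a ha), mul_one]
  have t := ocneanu_trace (v := v) hu _ (Hecke.T K u v j)
    (Hecke.Tt K u v (blockPerm (toOrbit χ) w b))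
  rw [T_mul_Tt hu, Tt_mul_T hu] at t
  simp only [map_add, map_smul, smul_eq_mul] at t
  simp only [asc_blockPerm _ _ hl hr, blockPerm_lt_blockPerm _ w
    (i := i) (a := b) (j := j) (by rw [hw']; exact hl) (by rw [hw']; exact hr)] at t
  rw [key (simpleT i * w), key (w * simpleT i), key w, k1, k2, blockPerm_mul, blockPerm_mul, hs,
    hw', blockPerm_simpleT_of_eq _ hl hr]
  linear_combination t * ∏ a ∈ Finset.univ.erase b,
        ocneanu u v _ (Hecke.Tt K u v (blockPerm (toOrbit χ) w a))

/-- A block can be computed from any increasing enumerations of the positions. -/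
theorem ocneanu_block {χ : Fin n → Fin d} {w : Equiv.Perm (Fin n)} {a : Fin d} {m : ℕ}
    (hm : colourCount χ a = m) {p q : Fin m → Fin n} (hp : StrictMono p) (hq : StrictMono q)
    (hpa : ∀ k, χ (w (p k)) = a) (hqa : ∀ k, χ (q k) = a) (σ : Equiv.Perm (Fin m))
    (h : ∀ k, q (σ k) = w (p k)) :
    ocneanu u v _ (Hecke.Tt K u v (blockPerm (toOrbit χ) w a)) =
      ocneanu u v m (Hecke.Tt K u v σ) := by
  subst hm
  have h1 : p = ((toOrbit χ).act w).pos a := Orbit.pos_unique _ hpa hp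
  have h2 : q = (toOrbit χ).pos a := Orbit.pos_unique _ hqa hq
  subst h1 h2
  rw [blockPerm_unique _ _ _ σ h]

theorem colourCount_snoc (χ : Fin n → Fin d) (c a : Fin d) :
    colourCount (Fin.snoc χ c : Fin (n + 1) → Fin d) a =
      colourCount χ a + if a = c then 1 else 0 := by
  simp only [colourCount, positions, Finset.card_filter, Fin.sum_univ_castSucc, Fin.snoc_castSucc,
    Fin.snoc_last, eq_comm (a := c)]

theorem sum_colourCount (χ : Fin n → Fin d) : ∑ a, colourCount χ a = n := by
  have := Finset.card_eq_sum_card_fiberwise (f := χ) (s := Finset.univ) (t := Finset.univ)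
    (fun _ _ => Finset.mem_univ _)
  simpa [colourCount, positions] using this.symm

theorem strictMono_castSucc_comp {m : ℕ} {f : Fin m → Fin n} (hf : StrictMono f) :
    StrictMono fun k => (f k).castSucc := fun _ _ h => Fin.castSucc_lt_castSucc_iff.2 (hf h)

theorem strictMono_lastCases {m : ℕ} {f : Fin m → Fin n} (hf : StrictMono f) :
    StrictMono (Fin.lastCases (motive := fun _ => Fin (n + 1)) (Fin.last n)
      fun k => (f k).castSucc) := by
  intro x y h
  cases y using Fin.lastCases with
  | last =>
    cases x using Fin.lastCases with
    | last => exact absurd h (lt_irrefl _)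
    | cast x => simp [Fin.castSucc_lt_last]
  | cast y =>
    cases x using Fin.lastCases with
    | last => exact absurd h (not_lt.2 (Fin.le_last _))
    | cast x => simpa using hf (Fin.castSucc_lt_castSucc_iff.1 h)

theorem ocneanu_extPerm (hu : u ≠ 0) {m : ℕ} (σ : Equiv.Perm (Fin m)) :
    ocneanu u v (m + 1) (Hecke.Tt K u v (extPerm σ)) =
      (if m = 0 then 1 else kappa u v) * ocneanu u v m (Hecke.Tt K u v σ) := by
  cases m with
  | zero =>
    obtain rfl : σ = 1 := Subsingleton.elim _ _
    rw [extPerm_one, Tt_one, Tt_one, ocneanu_one_one hu, ocneanu_zero_one hu]; simp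
  | succ m => rw [← incl_Tt, ocneanu_incl hu]; simp

theorem ocneanu_extPerm_mul (hu : u ≠ 0) {m : ℕ} (j : Fin (m + 1 - 1))
    (hj : rgt j = Fin.last m) (σ : Equiv.Perm (Fin m)) :
    u * ocneanu u v (m + 1) (Hecke.Tt K u v (extPerm σ * simpleT j)) =
      ocneanu u v m (Hecke.Tt K u v σ) := by
  cases m with
  | zero => exact j.elim0
  | succ m =>
    obtain rfl : j = Fin.last m := by
      have := congrArg Fin.val hj
      simp only [rgt, Fin.val_last] at this
      exact Fin.ext (by simpa using this)
    have h1 : (extPerm σ) (lft (n := m + 2) (Fin.last m)) <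
        (extPerm σ) (rgt (n := m + 2) (Fin.last m)) := by
      rw [hj, extPerm_last]
      refine lt_of_le_of_ne (Fin.le_last _) fun he => ?_
      rw [← extPerm_last σ, ← hj] at he
      exact (lft_lt_rgt (n := m + 2) _).ne ((extPerm σ).injective he)
    have h2 := Tt_mul_T_of_asc (v := v) hu h1
    have h3 := ocneanu_mid (v := v) hu (Hecke.Tt K u v σ) 1
    rw [map_one, mul_one, mul_one, incl_Tt, h2, map_smul, smul_eq_mul] at h3
    exact h3

/-- Adding a vertical strand of colour `c` adds one to the block of this colour, so the factor is
`κ` unless this block was empty. -/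
theorem weight_snoc (hu : u ≠ 0) (χ : Fin n → Fin d) (c : Fin d) (w : Equiv.Perm (Fin n)) :
    weight u v (Fin.snoc χ c : Fin (n + 1) → Fin d) (extPerm w) =
      (if colourCount χ c = 0 then 1 else kappa u v) * weight u v χ w := by
  have key : ∀ a, ocneanu u v _ (Hecke.Tt K u v (blockPerm
        (toOrbit (Fin.snoc χ c : Fin (n + 1) → Fin d)) (extPerm w) a)) =
      (if a = c then (if colourCount χ c = 0 then 1 else kappa u v) else 1 : K) *
        ocneanu u v _ (Hecke.Tt K u v (blockPerm (toOrbit χ) w a)) := by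
    intro a
    have hp := OrderEmbedding.strictMono (((toOrbit χ).act w).pos a)
    have hq := OrderEmbedding.strictMono ((toOrbit χ).pos a)
    have hcp : ∀ k, χ (w (((toOrbit χ).act w).pos a k)) = a := ((toOrbit χ).act w).colour_pos a
    have hcq : ∀ k, χ ((toOrbit χ).pos a k) = a := (toOrbit χ).colour_pos a
    by_cases h : a = c
    · rw [if_pos h, ocneanu_block (m := colourCount χ a + 1) (by rw [colourCount_snoc, if_pos h])
        (strictMono_lastCases hp) (strictMono_lastCases hq) ?_ ?_
        (extPerm (blockPerm (toOrbit χ) w a)) ?_, ocneanu_extPerm hu, h]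
      · intro k
        cases k using Fin.lastCases with
        | last => simp [h]
        | cast k => simpa using hcp k
      · intro k
        cases k using Fin.lastCases with
        | last => simp [h]
        | cast k => simpa using hcq k
      · intro k
        cases k using Fin.lastCases with
        | last => simp
        | cast k => simp [pos_blockPerm]
    · rw [if_neg h, one_mul]
      refine ocneanu_block (by rw [colourCount_snoc, if_neg h, add_zero])
        (strictMono_castSucc_comp hp) (strictMono_castSucc_comp hq) ?_ ?_ _ ?_
      · intro k; simpa using hcp k
      · intro k; simpa using hcq k
      · intro k; simp [pos_blockPerm]
  rw [weight, weightOrbit, Finset.prod_congr rfl fun a _ => key a, Finset.prod_mul_distrib,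
    Finset.prod_ite_eq' Finset.univ c]
  simp [weight, weightOrbit]

/-- Adding a strand of the colour of the last one, and a crossing of these two strands. In the block
of this colour the crossing is the one of the last two strands. -/
theorem weight_snoc_mul (hu : u ≠ 0) {χ : Fin (n + 1) → Fin d} {w : Equiv.Perm (Fin (n + 1))}
    (hw : χ ∘ w = χ) :
    u * weight u v (Fin.snoc χ (χ (Fin.last n)) : Fin (n + 2) → Fin d)
      (extPerm w * simpleT (n := n + 2) (Fin.last n)) = weight u v χ w := by
  set c := χ (Fin.last n) with hc
  have hw' : (toOrbit χ).act w = toOrbit χ := Subtype.ext hw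
  have hlft : lft (n := n + 2) (Fin.last n) = (Fin.last n).castSucc := rfl
  have hrgt : rgt (n := n + 2) (Fin.last n) = Fin.last (n + 1) := rfl
  have hfix : ∀ x : Fin (n + 1), χ x ≠ c →
      simpleT (n := n + 2) (Fin.last n) x.castSucc = x.castSucc := by
    intro x hx
    refine simpleT_of_ne ?_ ?_
    · rw [hlft]; exact fun h => hx (by rw [Fin.castSucc_injective _ h])
    · rw [hrgt]; exact (Fin.castSucc_lt_last x).ne
  have key : ∀ a, (if a = c then u else 1) * ocneanu u v _ (Hecke.Tt K u v (blockPerm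
        (toOrbit (Fin.snoc χ c : Fin (n + 2) → Fin d))
          (extPerm w * simpleT (n := n + 2) (Fin.last n)) a)) =
        ocneanu u v _ (Hecke.Tt K u v (blockPerm (toOrbit χ) w a)) := by
    intro a
    have hq := OrderEmbedding.strictMono ((toOrbit χ).pos a)
    have hcq : ∀ k, χ ((toOrbit χ).pos a k) = a := (toOrbit χ).colour_pos a
    have hbp := pos_blockPerm (toOrbit χ) w a
    rw [hw'] at hbp
    have hwχ : ∀ x, χ (w x) = χ x := congrFun hw
    split_ifs with h
    · subst h
      obtain ⟨k₀, hk₀⟩ := (toOrbit χ).exists_pos hc.symm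
      have hpos : 0 < colourCount χ c := by have := k₀.2; omega
      -- The last strand of `χ` is the last one of its colour.
      have htop : ∀ k : Fin (colourCount χ c), (k : ℕ) + 1 = colourCount χ c →
          (toOrbit χ).pos c k = Fin.last n := by
        intro k hk
        refine le_antisymm (Fin.le_last _) ?_
        rw [← hk₀, OrderEmbedding.le_iff_le, Fin.le_def]
        have := k₀.2
        omega
      let j : Fin (colourCount χ c + 1 - 1) := ⟨colourCount χ c - 1, by omega⟩
      have hjr : rgt j = Fin.last _ := Fin.ext (by simp [rgt, j]; omega)
      let k₁ : Fin (colourCount χ c) := ⟨colourCount χ c - 1, by omega⟩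
      have hjl : lft j = k₁.castSucc := rfl
      let p : Fin (colourCount χ c + 1) → Fin (n + 2) :=
        Fin.lastCases (motive := fun _ => Fin (n + 2)) (Fin.last (n + 1))
          fun k => ((toOrbit χ).pos c k).castSucc
      have hp : StrictMono p := strictMono_lastCases hq
      have hplast : p (Fin.last _) = Fin.last (n + 1) := by simp [p]
      have hpcast : ∀ k : Fin (colourCount χ c), p k.castSucc =
          ((toOrbit χ).pos c k).castSucc := fun k => by simp [p]
      have hpl : p (lft j) = lft (n := n + 2) (Fin.last n) := by
        rw [hjl, hpcast, htop k₁ (by simp [k₁]; omega), hlft]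
      have hpr : p (rgt j) = rgt (n := n + 2) (Fin.last n) := by rw [hjr, hplast, hrgt]
      have hps : ∀ k, p (simpleT j k) = simpleT (n := n + 2) (Fin.last n) (p k) := by
        intro k
        by_cases e1 : k = lft j
        · rw [e1, simpleT_lft, hpr, hpl, simpleT_lft]
        · by_cases e2 : k = rgt j
          · rw [e2, simpleT_rgt, hpr, hpl, simpleT_rgt]
          · rw [simpleT_of_ne e1 e2, simpleT_of_ne]
            · rw [← hpl]; exact fun h => e1 (hp.injective h)
            · rw [← hpr]; exact fun h => e2 (hp.injective h)
      have hpc : ∀ k, (Fin.snoc χ c : Fin (n + 2) → Fin d) (p k) = c := by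
        intro k
        cases k using Fin.lastCases with
        | last => simp [hplast]
        | cast k => simpa [hpcast] using hcq k
      have hpw : ∀ k, p (extPerm (blockPerm (toOrbit χ) w c) k) = extPerm w (p k) := by
        intro k
        cases k using Fin.lastCases with
        | last => simp [hplast]
        | cast k => simp [hpcast, hbp]
      have hpwc : ∀ k, (Fin.snoc χ c : Fin (n + 2) → Fin d) (extPerm w (p k)) = c := by
        intro k; rw [← hpw]; exact hpc _
      rw [ocneanu_block (m := colourCount χ c + 1) (by rw [colourCount_snoc, if_pos rfl])
        hp hp ?_ hpc (extPerm (blockPerm (toOrbit χ) w c) * simpleT j) ?_,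
        ocneanu_extPerm_mul hu j hjr]
      · intro k
        rw [Equiv.Perm.mul_apply, ← hps]; exact hpwc _
      · intro k
        rw [Equiv.Perm.mul_apply, hpw, hps, Equiv.Perm.mul_apply]
    · rw [one_mul]
      refine ocneanu_block (by rw [colourCount_snoc, if_neg h, add_zero])
        (strictMono_castSucc_comp hq) (strictMono_castSucc_comp hq) ?_ ?_ _ ?_
      · intro k
        rw [Equiv.Perm.mul_apply, hfix _ (by rw [hcq]; exact h)]
        simpa [hwχ] using hcq k
      · intro k; simpa using hcq k
      · intro k
        rw [Equiv.Perm.mul_apply, hfix _ (by rw [hcq]; exact h)]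
        simp [hbp]
  rw [weight, weightOrbit, weight, weightOrbit, ← Finset.prod_congr rfl fun a _ => key a,
    Finset.prod_mul_distrib, Finset.prod_ite_eq' Finset.univ c]
  simp

end Weight

/-! ### Markov traces with given parameters -/

section Psi

variable {K : Type} [Field K] {d n : ℕ} {u v : K} {ξ : Fin d → K}

/-- The map `Ψ_μ`, preceded by the projection onto `E_μ Y_{d,n}`. -/
def psi (u v : K) {ξ : Fin d → K} (hξ : IsRootFamily ξ) (n : ℕ) (μ : Fin d → ℕ) :
    Y K d u v n →ₗ[K] Matrix (Orbit n μ) (Orbit n μ) (HeckeComp K u v μ) :=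
  open Classical in
  constr u v hξ fun χ w =>
    if h : ∀ a, (positions χ a).card = μ a then
      Matrix.single ⟨χ, h⟩ (Orbit.act ⟨χ, h⟩ w)
        (PiTensorProduct.tprod K fun a => Hecke.Tt K u v (blockPerm ⟨χ, h⟩ w a))
    else 0

theorem isPsi_psi (hξ : IsRootFamily ξ) (hu : u ≠ 0) (n : ℕ) (μ : Fin d → ℕ) :
    IsPsi ξ u v n μ (psi u v hξ n μ) where
  on_summand χ w := by rw [psi, constr_basis hξ hu, dif_pos χ.2]
  off_summand χ w h := by rw [psi, constr_basis hξ hu, dif_neg h]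

/-- The value at the basis element `E_χ g̃_w` of the family with parameters `α`. -/
theorem sum_param_basis (hξ : IsRootFamily ξ)
    (τ : ∀ n, Hecke K u v n →ₗ[K] K)
    {Ψ : ∀ μ : Fin d → ℕ, Y K d u v n →ₗ[K] Matrix (Orbit n μ) (Orbit n μ) (HeckeComp K u v μ)}
    (hΨ : ∀ μ, IsPsi ξ u v n μ (Ψ μ)) (α : (Fin d → ℕ) → K) (χ : Fin n → Fin d)
    (w : Equiv.Perm (Fin n)) :
    ∑ μ ∈ Finset.piAntidiag Finset.univ n, α (base μ) *
      tensorTrace τ μ (Matrix.trace (Ψ μ (Emu ξ u v n μ * (Echi ξ u v χ * gt u v w)))) =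
    if χ ∘ w = χ then α (base (colourCount χ)) *
      ∏ a, τ (colourCount χ a) (Hecke.Tt K u v (blockPerm (toOrbit χ) w a)) else 0 := by
  rw [Finset.sum_eq_single (colourCount χ)]
  · have h1 : Emu ξ u v n (colourCount χ) * (Echi ξ u v χ * gt u v w) =
        Echi ξ u v χ * gt u v w := by
      have hc : ∀ a, (positions χ a).card = colourCount χ a := fun _ => rfl
      rw [← mul_assoc, Emu_mul_Echi hξ, if_pos hc]
    rw [h1, (hΨ _).on_summand (toOrbit χ) w]
    split_ifs with h
    · have : (toOrbit χ).act w = toOrbit χ := Subtype.ext h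
      rw [this, Matrix.trace_single_eq_same, tensorTrace, PiTensorProduct.lift.tprod]
      simp
    · rw [Matrix.trace_single_eq_of_ne _ _ _ fun h' => h (congrArg Subtype.val h').symm]
      simp
  · intro μ _ hμ
    rw [← mul_assoc, Emu_mul_Echi hξ, if_neg fun h => hμ (funext fun a => (h a).symm)]
    simp
  · intro h
    exact absurd (by simp [sum_colourCount]) h

/-- The family of traces with parameters `α`, built from the Ocneanu traces and the maps `psi`. -/
def rho (u v : K) {ξ : Fin d → K} (hξ : IsRootFamily ξ) (α : (Fin d → ℕ) → K) (n : ℕ) :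
    Y K d u v n →ₗ[K] K :=
  ∑ μ ∈ Finset.piAntidiag Finset.univ n, α (base μ) •
    (tensorTrace (ocneanu u v) μ ∘ₗ Matrix.traceLinearMap (Orbit n μ) K (HeckeComp K u v μ) ∘ₗ
      psi u v hξ n μ ∘ₗ LinearMap.mulLeft K (Emu ξ u v n μ))

theorem rho_apply (hξ : IsRootFamily ξ) (α : (Fin d → ℕ) → K) (x : Y K d u v n) :
    rho u v hξ α n x = ∑ μ ∈ Finset.piAntidiag Finset.univ n, α (base μ) *
      tensorTrace (ocneanu u v) μ (Matrix.trace (psi u v hξ n μ (Emu ξ u v n μ * x))) := by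
  simp [rho]

theorem rho_basis (hξ : IsRootFamily ξ) (hu : u ≠ 0) (α : (Fin d → ℕ) → K) (χ : Fin n → Fin d)
    (w : Equiv.Perm (Fin n)) : rho u v hξ α n (Echi ξ u v χ * gt u v w) =
      if χ ∘ w = χ then α (base (colourCount χ)) * weight u v χ w else 0 := by
  rw [rho_apply, sum_param_basis hξ _ (isPsi_psi hξ hu n) α χ w]
  rfl

theorem colourCount_comp (χ : Fin n → Fin d) (w : Equiv.Perm (Fin n)) :
    colourCount (χ ∘ w) = colourCount χ :=
  funext fun a => card_positions_comp χ w a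

theorem rho_gg_comm (hξ : IsRootFamily ξ) (hu : u ≠ 0) (α : (Fin d → ℕ) → K) (i : Fin (n - 1))
    (x : Y K d u v n) : rho u v hξ α n (gg i * x) = rho u v hξ α n (x * gg i) := by
  have : rho u v hξ α n ∘ₗ LinearMap.mulLeft K (gg i) =
      rho u v hξ α n ∘ₗ LinearMap.mulRight K (gg i) := by
    refine linearMap_ext_basis hξ hu fun χ w => ?_
    simp only [LinearMap.comp_apply, LinearMap.mulLeft_apply, LinearMap.mulRight_apply]
    rw [gg_mul_basis hξ hu, basis_mul_gg hξ hu]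
    simp only [map_add, map_smul, rho_basis hξ hu, smul_eq_mul, colourCount_comp]
    have e1 : (χ ∘ simpleT i) ∘ ⇑(simpleT i * w) = χ ∘ w := by
      funext j; simp
    have e2 : χ ∘ ⇑(w * simpleT i) = (χ ∘ w) ∘ simpleT i := rfl
    rw [e1, e2]
    by_cases hw : χ ∘ w = χ
    · have hwl := congrFun hw (lft i)
      have hwr := congrFun hw (rgt i)
      simp only [Function.comp_apply] at hwl hwr
      rw [hw, hwl, hwr]
      by_cases h : χ (lft i) = χ (rgt i)
      · rw [comp_simpleT h]
        simp only [h, true_and, if_true]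
        have := weight_comm (v := v) hu h hw
        have t1 : (if ¬ Asc i w then v else 0) = if Asc i w then 0 else v := by
          split_ifs <;> rfl
        have t2 : (if ¬ w (lft i) < w (rgt i) then v else 0) =
            if w (lft i) < w (rgt i) then 0 else v := by
          split_ifs <;> rfl
        rw [t1, t2]
        linear_combination α (base (colourCount χ)) * this
      · have h1 : χ ≠ χ ∘ simpleT i := fun he => h (by
          have := congrFun he (lft i); simpa using this)
        simp [h, h1, h1.symm]
    · have h1 : (χ ∘ w) ∘ simpleT i = χ ↔ χ ∘ w = χ ∘ simpleT i := by
        constructor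
        · intro h
          calc χ ∘ w = ((χ ∘ w) ∘ simpleT i) ∘ simpleT i := by funext j; simp
            _ = χ ∘ simpleT i := by rw [h]
        · intro h; rw [h]; funext j; simp
      simp only [hw, if_false, mul_zero, add_zero]
      by_cases h2 : χ ∘ w = χ ∘ simpleT i
      · have h : χ (lft i) ≠ χ (rgt i) := fun h => hw (h2.trans (comp_simpleT h))
        rw [if_pos h2, if_pos (h1.2 h2), weight_simpleT_mul_of_ne h w h2]
      · rw [if_neg h2, if_neg (h1.not.2 h2)]
  exact LinearMap.congr_fun this x

theorem rho_tt_comm (hξ : IsRootFamily ξ) (hu : u ≠ 0) (α : (Fin d → ℕ) → K) (j : Fin n)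
    (x : Y K d u v n) : rho u v hξ α n (tt j * x) = rho u v hξ α n (x * tt j) := by
  have : rho u v hξ α n ∘ₗ LinearMap.mulLeft K (tt j) =
      rho u v hξ α n ∘ₗ LinearMap.mulRight K (tt j) := by
    refine linearMap_ext_basis hξ hu fun χ w => ?_
    simp only [LinearMap.comp_apply, LinearMap.mulLeft_apply, LinearMap.mulRight_apply]
    rw [tt_mul_basis hξ, basis_mul_tt hξ hu, map_smul, map_smul, rho_basis hξ hu]
    split_ifs with h
    · have := congrFun h j
      simp only [Function.comp_apply] at this
      rw [this]
    · simp
  exact LinearMap.congr_fun this x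

theorem rho_trace (hξ : IsRootFamily ξ) (hu : u ≠ 0) (α : (Fin d → ℕ) → K) (x y : Y K d u v n) :
    rho u v hξ α n (x * y) = rho u v hξ α n (y * x) := by
  induction x using YAlg.induction_left generalizing y with
  | one => simp
  | add x x' hx hx' => rw [add_mul, mul_add, map_add, map_add, hx, hx']
  | smul k x hx => rw [smul_mul_assoc, mul_smul_comm, map_smul, map_smul, hx]
  | g i x hx => rw [mul_assoc, rho_gg_comm hξ hu, mul_assoc, hx, mul_assoc]
  | t j x hx => rw [mul_assoc, rho_tt_comm hξ hu, mul_assoc, hx, mul_assoc]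

theorem snoc_comp_extPerm (χ : Fin n → Fin d) (c : Fin d) (w : Equiv.Perm (Fin n)) :
    (Fin.snoc χ c : Fin (n + 1) → Fin d) ∘ extPerm w = Fin.snoc (χ ∘ w) c := by
  funext j
  cases j using Fin.lastCases <;> simp

theorem snoc_comp_extPerm_eq_iff (χ : Fin n → Fin d) (c : Fin d) (w : Equiv.Perm (Fin n)) :
    (Fin.snoc χ c : Fin (n + 1) → Fin d) ∘ extPerm w = Fin.snoc χ c ↔ χ ∘ w = χ := by
  rw [snoc_comp_extPerm]
  constructor
  · intro h
    funext j
    have := congrFun h j.castSucc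
    simpa using this
  · intro h; rw [h]

theorem base_colourCount_snoc {χ : Fin n → Fin d} {c : Fin d} (h : colourCount χ c ≠ 0) :
    base (colourCount (Fin.snoc χ c : Fin (n + 1) → Fin d)) = base (colourCount χ) := by
  funext a
  rw [base, base, colourCount_snoc]
  by_cases ha : a = c
  · subst ha; simp [h]
  · simp [ha]

theorem colourCount_ne_zero (χ : Fin n → Fin d) (j : Fin n) : colourCount χ (χ j) ≠ 0 :=
  Finset.card_ne_zero_of_mem (mem_positions.2 rfl)

theorem rho_snoc (hξ : IsRootFamily ξ) (hu : u ≠ 0) (α : (Fin d → ℕ) → K) (χ : Fin n → Fin d)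
    (c : Fin d) (w : Equiv.Perm (Fin n)) :
    rho u v hξ α (n + 1) (Echi ξ u v (Fin.snoc χ c : Fin (n + 1) → Fin d) * gt u v (extPerm w)) =
      if χ ∘ w = χ then α (base (colourCount (Fin.snoc χ c : Fin (n + 1) → Fin d))) *
        ((if colourCount χ c = 0 then 1 else kappa u v) * weight u v χ w) else 0 := by
  rw [rho_basis hξ hu, weight_snoc hu]
  simp only [snoc_comp_extPerm_eq_iff]

theorem rho_markov (hξ : IsRootFamily ξ) (hu : u ≠ 0) (α : (Fin d → ℕ) → K)
    (x : Y K d u v (n + 1)) :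
    rho u v hξ α (n + 2) (incl _ _ _ (n + 1) x * gg (n := n + 2) (Fin.last n)) =
      rho u v hξ α (n + 1) x := by
  have : rho u v hξ α (n + 2) ∘ₗ LinearMap.mulRight K (gg (n := n + 2) (Fin.last n)) ∘ₗ
      (incl _ _ _ (n + 1)).toLinearMap = rho u v hξ α (n + 1) := by
    refine linearMap_ext_basis hξ hu fun χ w => ?_
    simp only [LinearMap.comp_apply, LinearMap.mulRight_apply, AlgHom.toLinearMap_apply]
    have hrgt : rgt (n := n + 2) (Fin.last n) = Fin.last (n + 1) := rfl
    have hlft : lft (n := n + 2) (Fin.last n) = (Fin.last n).castSucc := rfl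
    have hlt : extPerm w (lft (n := n + 2) (Fin.last n)) <
        extPerm w (rgt (n := n + 2) (Fin.last n)) := by
      rw [hrgt, hlft, extPerm_last, extPerm_castSucc]; exact Fin.castSucc_lt_last _
    rw [incl_basis hξ, Finset.sum_mul, map_sum]
    have key : ∀ c, rho u v hξ α (n + 2)
        (Echi ξ u v (Fin.snoc χ c : Fin (n + 2) → Fin d) * gt u v (extPerm w) *
          gg (n := n + 2) (Fin.last n)) =
        if c = χ (Fin.last n) then rho u v hξ α (n + 1) (Echi ξ u v χ * gt u v w) else 0 := by
      intro c
      rw [basis_mul_gg hξ hu, if_neg (fun h => h.2 hlt), zero_smul, add_zero, map_smul,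
        rho_basis hξ hu, rho_basis hξ hu]
      have hiff : (Fin.snoc χ c : Fin (n + 2) → Fin d) ∘
          ⇑(extPerm w * simpleT (n := n + 2) (Fin.last n)) = Fin.snoc χ c ↔
          c = χ (Fin.last n) ∧ χ ∘ w = χ := by
        have e : (Fin.snoc χ c : Fin (n + 2) → Fin d) ∘
            ⇑(extPerm w * simpleT (n := n + 2) (Fin.last n)) =
            (Fin.snoc (χ ∘ w) c : Fin (n + 2) → Fin d) ∘ simpleT (n := n + 2) (Fin.last n) := by
          rw [← snoc_comp_extPerm]; rfl
        rw [e]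
        constructor
        · intro h
          have h1 := congrFun h (lft (n := n + 2) (Fin.last n))
          rw [Function.comp_apply, simpleT_lft, hrgt, hlft, Fin.snoc_last, Fin.snoc_castSucc] at h1
          refine ⟨h1, ?_⟩
          have h2 := congrFun h (rgt (n := n + 2) (Fin.last n))
          rw [Function.comp_apply, simpleT_rgt, hrgt, hlft, Fin.snoc_last,
            Fin.snoc_castSucc] at h2
          funext j
          by_cases hj : j = Fin.last n
          · rw [hj, h2, h1]
          · have h3 := congrFun h j.castSucc
            rw [Function.comp_apply, simpleT_of_ne, Fin.snoc_castSucc, Fin.snoc_castSucc] at h3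
            · exact h3
            · rw [hlft]; exact fun he => hj (Fin.castSucc_injective _ he)
            · rw [hrgt]; exact (Fin.castSucc_lt_last _).ne
        · rintro ⟨h1, h2⟩
          rw [h2]
          refine comp_simpleT ?_
          rw [hlft, hrgt, Fin.snoc_last, Fin.snoc_castSucc, h1]
      simp only [hiff]
      by_cases hc : c = χ (Fin.last n)
      · by_cases hw : χ ∘ w = χ
        · simp only [hc, hw, and_self, if_true, smul_eq_mul]
          rw [base_colourCount_snoc (colourCount_ne_zero χ _), mul_left_comm,
            weight_snoc_mul hu hw]
        · simp [hw]
      · simp [hc]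
    rw [Finset.sum_congr rfl fun c _ => key c, Finset.sum_ite_eq' Finset.univ, if_pos (by simp)]
  exact LinearMap.congr_fun this x

/-- Since `e_n` selects the colour of the last strand for the new one, that colour always occurs,
and the new strand contributes `κ` whatever the parameters are. -/
theorem rho_incl_mul_ee (hξ : IsRootFamily ξ) (hu : u ≠ 0) (α : (Fin d → ℕ) → K)
    (x : Y K d u v (n + 1)) :
    rho u v hξ α (n + 2) (incl _ _ _ (n + 1) x * ee (n := n + 2) (Fin.last n)) =
      kappa u v * rho u v hξ α (n + 1) x := by
  have : rho u v hξ α (n + 2) ∘ₗ LinearMap.mulRight K (ee (n := n + 2) (Fin.last n)) ∘ₗ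
      (incl _ _ _ (n + 1)).toLinearMap = kappa u v • rho u v hξ α (n + 1) := by
    refine linearMap_ext_basis hξ hu fun χ w => ?_
    simp only [LinearMap.comp_apply, LinearMap.mulRight_apply, AlgHom.toLinearMap_apply,
      LinearMap.smul_apply]
    have hrgt : rgt (n := n + 2) (Fin.last n) = Fin.last (n + 1) := rfl
    have hlft : lft (n := n + 2) (Fin.last n) = (Fin.last n).castSucc := rfl
    rw [incl_basis hξ, Finset.sum_mul, map_sum]
    simp only [basis_mul_ee hξ hu, hrgt, hlft, extPerm_last, extPerm_castSucc, Fin.snoc_last,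
      Fin.snoc_castSucc, map_smul, rho_snoc hξ hu]
    rw [Finset.sum_eq_single (χ (w (Fin.last n)))]
    · rw [rho_basis hξ hu, base_colourCount_snoc (colourCount_ne_zero χ _),
        if_neg (colourCount_ne_zero χ _)]
      simp only [if_true, smul_eq_mul]
      split_ifs <;> ring
    · intro c _ hc
      rw [if_neg hc.symm, zero_smul]
    · simp
  exact LinearMap.congr_fun this x

theorem inverse_gg (hu : u ≠ 0) (i : Fin (n - 1)) :
    (gg i * ((u ^ 2)⁻¹ • (gg i - v • ee i)) : Y K d u v n) = 1 ∧
      ((u ^ 2)⁻¹ • (gg i - v • ee i)) * gg i = (1 : Y K d u v n) := by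
  have h1 : gg i * gg i - v • (ee i * gg i) = u ^ 2 • (1 : Y K d u v n) := by
    rw [gg_mul_self, zero_smul, add_zero, add_sub_cancel_right, Algebra.algebraMap_eq_smul_one]
  have hu2 : (u ^ 2)⁻¹ * u ^ 2 = 1 := inv_mul_cancel₀ (pow_ne_zero 2 hu)
  constructor
  · rw [mul_smul_comm, mul_sub, mul_smul_comm, ← (commute_ee_gg i).eq, h1, smul_smul, hu2, one_smul]
  · rw [smul_mul_assoc, sub_mul, smul_mul_assoc, h1, smul_smul, hu2, one_smul]

theorem isMarkovTrace_rho (hξ : IsRootFamily ξ) (hu : u ≠ 0) (hv : v ≠ 0)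
    (α : (Fin d → ℕ) → K) : IsMarkovTrace u v (rho u v hξ α) where
  trace _ _ := rho_trace hξ hu α
  markov _ := rho_markov hξ hu α
  markov_inv n x := by
    rw [inverse_eq_of_mul (inverse_gg hu _).1 (inverse_gg hu _).2, mul_smul_comm, mul_sub,
      mul_smul_comm, map_smul, map_sub, map_smul, rho_markov hξ hu, rho_incl_mul_ee hξ hu, kappa,
      smul_eq_mul, smul_eq_mul]
    field_simp
    ring

theorem pow_mul_eigen {A : Type*} [Ring A] [Algebra K A] {x y : A} {a : K} (h : x * y = a • x)
    (b : ℕ) : x * y ^ b = a ^ b • x := by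
  induction b with
  | zero => simp
  | succ b ih => rw [pow_succ, ← mul_assoc, ih, smul_mul_assoc, h, smul_smul, pow_succ]

theorem rho_incl_mul_tt_pow (hξ : IsRootFamily ξ) (hu : u ≠ 0) (α : (Fin d → ℕ) → K)
    (χ : Fin n → Fin d) (w : Equiv.Perm (Fin n)) (b : ℕ) :
    rho u v hξ α (n + 1)
      (incl _ _ _ n (Echi ξ u v χ * gt u v w) * tt (Fin.last n) ^ b) =
      if χ ∘ w = χ then (∑ c, ξ c ^ b *
        (α (base (colourCount (Fin.snoc χ c : Fin (n + 1) → Fin d))) *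
          (if colourCount χ c = 0 then 1 else kappa u v))) * weight u v χ w else 0 := by
  rw [incl_basis hξ, Finset.sum_mul, map_sum]
  have : ∀ c, Echi ξ u v (Fin.snoc χ c : Fin (n + 1) → Fin d) * gt u v (extPerm w) *
      tt (Fin.last n) ^ b =
      ξ c ^ b • (Echi ξ u v (Fin.snoc χ c : Fin (n + 1) → Fin d) * gt u v (extPerm w)) := by
    intro c
    refine pow_mul_eigen ?_ b
    rw [basis_mul_tt hξ hu, extPerm_last, Fin.snoc_last]
  simp only [this, map_smul, rho_snoc hξ hu, smul_eq_mul]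
  split_ifs with h
  · rw [Finset.sum_mul]
    exact Finset.sum_congr rfl fun c _ => by ring
  · simp

end Psi

/-! ### The parameters attached to a set of roots of unity -/

section AlphaS

variable {K : Type} [Field K] {d n : ℕ} {u v : K} {ξ : Fin d → K}

theorem alphaS_base (D : K) (S : Finset (Fin d)) (μ : Fin d → ℕ) :
    alphaS D S (base μ) = if Finset.univ.filter (fun a => μ a ≠ 0) ⊆ S then
      D ^ ((Finset.univ.filter (fun a => μ a ≠ 0)).card - 1) /
        (S.card : K) ^ (Finset.univ.filter (fun a => μ a ≠ 0)).card else 0 := by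
  have h1 : ∑ a, base μ a = (Finset.univ.filter (fun a => μ a ≠ 0)).card := by
    rw [Finset.card_filter]
    exact Finset.sum_congr rfl fun a _ => by simp only [base]; split_ifs <;> simp_all
  have h2 : (∃ a, a ∉ S ∧ 0 < base μ a) ↔
      ¬ Finset.univ.filter (fun a => μ a ≠ 0) ⊆ S := by
    simp only [Finset.subset_iff, Finset.mem_filter, Finset.mem_univ, true_and, not_forall, base]
    refine exists_congr fun a => ?_
    by_cases h : μ a = 0 <;> simp [h]
  rw [alphaS, h1]
  by_cases h : Finset.univ.filter (fun a => μ a ≠ 0) ⊆ S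
  · rw [if_pos h, if_neg (by rw [h2]; exact fun h' => h' h)]
  · rw [if_neg h, if_pos (h2.2 h)]

theorem support_colourCount_snoc (χ : Fin n → Fin d) (c : Fin d) :
    Finset.univ.filter (fun a => colourCount (Fin.snoc χ c : Fin (n + 1) → Fin d) a ≠ 0) =
      insert c (Finset.univ.filter fun a => colourCount χ a ≠ 0) := by
  ext a
  simp only [colourCount_snoc, Finset.mem_filter, Finset.mem_univ, true_and, Finset.mem_insert]
  by_cases h : a = c <;> simp [h]

/-- Adding a vertical strand of colour `c ∈ S` multiplies the trace by `D / |S|`, whether or not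
this colour has occurred before. -/
theorem alphaS_snoc {D : K} {S : Finset (Fin d)} (χ : Fin (n + 1) → Fin d)
    (c : Fin d) :
    alphaS D S (base (colourCount (Fin.snoc χ c : Fin (n + 2) → Fin d))) *
      (if colourCount χ c = 0 then 1 else D / S.card) =
    if c ∈ S then D / S.card * alphaS D S (base (colourCount χ)) else 0 := by
  rw [alphaS_base, alphaS_base, support_colourCount_snoc]
  set T := Finset.univ.filter fun a => colourCount χ a ≠ 0 with hT
  have hT0 : T.card ≠ 0 := Finset.card_ne_zero_of_mem (a := χ 0)
    (by simp [hT, colourCount_ne_zero χ 0])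
  by_cases hc : c ∈ S
  · rw [if_pos hc]
    have hsub : insert c T ⊆ S ↔ T ⊆ S := by simp [Finset.insert_subset_iff, hc]
    by_cases hTS : T ⊆ S
    · rw [if_pos (hsub.2 hTS), if_pos hTS]
      by_cases h0 : colourCount χ c = 0
      · rw [if_pos h0, Finset.card_insert_of_notMem (by simp [hT, h0])]
        obtain ⟨k, hk⟩ := Nat.exists_eq_succ_of_ne_zero hT0
        rw [hk]
        simp only [Nat.succ_eq_add_one, Nat.add_sub_cancel, mul_one, div_mul_div_comm, pow_succ,
          mul_comm]
      · rw [if_neg h0, Finset.insert_eq_of_mem (by simp [hT, h0]), mul_comm]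
    · rw [if_neg (hsub.not.2 hTS), if_neg hTS, zero_mul, mul_zero]
  · rw [if_neg hc, if_neg fun h => hc (h (Finset.mem_insert_self _ _)), zero_mul]

/-- The framing condition, up to the factor `D`: the strand is the sum over its colours `c`, on
which `t_{n+1}` acts as `ξ_c`. -/
theorem rho_alphaS_framing (hξ : IsRootFamily ξ) (hu : u ≠ 0) {D : K}
    {S : Finset (Fin d)} (hκ : kappa u v = D / S.card) (x : Y K d u v (n + 1)) (b : ℕ) :
    rho u v hξ (alphaS D S) (n + 2) (incl _ _ _ (n + 1) x * tt (Fin.last (n + 1)) ^ b) =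
      D * eSystem ξ S b * rho u v hξ (alphaS D S) (n + 1) x := by
  have : rho u v hξ (alphaS D S) (n + 2) ∘ₗ LinearMap.mulRight K (tt (Fin.last (n + 1)) ^ b) ∘ₗ
      (incl _ _ _ (n + 1)).toLinearMap =
        (D * eSystem ξ S b) • rho u v hξ (alphaS D S) (n + 1) := by
    refine linearMap_ext_basis hξ hu fun χ w => ?_
    simp only [LinearMap.comp_apply, LinearMap.mulRight_apply, AlgHom.toLinearMap_apply,
      LinearMap.smul_apply]
    rw [rho_incl_mul_tt_pow hξ hu, rho_basis hξ hu]
    simp only [hκ, alphaS_snoc]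
    simp only [mul_ite, mul_zero, Finset.sum_ite_mem, Finset.univ_inter, ← Finset.sum_mul]
    split_ifs
    · rw [eSystem, smul_eq_mul]; ring
    · simp
  exact LinearMap.congr_fun this x

theorem IsNormalizedMarkovTrace.apply_one {τ : ∀ n, Hecke K u v n →ₗ[K] K}
    (h : IsNormalizedMarkovTrace K u v τ) : ∀ {m : ℕ}, m ≤ 1 → τ m 1 = 1
  | 0, _ => h.zero
  | 1, _ => h.norm

theorem weight_one (hu : u ≠ 0) (hv : v ≠ 0) {χ : Fin n → Fin d}
    (h : ∀ a, colourCount χ a ≤ 1) : weight u v χ 1 = 1 := by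
  rw [weight, weightOrbit]
  refine Finset.prod_eq_one fun a _ => ?_
  rw [blockPerm_one, Tt_one, (isNormalizedMarkovTrace_ocneanu hu hv).apply_one (h a)]

theorem rho_alphaS_one (hξ : IsRootFamily ξ) (hu : u ≠ 0) (hv : v ≠ 0) {D : K}
    {S : Finset (Fin d)} (b : ℕ) :
    rho u v hξ (alphaS D S) 1 (tt (Fin.last 0) ^ b) = eSystem ξ S b := by
  have h1 : (1 : Y K d u v 0) = Echi ξ u v (Fin.elim0 : Fin 0 → Fin d) * gt u v 1 :=
    (basis_zero hξ _ _).symm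
  have h2 := rho_incl_mul_tt_pow (v := v) hξ hu (alphaS D S) (Fin.elim0 : Fin 0 → Fin d) 1 b
  have h0 : ∀ c, colourCount (Fin.elim0 : Fin 0 → Fin d) c = 0 := by
    simp [colourCount, positions]
  rw [← h1, map_one, one_mul, if_pos (Subsingleton.elim _ _),
    weight_one hu hv (fun c => by rw [h0]; omega), mul_one] at h2
  rw [h2, eSystem]
  have h3 : ∀ c, alphaS D S (base (colourCount (Fin.snoc (Fin.elim0 : Fin 0 → Fin d) c :
      Fin 1 → Fin d))) = if c ∈ S then (S.card : K)⁻¹ else 0 := by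
    intro c
    rw [alphaS_base, support_colourCount_snoc]
    simp [h0]
  simp only [h0, h3, if_true, mul_one, mul_ite, mul_zero, Finset.sum_ite_mem, Finset.univ_inter,
    ← Finset.sum_mul]
  exact mul_comm _ _

end AlphaS

/-! ### Changes of generators -/

section Twist

variable {K : Type} [Field K] {d n : ℕ} {A : Type} [Ring A] [Algebra K A]

theorem idem_mul_self (hd : (d : K) ≠ 0) {x y : A} (hxy : Commute x y)
    (hx : x ^ d = 1) (hy : y ^ d = 1) : idem K d x y * idem K d x y = idem K d x y := by
  have h1 : x * idem K d x y = y * idem K d x y := by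
    have h2 := Commute.mul_geom_sum₂ hxy d
    rw [hx, hy, sub_self] at h2
    have h3 : (∑ s ∈ Finset.range d, x ^ s * y ^ (d - s)) =
        (∑ s ∈ Finset.range d, x ^ s * y ^ (d - 1 - s)) * y := by
      rw [Finset.sum_mul]
      refine Finset.sum_congr rfl fun s hs => ?_
      have := Finset.mem_range.1 hs
      rw [mul_assoc, ← pow_succ, show d - 1 - s + 1 = d - s by omega]
    rw [← sub_eq_zero, ← sub_mul, idem, h3, mul_smul_comm, ← mul_assoc, h2, zero_mul, smul_zero]
  have h4 : ∀ s, x ^ s * idem K d x y = y ^ s * idem K d x y := by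
    intro s
    induction s with
    | zero => simp
    | succ s ih =>
      rw [pow_succ, mul_assoc, h1, ← mul_assoc, (hxy.pow_left s).eq, mul_assoc, ih, ← mul_assoc,
        pow_succ']
  have h5 : ∀ s ∈ Finset.range d, x ^ s * y ^ (d - s) * idem K d x y = idem K d x y := by
    intro s hs
    rw [(hxy.pow_pow s (d - s)).eq, mul_assoc, h4, ← mul_assoc, ← pow_add,
      Nat.sub_add_cancel (Finset.mem_range.1 hs).le, hy, one_mul]
  calc idem K d x y * idem K d x y
      = (d : K)⁻¹ • ∑ s ∈ Finset.range d, x ^ s * y ^ (d - s) * idem K d x y := by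
        rw [← Finset.sum_mul, ← smul_mul_assoc]; rfl
    _ = idem K d x y := by
        rw [Finset.sum_congr rfl h5, Finset.sum_const, Finset.card_range,
          ← Nat.cast_smul_eq_nsmul K, smul_smul, inv_mul_cancel₀ hd, one_smul]

/-- The element `p + (1 - p) e` attached to a pair of commuting elements, where `e` is their
idempotent `idem`. It acts as `1` on the image of `e` and as `p` on the image of `1 - e`. -/
def stretch (d : ℕ) (p : K) (x y : A) : A := algebraMap K A p + (1 - p) • idem K d x y

theorem stretch_commute {p : K} {x y z : A} (hx : Commute z x) (hy : Commute z y) :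
    Commute z (stretch d p x y) :=
  Commute.add_right (Algebra.commutes p z).symm ((idem_commute hx hy).smul_right _)

theorem stretch_intertwine {p : K} {g x y x' y' : A} (hx : g * x = x' * g)
    (hy : g * y = y' * g) : g * stretch d p x y = stretch d p x' y' * g := by
  rw [stretch, stretch, mul_add, add_mul, mul_smul_comm, smul_mul_assoc, idem_intertwine hx hy,
    Algebra.commutes]

theorem stretch_comm (p : K) {x y : A} (hxy : Commute x y)
    (hx : x ^ d = 1) (hy : y ^ d = 1) : stretch d p x y = stretch d p y x := by
  rw [stretch, stretch, idem_comm hxy hx hy]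

theorem stretch_mul (hd : (d : K) ≠ 0) (p p' : K) {x y : A} (hxy : Commute x y)
    (hx : x ^ d = 1) (hy : y ^ d = 1) :
    stretch d p x y * stretch d p' x y = stretch d (p * p') x y := by
  have h := idem_mul_self hd hxy hx hy
  simp only [stretch, Algebra.algebraMap_eq_smul_one, add_mul, mul_add, smul_mul_assoc,
    mul_smul_comm, h, one_mul, mul_one]
  module

theorem stretch_one (x y : A) : stretch d (1 : K) x y = 1 := by simp [stretch]

theorem idem_mul_stretch (hd : (d : K) ≠ 0) (p : K) {x y : A} (hxy : Commute x y)
    (hx : x ^ d = 1) (hy : y ^ d = 1) : idem K d x y * stretch d p x y = idem K d x y := by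
  have h := idem_mul_self hd hxy hx hy
  simp only [stretch, Algebra.algebraMap_eq_smul_one, mul_add, mul_smul_comm, h, mul_one]
  module

theorem map_stretch {B : Type} [Ring B] [Algebra K B] (f : A →ₐ[K] B) (p : K) (x y : A) :
    f (stretch d p x y) = stretch d p (f x) (f y) := by
  simp [stretch, map_idem]

/-- The rescaled generators `r (p + (1 - p) e_i) g_i`. -/
def twist (d : ℕ) (r p : K) (g : Fin (n - 1) → A) (t : Fin n → A) (i : Fin (n - 1)) : A :=
  r • (stretch d p (t (lft i)) (t (rgt i)) * g i)

theorem IsFramed.mul_stretch {g : Fin (n - 1) → A} {t : Fin n → A} (h : IsFramed d g t) (p : K)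
    (i : Fin (n - 1)) (a b : Fin n) : g i * stretch d p (t a) (t b) =
      stretch d p (t (simpleT i a)) (t (simpleT i b)) * g i :=
  stretch_intertwine (h.gt i a) (h.gt i b)

theorem IsFramed.commute_stretch {g : Fin (n - 1) → A} {t : Fin n → A} (h : IsFramed d g t)
    (p : K) (a b a' b' : Fin n) :
    Commute (stretch d p (t a) (t b)) (stretch d p (t a') (t b')) :=
  stretch_commute (stretch_commute (h.tt _ _) (h.tt _ _)).symm
    (stretch_commute (h.tt _ _) (h.tt _ _)).symm

theorem mul_mul_mul_comm_of_eq {M : Type*} [Semigroup M] {x y y' z w : M} (h : w * y = y' * w) :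
    x * w * (y * z) = x * y' * (w * z) := by
  rw [mul_assoc, ← mul_assoc w, h, mul_assoc, mul_assoc]

/-- The rescaled generators satisfy the relations of the framed braid monoid. -/
theorem IsFramed.twist {g : Fin (n - 1) → A} {t : Fin n → A} (h : IsFramed d g t) (r p : K) :
    IsFramed d (twist d r p g t) t where
  far i j hij := by
    obtain ⟨h1, h2⟩ := simpleT_far (Or.inl hij)
    obtain ⟨h3, h4⟩ := simpleT_far (Or.inr hij)
    have e1 := h.mul_stretch p i (lft j) (rgt j)
    have e2 := h.mul_stretch p j (lft i) (rgt i)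
    rw [h1, h2] at e1
    rw [h3, h4] at e2
    have e3 := h.commute_stretch p (lft i) (rgt i) (lft j) (rgt j)
    rw [JL.twist, JL.twist, smul_mul_smul_comm, smul_mul_smul_comm, mul_mul_mul_comm_of_eq e1,
      mul_mul_mul_comm_of_eq e2, e3.eq, h.far i j hij]
  braid i j hij := by
    have hb := rgt_eq_lft hij
    obtain ⟨h2, h1⟩ := simpleT_adj hij
    have h3 : simpleT i (lft j) = lft i := by rw [← hb]; simp
    have e1 : g i * stretch d p (t (lft j)) (t (rgt j)) =
        stretch d p (t (lft i)) (t (rgt j)) * g i := by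
      have := h.mul_stretch p i (lft j) (rgt j)
      rwa [h3, h2] at this
    have e2 : g i * stretch d p (t (lft i)) (t (rgt j)) =
        stretch d p (t (lft j)) (t (rgt j)) * g i := by
      have := h.mul_stretch p i (lft i) (rgt j)
      rwa [simpleT_lft, h2, hb] at this
    have e3 : g j * stretch d p (t (lft i)) (t (lft j)) =
        stretch d p (t (lft i)) (t (rgt j)) * g j := by
      have := h.mul_stretch p j (lft i) (lft j)
      rwa [simpleT_lft, h1] at this
    have e4 : g j * stretch d p (t (lft i)) (t (rgt j)) =
        stretch d p (t (lft i)) (t (lft j)) * g j := by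
      have := h.mul_stretch p j (lft i) (rgt j)
      rwa [simpleT_rgt, h1] at this
    have c1 := h.commute_stretch p (lft i) (lft j) (lft i) (rgt j)
    have c2 := h.commute_stretch p (lft i) (lft j) (lft j) (rgt j)
    have c3 := h.commute_stretch p (lft i) (rgt j) (lft j) (rgt j)
    have hg := h.braid i j hij
    simp only [JL.twist, hb, smul_mul_smul_comm]
    congr 1
    generalize stretch d p (t (lft i)) (t (lft j)) = X at *
    generalize stretch d p (t (lft i)) (t (rgt j)) = Y at *
    generalize stretch d p (t (lft j)) (t (rgt j)) = Z at *
    calc X * g i * (Z * g j) * (X * g i) = X * (g i * Z) * (g j * X) * g i := by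
          simp only [mul_assoc]
      _ = X * Y * (g i * Y) * g j * g i := by rw [e1, e3]; simp only [mul_assoc]
      _ = X * Y * Z * (g i * g j * g i) := by rw [e2]; simp only [mul_assoc]
      _ = Z * Y * X * (g j * g i * g j) := by
          rw [hg, c3.right_comm, c2.eq, mul_assoc Z, c1.eq]
          simp only [mul_assoc]
      _ = Z * Y * (g j * Y) * g i * g j := by rw [e4]; simp only [mul_assoc]
      _ = Z * g j * (X * g i) * (Z * g j) := by
          have : Z * g j * (X * g i) * (Z * g j) = Z * (g j * X) * (g i * Z) * g j := by
            simp only [mul_assoc]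
          rw [this, e1, e3]; simp only [mul_assoc]
  tt := h.tt
  gt i j := by
    simp only [JL.twist, smul_mul_assoc, mul_smul_comm]
    rw [mul_assoc, h.gt, ← mul_assoc, ← mul_assoc,
      (stretch_commute (h.tt _ _) (h.tt _ _) : Commute (t (simpleT i j)) _).eq]
  tpow := h.tpow

theorem IsFramed.twist_mul_self (hd : (d : K) ≠ 0) {g : Fin (n - 1) → A} {t : Fin n → A}
    (h : IsFramed d g t) {a b c : K} {i : Fin (n - 1)}
    (hq : g i * g i = algebraMap K A a + b • idem K d (t (lft i)) (t (rgt i)) +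
      c • (idem K d (t (lft i)) (t (rgt i)) * g i)) (r p : K) :
    JL.twist d r p g t i * JL.twist d r p g t i = algebraMap K A (r ^ 2 * p ^ 2 * a) +
      (r ^ 2 * ((1 - p ^ 2) * a + b)) • idem K d (t (lft i)) (t (rgt i)) +
      (r * c) • (idem K d (t (lft i)) (t (rgt i)) * JL.twist d r p g t i) := by
  have hc : Commute (t (lft i)) (t (rgt i)) := h.tt _ _
  have hl := h.tpow (lft i)
  have hr := h.tpow (rgt i)
  have e1 := h.mul_stretch p i (lft i) (rgt i)
  rw [simpleT_lft, simpleT_rgt, ← stretch_comm p hc hl hr] at e1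
  have e2 := stretch_mul hd p p hc hl hr
  have e3 := idem_mul_stretch hd p hc hl hr
  have e4 := idem_mul_stretch hd (p * p) hc hl hr
  have e5 : Commute (idem K d (t (lft i)) (t (rgt i)))
      (stretch d (p * p) (t (lft i)) (t (rgt i))) :=
    stretch_commute (idem_commute (Commute.refl _) hc).symm
      (idem_commute hc.symm (Commute.refl _)).symm
  rw [e5.eq] at e4
  rw [JL.twist, smul_mul_smul_comm, mul_smul_comm, mul_mul_mul_comm_of_eq e1, e2,
    ← mul_assoc (idem K d _ _), e3, hq, mul_add, mul_add, mul_smul_comm, e4, mul_smul_comm,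
    ← mul_assoc, e4,
    ← Algebra.commutes, ← Algebra.smul_def, stretch, Algebra.algebraMap_eq_smul_one,
    Algebra.algebraMap_eq_smul_one]
  module

section YAlg

variable {a b c a' b' c' : K}

/-- The morphism `g_i ↦ r (p + (1 - p) e_i) g_i`, `t_j ↦ t_j`. -/
def twistHom (hd : (d : K) ≠ 0) (r p : K) (ha : a' = r ^ 2 * p ^ 2 * a)
    (hb : b' = r ^ 2 * ((1 - p ^ 2) * a + b)) (hc : c' = r * c) (n : ℕ) :
    YAlg K d a' b' c' n →ₐ[K] YAlg K d a b c n :=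
  YAlg.lift (isFramed_gens.twist r p) fun i => by
    rw [isFramed_gens.twist_mul_self hd (gg_mul_self i), ha, hb, hc]

variable (hd : (d : K) ≠ 0) {r p : K} (ha : a' = r ^ 2 * p ^ 2 * a)
    (hb : b' = r ^ 2 * ((1 - p ^ 2) * a + b)) (hc : c' = r * c)

theorem twistHom_gg (i : Fin (n - 1)) : twistHom hd r p ha hb hc n (gg i) =
    r • (stretch d p (tt (lft i)) (tt (rgt i)) * gg i) := YAlg.lift_gg _ _ i

theorem twistHom_tt (j : Fin n) : twistHom hd r p ha hb hc n (tt j) = tt j := YAlg.lift_tt _ _ j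

theorem twistHom_incl (x : YAlg K d a' b' c' n) :
    twistHom hd r p ha hb hc (n + 1) (incl _ _ _ n x) = incl _ _ _ n (twistHom hd r p ha hb hc n x) := by
  have : (twistHom hd r p ha hb hc (n + 1)).comp (incl _ _ _ n) =
      (incl _ _ _ n).comp (twistHom hd r p ha hb hc n) := by
    refine YAlg.hom_ext (fun i => ?_) fun j => ?_
    · simp only [AlgHom.comp_apply, incl_gg, twistHom_gg, map_smul, map_mul, map_stretch, incl_tt,
        lft_extGen, rgt_extGen]
    · simp only [AlgHom.comp_apply, incl_tt, twistHom_tt]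
  exact AlgHom.congr_fun this x

theorem commute_tt (i j : Fin n) : Commute (tt i : YAlg K d a b c n) (tt j) := isFramed_gens.tt i j

theorem twistHom_comp_eq_id {r' p' : K} (ha' : a = r' ^ 2 * p' ^ 2 * a')
    (hb' : b = r' ^ 2 * ((1 - p' ^ 2) * a' + b')) (hc' : c = r' * c') (hr : r * r' = 1)
    (hp : p * p' = 1) :
    (twistHom hd r' p' ha' hb' hc' n).comp (twistHom hd r p ha hb hc n) = AlgHom.id K _ := by
  refine YAlg.hom_ext (fun i => ?_) fun j => ?_
  · rw [AlgHom.comp_apply, twistHom_gg, map_smul, map_mul, map_stretch, twistHom_tt, twistHom_tt,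
      twistHom_gg, mul_smul_comm, smul_smul, hr, one_smul, ← mul_assoc,
      stretch_mul hd _ _ (commute_tt _ _) (isFramed_gens.tpow _) (isFramed_gens.tpow _), hp,
      stretch_one, one_mul, AlgHom.id_apply]
  · rw [AlgHom.comp_apply, twistHom_tt, twistHom_tt, AlgHom.id_apply]

end YAlg

end Twist

/-! ### Framed braids -/

section FramedBraid

variable {d n : ℕ} {A : Type*} [Monoid A]

/-- The morphism from framed braids given by invertible elements which satisfy the relations. -/
def FramedBraid.lift (hd : d ≠ 0) {g : Fin (n - 1) → A} {t : Fin n → A} (h : IsFramed d g t)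
    (hg : ∀ i, IsUnit (g i)) : FramedBraid d n →* A :=
  (Units.coeHom A).comp (PresentedGroup.toGroup
    (f := fun x : Gen n => match x with
      | Gen.g i => (hg i).unit
      | Gen.t j => (IsUnit.of_pow_eq_one (h.tpow j) hd).unit) (by
    rintro _ ⟨x, y, hr, rfl⟩
    rw [map_mul, map_inv, mul_inv_eq_one]
    ext
    cases hr with
    | far i j hij => simpa using h.far i j hij
    | braid i j hij => simpa using h.braid i j hij
    | tt i j => simpa using h.tt i j
    | gt i j => simpa using h.gt i j
    | tpow j => simpa using h.tpow j))

theorem FramedBraid.lift_g (hd : d ≠ 0) {g : Fin (n - 1) → A} {t : Fin n → A} (h : IsFramed d g t)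
    (hg : ∀ i, IsUnit (g i)) (i : Fin (n - 1)) :
    FramedBraid.lift hd h hg (PresentedGroup.of (Gen.g i)) = g i := by
  simp [FramedBraid.lift]

theorem FramedBraid.lift_t (hd : d ≠ 0) {g : Fin (n - 1) → A} {t : Fin n → A} (h : IsFramed d g t)
    (hg : ∀ i, IsUnit (g i)) (j : Fin n) :
    FramedBraid.lift hd h hg (PresentedGroup.of (Gen.t j)) = t j := by
  simp [FramedBraid.lift]

end FramedBraid

/-! ### Uniqueness of the trace -/

section Unique

variable {K : Type} [Field K] {d n : ℕ} {a b c : K}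

/-- The conditions of Juyumaya's trace on the chain of algebras with quadratic relation
`g_i ^ 2 = a + b e_i + c e_i g_i`. -/
structure IsChainTrace (z : K) (e : ℕ → K) (f : ∀ n, YAlg K d a b c n →ₗ[K] K) : Prop where
  one : ∀ n, f n 1 = 1
  trace : ∀ n x y, f n (x * y) = f n (y * x)
  markov : ∀ n x,
    f (n + 2) (incl _ _ _ (n + 1) x * gg (n := n + 2) (Fin.last n)) = z * f (n + 1) x
  framing : ∀ n x b, b < d → f (n + 1) (incl _ _ _ n x * tt (Fin.last n) ^ b) = e b * f n x

theorem isJuyumayaTrace_iff {q z : K} {e : ℕ → K} {tr : ∀ n, YJ K d q n →ₗ[K] K} :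
    IsJuyumayaTrace q z e tr ↔ IsChainTrace z e tr :=
  ⟨fun h => ⟨h.one, h.trace, h.markov, h.framing⟩, fun h => ⟨h.one, h.trace, h.markov, h.framing⟩⟩

/-- Since `e_n g_n` is the average of the elements `t_n ^ s g_n t_n ^ {-s}`, a trace which
satisfies the Markov condition for `g_n` satisfies it for `e_n g_n` as well. -/
theorem IsChainTrace.markov_ee (hd : (d : K) ≠ 0) {z : K} {e : ℕ → K}
    {f : ∀ n, YAlg K d a b c n →ₗ[K] K} (hf : IsChainTrace z e f) (n : ℕ)
    (x : YAlg K d a b c (n + 1)) : f (n + 2) (incl _ _ _ (n + 1) x *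
      (ee (n := n + 2) (Fin.last n) * gg (n := n + 2) (Fin.last n))) = z * f (n + 1) x := by
  have hlft : tt (lft (n := n + 2) (Fin.last n)) =
      incl a b c (n + 1) (tt (Fin.last n) : YAlg K d a b c (n + 1)) := (incl_tt _).symm
  have h1 : ∀ k, (tt (rgt (n := n + 2) (Fin.last n)) : YAlg K d a b c (n + 2)) ^ k *
      gg (n := n + 2) (Fin.last n) =
      gg (n := n + 2) (Fin.last n) * incl a b c (n + 1) (tt (Fin.last n)) ^ k := by
    intro k
    have h := isFramed_gens (K := K) (d := d) (a := a) (b := b) (c := c) (n := n + 2)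
    have h0 : SemiconjBy (gg (n := n + 2) (Fin.last n))
        (tt (lft (n := n + 2) (Fin.last n)) : YAlg K d a b c (n + 2))
        (tt (rgt (n := n + 2) (Fin.last n))) := by
      have := h.gt (Fin.last n) (lft (n := n + 2) (Fin.last n))
      rwa [simpleT_lft] at this
    rw [← hlft]
    exact (h0.pow_right k).symm
  have h2 : ∀ s ∈ Finset.range d, f (n + 2) (incl _ _ _ (n + 1) x *
      (tt (lft (n := n + 2) (Fin.last n)) ^ s * tt (rgt (n := n + 2) (Fin.last n)) ^ (d - s) *
        gg (n := n + 2) (Fin.last n))) = z * f (n + 1) x := by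
    intro s hs
    rw [mul_assoc _ _ (gg _), h1, hlft, ← mul_assoc, ← mul_assoc, hf.trace, ← map_pow, ← map_pow,
      ← mul_assoc, ← map_mul, ← map_mul, hf.markov, ← mul_assoc, hf.trace, ← mul_assoc, ← pow_add,
      Nat.add_sub_cancel' (Finset.mem_range.1 hs).le, isFramed_gens.tpow, one_mul]
  rw [ee, idem, smul_mul_assoc, Finset.sum_mul, mul_smul_comm, Finset.mul_sum, map_smul, map_sum,
    Finset.sum_congr rfl h2, Finset.sum_const, Finset.card_range, nsmul_eq_mul, smul_eq_mul,
    inv_mul_cancel_left₀ hd]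

/-- Juyumaya's conditions are preserved by the changes of generators, which rescale `z`. -/
theorem IsChainTrace.comp_twistHom {a' b' c' : K} (hd : (d : K) ≠ 0) {r p : K}
    (ha : a' = r ^ 2 * p ^ 2 * a) (hb : b' = r ^ 2 * ((1 - p ^ 2) * a + b)) (hc : c' = r * c)
    {z : K} {e : ℕ → K} {f : ∀ n, YAlg K d a b c n →ₗ[K] K} (hf : IsChainTrace z e f) :
    IsChainTrace (r * z) e fun n => f n ∘ₗ (twistHom hd r p ha hb hc n).toLinearMap where
  one n := by simp [hf.one]
  trace n x y := by simp [hf.trace n (twistHom hd r p ha hb hc n x)]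
  markov n x := by
    have := hf.markov_ee hd n (twistHom hd r p ha hb hc (n + 1) x)
    rw [ee] at this
    simp only [LinearMap.comp_apply, AlgHom.toLinearMap_apply, map_mul, twistHom_incl, twistHom_gg,
      stretch, Algebra.algebraMap_eq_smul_one, add_mul, smul_mul_assoc, one_mul, smul_add,
      mul_smul_comm, mul_add, map_add, map_smul, hf.markov, this, smul_eq_mul]
    ring
  framing n x k hk := by
    simp only [LinearMap.comp_apply, AlgHom.toLinearMap_apply, map_mul, twistHom_incl, map_pow,
      twistHom_tt, hf.framing n _ k hk]

variable {u v : K} {ξ : Fin d → K}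

/-- The coset representatives of the symmetric group that move the last strand contain the last
generator exactly once. -/
theorem exists_gt_extPerm_mul_cyc (hu : u ≠ 0) (k : Fin (n + 1)) : ∃ y : Y K d u v (n + 1),
    ∀ w : Equiv.Perm (Fin (n + 1)), gt u v (extPerm w * cyc (n + 1) k.castSucc) =
      incl _ _ _ (n + 1) (gt u v w) * gg (n := n + 2) (Fin.last n) * incl _ _ _ (n + 1) y := by
  have hlt : ∀ (w : Equiv.Perm (Fin (n + 1))) (k : Fin (n + 1)),
      (extPerm w * cyc (n + 1) k.succ) (lft (n := n + 2) k) <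
        (extPerm w * cyc (n + 1) k.succ) (rgt (n := n + 2) k) := by
    intro w k
    have h1 : (extPerm w * cyc (n + 1) k.succ) (rgt (n := n + 2) k) = Fin.last (n + 1) := by
      have : rgt (n := n + 2) k = k.succ := rfl
      rw [this, Equiv.Perm.mul_apply, cyc_self, extPerm_last]
    refine lt_of_le_of_ne (h1 ▸ Fin.le_last _) fun he => ?_
    exact (lft_lt_rgt (n := n + 2) k).ne ((extPerm w * cyc (n + 1) k.succ).injective he)
  have hstep : ∀ (w : Equiv.Perm (Fin (n + 1))) (k : Fin (n + 1)),
      (gt u v (extPerm w * cyc (n + 1) k.castSucc) : Y K d u v (n + 2)) =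
        u⁻¹ • (gt u v (extPerm w * cyc (n + 1) k.succ) * gg (n := n + 2) k) := by
    intro w k
    rw [gt_mul_gg_of_asc hu (hlt w k), smul_smul, inv_mul_cancel₀ hu, one_smul, mul_assoc,
      ← cyc_castSucc]
  induction k using Fin.reverseInduction with
  | last =>
    refine ⟨u⁻¹ • 1, fun w => ?_⟩
    rw [hstep, Fin.succ_last, cyc_last, mul_one, incl_gt, map_smul, map_one, mul_smul_comm, mul_one]
  | cast k ih =>
    obtain ⟨y, hy⟩ := ih
    refine ⟨u⁻¹ • (y * gg (n := n + 1) k), fun w => ?_⟩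
    have h1 : (gg (n := n + 2) k.castSucc : Y K d u v (n + 2)) =
        incl _ _ _ (n + 1) (gg (n := n + 1) k) := (incl_gg (n := n + 1) k).symm
    have h2 : k.castSucc.succ = k.succ.castSucc := rfl
    rw [hstep, h2, hy, h1, map_smul, map_mul, mul_smul_comm, ← mul_assoc]

theorem commute_tt_last_incl (x : YAlg K d a b c n) :
    Commute (tt (Fin.last n)) (incl a b c n x) := by
  have h := isFramed_gens (K := K) (d := d) (a := a) (b := b) (c := c) (n := n + 1)
  induction x using YAlg.induction_left with
  | one => simp
  | add x y hx hy => rw [map_add]; exact hx.add_right hy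
  | smul k x hx => rw [map_smul]; exact hx.smul_right k
  | g i x hx =>
    rw [map_mul, incl_gg]
    have := h.gt (extGen i) (Fin.last n)
    rw [simpleT_of_ne (by rw [lft_extGen]; exact (Fin.castSucc_lt_last _).ne')
      (by rw [rgt_extGen]; exact (Fin.castSucc_lt_last _).ne')] at this
    exact Commute.mul_right this.symm hx
  | t j x hx =>
    rw [map_mul, incl_tt]
    exact Commute.mul_right (h.tt _ _) hx

theorem Echi_snoc_mul_gt (χ : Fin n → Fin d) (c : Fin d) (w : Equiv.Perm (Fin n)) :
    Echi ξ u v (Fin.snoc χ c : Fin (n + 1) → Fin d) * incl _ _ _ n (gt u v w) =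
      incl _ _ _ n (Echi ξ u v χ * gt u v w) *
        idem K d (algebraMap K (Y K d u v (n + 1)) (ξ c)) (tt (Fin.last n)) := by
  have : Commute (idem K d (algebraMap K (Y K d u v (n + 1)) (ξ c)) (tt (Fin.last n)))
      (incl _ _ _ n (gt u v w)) :=
    (idem_commute (Algebra.commutes _ _).symm (commute_tt_last_incl _).symm).symm
  rw [Echi_snoc, mul_assoc, this.eq, ← mul_assoc, map_mul]

theorem linearMap_ext_zero (hξ : IsRootFamily ξ) (hu : u ≠ 0) {f f' : Y K d u v 0 →ₗ[K] K}
    (h : f 1 = f' 1) : f = f' := by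
  refine linearMap_ext_basis hξ hu fun χ w => ?_
  rw [basis_zero hξ, h]

theorem map_Echi_snoc_eq (hξ : IsRootFamily ξ) {f f' : Y K d u v (n + 1) →ₗ[K] K}
    (h : ∀ x, ∀ b < d, f (incl _ _ _ n x * tt (Fin.last n) ^ b) =
      f' (incl _ _ _ n x * tt (Fin.last n) ^ b)) (χ : Fin n → Fin d) (c : Fin d)
    (w : Equiv.Perm (Fin n)) :
    f (Echi ξ u v (Fin.snoc χ c : Fin (n + 1) → Fin d) * gt u v (extPerm w)) =
      f' (Echi ξ u v (Fin.snoc χ c : Fin (n + 1) → Fin d) * gt u v (extPerm w)) := by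
  rw [← incl_gt, Echi_snoc_mul_gt, idem_comm (Algebra.commutes _ _)
    (by rw [← map_pow, hξ.pow, map_one]) (isFramed_gens.tpow _), idem, mul_smul_comm, map_smul,
    map_smul, Finset.mul_sum, map_sum, map_sum]
  congr 1
  refine Finset.sum_congr rfl fun s hs => ?_
  rw [← map_pow, ← Algebra.commutes, ← Algebra.smul_def, mul_smul_comm, map_smul, map_smul,
    h _ s (Finset.mem_range.1 hs)]

theorem linearMap_ext_one (hξ : IsRootFamily ξ) (hu : u ≠ 0) {f f' : Y K d u v 1 →ₗ[K] K}
    (h : ∀ x, ∀ b < d, f (incl _ _ _ 0 x * tt (Fin.last 0) ^ b) =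
      f' (incl _ _ _ 0 x * tt (Fin.last 0) ^ b)) : f = f' := by
  refine linearMap_ext_basis hξ hu fun χ w => ?_
  have := map_Echi_snoc_eq hξ h (Fin.init χ) (χ (Fin.last 0)) 1
  rwa [Fin.snoc_init_self, extPerm_one, Subsingleton.elim (1 : Equiv.Perm (Fin 1)) w] at this

/-- On the algebra with `n + 2` strands, linear forms are determined by their values at the
elements `x t_{n+2} ^ b` and `x g_{n+1} y`, for `x`, `y` in the algebra with `n + 1` strands. -/
theorem linearMap_ext_succ (hξ : IsRootFamily ξ) (hu : u ≠ 0)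
    {f f' : Y K d u v (n + 2) →ₗ[K] K}
    (h : ∀ x, ∀ b < d, f (incl _ _ _ (n + 1) x * tt (Fin.last (n + 1)) ^ b) =
      f' (incl _ _ _ (n + 1) x * tt (Fin.last (n + 1)) ^ b))
    (hg : ∀ x y, f (incl _ _ _ (n + 1) x * gg (n := n + 2) (Fin.last n) * incl _ _ _ (n + 1) y) =
      f' (incl _ _ _ (n + 1) x * gg (n := n + 2) (Fin.last n) * incl _ _ _ (n + 1) y)) :
    f = f' := by
  refine linearMap_ext_basis hξ hu fun χ w => ?_
  obtain ⟨⟨w, k⟩, rfl⟩ := (cosetEquiv (n + 1)).surjective w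
  rw [cosetEquiv_apply]
  have hχ : χ = Fin.snoc (Fin.init χ) (χ (Fin.last (n + 1))) := (Fin.snoc_init_self χ).symm
  generalize Fin.init χ = ψ at hχ
  generalize χ (Fin.last (n + 1)) = c at hχ
  subst hχ
  induction k using Fin.lastCases with
  | last =>
    rw [cyc_last, mul_one]
    exact map_Echi_snoc_eq hξ h ψ c w
  | cast k =>
    obtain ⟨y, hy⟩ := exists_gt_extPerm_mul_cyc (d := d) (v := v) hu k
    have h1 := isFramed_gens (K := K) (d := d) (a := u ^ 2) (b := 0) (c := v) (n := n + 2)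
    have h2 : (tt (Fin.last (n + 1)) : Y K d u v (n + 2)) =
      tt (rgt (n := n + 2) (Fin.last n)) := rfl
    have h3 : tt (lft (n := n + 2) (Fin.last n)) =
      incl _ _ _ (n + 1) (tt (Fin.last n) : Y K d u v (n + 1)) := (incl_tt _).symm
    have h4 := h1.gt (Fin.last n) (lft (n := n + 2) (Fin.last n))
    rw [simpleT_lft, ← h2, h3] at h4
    have h5 := idem_intertwine (K := K) (d := d)
      (x := algebraMap K (Y K d u v (n + 2)) (ξ c)) (Algebra.commutes _ _).symm h4
    have h6 : idem K d (algebraMap K (Y K d u v (n + 2)) (ξ c)) (incl _ _ _ (n + 1)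
        (tt (Fin.last n))) = incl _ _ _ (n + 1)
        (idem K d (algebraMap K (Y K d u v (n + 1)) (ξ c)) (tt (Fin.last n))) := by
      rw [map_idem, AlgHom.commutes]
    rw [hy, ← mul_assoc, ← mul_assoc, Echi_snoc_mul_gt, mul_assoc _ _ (gg _), ← h5, h6,
      ← mul_assoc, mul_assoc _ (incl _ _ _ _ _), ← map_mul, hg]

theorem IsChainTrace.unique (hξ : IsRootFamily ξ) (hu : u ≠ 0) {z : K} {e : ℕ → K}
    {f f' : ∀ n, Y K d u v n →ₗ[K] K} (h : IsChainTrace z e f) (h' : IsChainTrace z e f') :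
    ∀ n, f n = f' n
  | 0 => linearMap_ext_zero hξ hu (by rw [h.one, h'.one])
  | 1 => linearMap_ext_one hξ hu fun x b hb => by
      rw [h.framing 0 x b hb, h'.framing 0 x b hb, unique hξ hu h h' 0]
  | n + 2 => linearMap_ext_succ hξ hu
      (fun x b hb => by
        rw [h.framing _ x b hb, h'.framing _ x b hb, unique hξ hu h h' (n + 1)])
      (fun x y => by
        rw [h.trace, h'.trace, ← mul_assoc, ← map_mul, h.markov, h'.markov,
          unique hξ hu h h' (n + 1)])

end Unique

/-! ### Uniqueness of the parameters -/

section Parameters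

variable {K : Type} [Field K] {d n : ℕ} {u v : K} {ξ : Fin d → K}

theorem mem_Comp0 {μ : Fin d → ℕ} : μ ∈ Comp0 d ↔ μ ≠ 0 ∧ ∀ a, μ a = 0 ∨ μ a = 1 := by
  simp [Comp0, Fintype.mem_piFinset]

theorem base_eq_self {μ : Fin d → ℕ} (h : μ ∈ Comp0 d) : base μ = μ := by
  funext a
  rcases (mem_Comp0.1 h).2 a with h | h <;> simp [base, h]

theorem base_mem_Comp0 {μ : Fin d → ℕ} (hn : 1 ≤ n)
    (h : μ ∈ Finset.piAntidiag Finset.univ n) : base μ ∈ Comp0 d := by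
  refine mem_Comp0.2 ⟨fun h0 => ?_, fun a => ?_⟩
  · have h1 : ∀ a, μ a = 0 := fun a => by
      have := congrFun h0 a
      by_contra hc
      simp [base, hc] at this
    have h2 : ∑ a, μ a = n := by simpa using h
    simp [h1] at h2
    omega
  · simp only [base]; split_ifs <;> simp

/-- Every composition counts the colours of some sequence of colours. -/
theorem exists_colourCount_eq (μ : Fin d → ℕ) :
    ∃ χ : Fin (∑ a, μ a) → Fin d, colourCount χ = μ := by
  refine ⟨fun j => (finSigmaFinEquiv.symm j).1, funext fun a => ?_⟩
  have : positions (fun j : Fin (∑ a, μ a) => (finSigmaFinEquiv.symm j).1) a =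
      (Finset.univ : Finset (Fin (μ a))).map
        ⟨fun k => finSigmaFinEquiv ⟨a, k⟩, fun k k' h => by simpa using h⟩ := by
    ext j
    obtain ⟨⟨b, k⟩, rfl⟩ := finSigmaFinEquiv.surjective j
    simp only [mem_positions, Equiv.symm_apply_apply, Finset.mem_map, Finset.mem_univ, true_and]
    constructor
    · rintro rfl; exact ⟨k, rfl⟩
    · rintro ⟨k', h⟩; exact (congrArg Sigma.fst (finSigmaFinEquiv.injective h)).symm
  rw [colourCount, this, Finset.card_map, Finset.card_univ, Fintype.card_fin]

theorem hasParameters_iff (hξ : IsRootFamily ξ) (hu : u ≠ 0) (hv : v ≠ 0)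
    {f : ∀ n, Y K d u v n →ₗ[K] K} {β : (Fin d → ℕ) → K}
    (hf : ∀ n, 1 ≤ n → f n = rho u v hξ β n) (α : (Fin d → ℕ) → K) :
    HasParameters ξ u v f α ↔ ∀ μ ∈ Comp0 d, α μ = β μ := by
  constructor
  · rintro ⟨τ, hτ, Ψ, hΨ, h⟩ μ hμ
    have hn : 1 ≤ ∑ a, μ a := by
      by_contra hc
      refine (mem_Comp0.1 hμ).1 (funext fun a => ?_)
      have : ∑ a, μ a = 0 := by omega
      exact Finset.sum_eq_zero_iff.1 this a (Finset.mem_univ a)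
    obtain ⟨χ, hχ⟩ := exists_colourCount_eq μ
    have h1 : ∀ a, colourCount χ a ≤ 1 := fun a => by
      rw [hχ]; rcases (mem_Comp0.1 hμ).2 a with h | h <;> omega
    have h2 := h _ hn (Echi ξ u v χ * gt u v 1)
    have h3 : χ ∘ (1 : Equiv.Perm (Fin (∑ a, μ a))) = χ := rfl
    rw [sum_param_basis hξ τ (hΨ _), hf _ hn, rho_basis hξ hu, if_pos h3, if_pos h3,
      weight_one hu hv h1, Finset.prod_eq_one, mul_one, mul_one, hχ, base_eq_self hμ] at h2
    · exact h2.symm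
    · intro a _
      rw [blockPerm_one, Tt_one, hτ.apply_one (h1 a)]
  · intro h
    refine ⟨ocneanu u v, isNormalizedMarkovTrace_ocneanu hu hv, psi u v hξ,
      fun n μ => isPsi_psi hξ hu n μ, fun n hn x => ?_⟩
    rw [hf n hn, rho_apply]
    exact Finset.sum_congr rfl fun μ hμ => by rw [h _ (base_mem_Comp0 hn hμ)]

/-- The expression of a Markov trace in the basis of those which have a single non-zero
parameter. -/
theorem rho_eq_sum (hξ : IsRootFamily ξ) (β : (Fin d → ℕ) → K) (hn : 1 ≤ n) (x : Y K d u v n) :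
    rho u v hξ β n x = ∑ ν ∈ Comp0 d, β ν * rho u v hξ (Pi.single ν 1) n x := by
  simp only [rho_apply, Finset.mul_sum]
  rw [Finset.sum_comm]
  refine Finset.sum_congr rfl fun μ hμ => ?_
  rw [Finset.sum_eq_single_of_mem (base μ) (base_mem_Comp0 hn hμ)]
  · simp
  · intro ν _ hν
    rw [Pi.single_eq_of_ne hν.symm, zero_mul, mul_zero]

end Parameters

/-! ### Juyumaya's trace as a Markov trace -/

section ChainTrace

variable {K : Type} [Field K] {d : ℕ} {u v : K} {ξ : Fin d → K}

/-- The trace with parameters `alphaS D S`, divided by `D ^ (n - 1)`. On no strands, where the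
formula for `rho` says nothing about the normalization, it is the identity of the ground field. -/
def chainTrace (u v : K) {ξ : Fin d → K} (hξ : IsRootFamily ξ) (D : K) (S : Finset (Fin d)) :
    ∀ n, Y K d u v n →ₗ[K] K
  | 0 => constr u v hξ fun _ _ => 1
  | n + 1 => (D ^ n)⁻¹ • rho u v hξ (alphaS D S) (n + 1)

theorem eSystem_zero {S : Finset (Fin d)} (hS : (S.card : K) ≠ 0) : eSystem ξ S 0 = 1 := by
  simp [eSystem, hS]

theorem isChainTrace_chainTrace (hξ : IsRootFamily ξ) (hu : u ≠ 0) (hv : v ≠ 0) {D : K}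
    (hD : D ≠ 0) {S : Finset (Fin d)} (hS : (S.card : K) ≠ 0) (hκ : kappa u v = D / S.card) :
    IsChainTrace D⁻¹ (eSystem ξ S) (chainTrace u v hξ D S) := by
  have h0 : chainTrace u v hξ D S 0 1 = 1 := by
    have : (1 : Y K d u v 0) = Echi ξ u v (Fin.elim0 : Fin 0 → Fin d) * gt u v 1 :=
      (basis_zero hξ _ _).symm
    rw [this]
    exact constr_basis hξ hu _ _ _
  have hz : ∀ x : Y K d u v 0, x = chainTrace u v hξ D S 0 x • (1 : Y K d u v 0) := by
    intro x
    have : LinearMap.id =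
        (LinearMap.toSpanSingleton K _ (1 : Y K d u v 0)) ∘ₗ chainTrace u v hξ D S 0 := by
      refine linearMap_ext_basis hξ hu fun χ w => ?_
      simp [basis_zero hξ, h0]
    exact LinearMap.congr_fun this x
  have hfr : ∀ n x b, chainTrace u v hξ D S (n + 1) (incl _ _ _ n x * tt (Fin.last n) ^ b) =
      eSystem ξ S b * chainTrace u v hξ D S n x := by
    rintro (_ | n) x b
    · rw [hz x, map_smul, map_one, smul_mul_assoc, one_mul, map_smul, map_smul, h0, smul_eq_mul,
        smul_eq_mul, mul_one, mul_comm]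
      congr 1
      simp only [chainTrace, pow_zero, inv_one, one_smul]
      exact rho_alphaS_one hξ hu hv b
    · simp only [chainTrace, LinearMap.smul_apply, smul_eq_mul]
      rw [rho_alphaS_framing hξ hu hκ]
      field_simp
      ring
  refine ⟨fun n => ?_, fun n x y => ?_, fun n x => ?_, fun n x b _ => hfr n x b⟩
  · induction n with
    | zero => exact h0
    | succ n ih =>
      have := hfr n 1 0
      rwa [map_one, pow_zero, mul_one, ih, eSystem_zero hS, mul_one] at this
  · cases n with
    | zero => rw [hz x, smul_mul_assoc, mul_smul_comm, one_mul, mul_one]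
    | succ n => simp only [chainTrace, LinearMap.smul_apply, rho_trace hξ hu _ x y]
  · simp only [chainTrace, LinearMap.smul_apply, smul_eq_mul]
    rw [rho_markov hξ hu, pow_succ, mul_inv]
    ring

end ChainTrace

/-! ### The change of generators and the comparison of the traces -/

section Comparison

variable {K : Type} [Field K] {d : ℕ}

/-- The isomorphism `g_i ↦ r (s + (1 - s) e_i) G_i`, `t_j ↦ t_j`. -/
def changeGens (hd : (d : K) ≠ 0) {s r : K} (hs : s ≠ 0) (hr : r ≠ 0) (n : ℕ) :
    Y K d (s * r) ((s ^ 2 - 1) * r) n ≃ₐ[K] YJ K d (s ^ 2) n :=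
  AlgEquiv.ofAlgHom
    (twistHom hd r s (by ring) (by ring) (by ring) n)
    (twistHom hd r⁻¹ s⁻¹ (by field_simp) (by field_simp; ring) (by field_simp) n)
    (twistHom_comp_eq_id _ _ _ _ _ _ _ (inv_mul_cancel₀ hr) (inv_mul_cancel₀ hs))
    (twistHom_comp_eq_id _ _ _ _ _ _ _ (mul_inv_cancel₀ hr) (mul_inv_cancel₀ hs))

variable {s r : K}

theorem changeGens_gg (hd : (d : K) ≠ 0) (hs : s ≠ 0) (hr : r ≠ 0) {n : ℕ} (i : Fin (n - 1)) :
    changeGens hd hs hr n (gg i) = r • (stretch d s (tt (lft i)) (tt (rgt i)) * gg i) :=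
  twistHom_gg _ _ _ _ _

theorem changeGens_tt (hd : (d : K) ≠ 0) (hs : s ≠ 0) (hr : r ≠ 0) {n : ℕ} (j : Fin n) :
    changeGens hd hs hr n (tt j) = tt j :=
  twistHom_tt _ _ _ _ _

theorem exists_isDelta {u v : K} (hd : (d : K) ≠ 0) (hu : u ≠ 0) {γ : K} (hγ : γ ≠ 0) :
    ∃ δ : ∀ n, FramedBraid d n →* Y K d u v n, IsDelta γ δ := by
  have hd0 : d ≠ 0 := by rintro rfl; simp at hd
  have hunit : ∀ n (i : Fin (n - 1)),
      IsUnit (twist d (1 : K) γ (gg : Fin (n - 1) → Y K d u v n) tt i) := by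
    intro n i
    have hg : IsUnit (gg i : Y K d u v n) :=
      ⟨⟨_, _, (inverse_gg hu i).1, (inverse_gg hu i).2⟩, rfl⟩
    have hf := isFramed_gens (K := K) (d := d) (a := u ^ 2) (b := 0) (c := v) (n := n)
    have h := fun p p' : K => stretch_mul hd p p' (hf.tt (lft i) (rgt i)) (hf.tpow _) (hf.tpow _)
    have h1 := h γ γ⁻¹
    have h2 := h γ⁻¹ γ
    rw [mul_inv_cancel₀ hγ, stretch_one] at h1
    rw [inv_mul_cancel₀ hγ, stretch_one] at h2
    rw [twist, one_smul]
    exact IsUnit.mul ⟨⟨_, _, h1, h2⟩, rfl⟩ hg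
  refine ⟨fun n => FramedBraid.lift hd0 (isFramed_gens.twist 1 γ) (hunit n), fun n =>
    ⟨fun i => ?_, fun j => FramedBraid.lift_t _ _ _ j⟩⟩
  rw [FramedBraid.lift_g, twist, one_smul]
  rfl

/-- The comparison over an arbitrary field. Of the definition of the scalars only two consequences
matter: `D⁻¹ = r z`, which matches the Markov conditions, and `κ = D / |S|`, which matches the
framing condition. -/
theorem juyumayaTrace_parameters {ξ : Fin d → K} (hξ : IsRootFamily ξ) {z D : K}
    (hs : s ≠ 0) (hr : r ≠ 0) (hs2 : s ^ 2 ≠ 1) (hD0 : D ≠ 0) (hD : D⁻¹ = r * z)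
    {S : Finset (Fin d)} (hS : (S.card : K) ≠ 0)
    (hκ : kappa (s * r) ((s ^ 2 - 1) * r) = D / S.card) :
    ∃ θ : ∀ n, Y K d (s * r) ((s ^ 2 - 1) * r) n ≃ₐ[K] YJ K d (s ^ 2) n,
      IsChangeOfGenerators s r θ ∧
    ∃ tr : ∀ n, YJ K d (s ^ 2) n →ₗ[K] K,
      IsJuyumayaTrace (s ^ 2) z (eSystem ξ S) tr ∧
      (∀ tr', IsJuyumayaTrace (s ^ 2) z (eSystem ξ S) tr' → tr' = tr) ∧
      IsMarkovTrace (s * r) ((s ^ 2 - 1) * r) (rescaled D θ tr) ∧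
      (∀ α : (Fin d → ℕ) → K,
        HasParameters ξ (s * r) ((s ^ 2 - 1) * r) (rescaled D θ tr) α ↔
          ∀ μ ∈ Comp0 d, α μ = alphaS D S μ) ∧
      ∃ ρ : (Fin d → ℕ) → ∀ n, Y K d (s * r) ((s ^ 2 - 1) * r) n →ₗ[K] K,
        (∀ μ ∈ Comp0 d, IsMarkovTrace (s * r) ((s ^ 2 - 1) * r) (ρ μ) ∧
          HasParameters ξ (s * r) ((s ^ 2 - 1) * r) (ρ μ) (Pi.single μ 1)) ∧
        (∀ n, 1 ≤ n → ∀ x,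
          rescaled D θ tr n x = ∑ μ ∈ Comp0 d, alphaS D S μ * ρ μ n x) ∧
        ∃ (δ' : ∀ n, FramedBraid d n →* YJ K d (s ^ 2) n)
          (δ : ∀ n, FramedBraid d n →* Y K d (s * r) ((s ^ 2 - 1) * r) n),
          IsDeltaJL r δ' ∧ IsDelta s⁻¹ δ ∧
          ∀ n, 1 ≤ n → ∀ β : FramedBraid d n,
            D ^ (n - 1) * tr n (δ' n β) = ∑ μ ∈ Comp0 d, alphaS D S μ * ρ μ n (δ n β) := by
  have hd := hξ.ne_zero
  have hu : s * r ≠ 0 := mul_ne_zero hs hr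
  have hv : (s ^ 2 - 1) * r ≠ 0 := mul_ne_zero (sub_ne_zero.2 hs2) hr
  let θ := fun n => changeGens hd hs hr n
  let tr : ∀ n, YJ K d (s ^ 2) n →ₗ[K] K :=
    fun n => chainTrace (s * r) ((s ^ 2 - 1) * r) hξ D S n ∘ₗ (θ n).symm.toLinearMap
  have hcong : ∀ n, 1 ≤ n →
      rescaled D θ tr n = rho (s * r) ((s ^ 2 - 1) * r) hξ (alphaS D S) n := by
    rintro (_ | n) hn
    · omega
    · ext x
      simp [rescaled, tr, chainTrace, hD0]
  have hsum : ∀ n, 1 ≤ n → ∀ x, rescaled D θ tr n x = ∑ μ ∈ Comp0 d, alphaS D S μ *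
      rho (s * r) ((s ^ 2 - 1) * r) hξ (Pi.single μ 1) n x :=
    fun n hn x => by rw [hcong n hn, rho_eq_sum hξ _ hn]
  obtain ⟨δ, hδ⟩ := exists_isDelta (v := (s ^ 2 - 1) * r) hd hu (inv_ne_zero hs)
  have htr : IsChainTrace z (eSystem ξ S) tr := by
    have := (isChainTrace_chainTrace hξ hu hv hD0 hS hκ).comp_twistHom (a' := 1) (b' := s ^ 2 - 1)
      (c' := s ^ 2 - 1) hd (r := r⁻¹) (p := s⁻¹) (by field_simp) (by field_simp; ring)
      (by field_simp)
    rw [hD, inv_mul_cancel_left₀ hr] at this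
    exact this
  have hθ : ∀ tr', IsJuyumayaTrace (s ^ 2) z (eSystem ξ S) tr' → IsChainTrace (r * z)
      (eSystem ξ S) (fun n => tr' n ∘ₗ (θ n).toLinearMap) := fun tr' h =>
    (isJuyumayaTrace_iff.1 h).comp_twistHom hd (p := s) _ _ _
  refine ⟨θ, fun n => ⟨fun i => changeGens_gg hd hs hr i, fun j => changeGens_tt hd hs hr j⟩, tr,
    isJuyumayaTrace_iff.2 htr, fun tr' h => ?_, ?_, hasParameters_iff hξ hu hv hcong,
    fun μ => rho (s * r) ((s ^ 2 - 1) * r) hξ (Pi.single μ 1),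
    fun μ _ => ⟨isMarkovTrace_rho hξ hu hv _,
      (hasParameters_iff hξ hu hv (fun _ _ => rfl) _).2 fun _ _ => rfl⟩, hsum,
    fun n => (θ n : _ →* YJ K d (s ^ 2) n).comp (δ n), δ, fun n => ⟨fun i => ?_, fun j => ?_⟩, hδ,
    fun n hn β => ?_⟩
  · funext n
    have := IsChainTrace.unique hξ hu (hθ tr' h) (hθ tr (isJuyumayaTrace_iff.2 htr)) n
    ext x
    obtain ⟨y, rfl⟩ := (θ n).surjective x
    exact LinearMap.congr_fun this y
  · have hM := isMarkovTrace_rho (v := (s ^ 2 - 1) * r) hξ hu hv (alphaS D S)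
    refine ⟨fun n hn => ?_, fun n => ?_, fun n => ?_⟩
    · rw [hcong n hn]; exact hM.trace n hn
    · rw [hcong _ (by omega), hcong _ (by omega)]; exact hM.markov n
    · rw [hcong _ (by omega), hcong _ (by omega)]; exact hM.markov_inv n
  · have h1 : δ n (PresentedGroup.of (Gen.g i)) =
      stretch d s⁻¹ (tt (lft i)) (tt (rgt i)) * gg i := (hδ n).1 i
    have h2 : θ n (stretch d s⁻¹ (tt (lft i)) (tt (rgt i)) * gg i) = r • gg i := by
      rw [map_mul, changeGens_gg]
      have h3 := map_stretch (d := d) (θ n).toAlgHom s⁻¹ (tt (lft i)) (tt (rgt i))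
      have h4 : ∀ j, (θ n).toAlgHom (tt j) = tt j := changeGens_tt hd hs hr
      rw [h4, h4] at h3
      have h5 : θ n (stretch d s⁻¹ (tt (lft i)) (tt (rgt i))) =
        stretch d s⁻¹ (tt (lft i)) (tt (rgt i)) := h3
      rw [h5, mul_smul_comm, ← mul_assoc, stretch_mul hd _ _ (commute_tt _ _)
        (isFramed_gens.tpow _) (isFramed_gens.tpow _), inv_mul_cancel₀ hs, stretch_one, one_mul]
    exact (congrArg (θ n) h1).trans h2
  · exact (congrArg (θ n) ((hδ n).2 j)).trans (changeGens_tt hd hs hr j)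
  · exact hsum n hn (δ n β)

end Comparison

/-! ### The scalars in `k_S` -/

section Scalars

variable {d : ℕ}

theorem sqrtQ_ne_zero : sqrtQ ≠ 0 := by
  rw [sqrtQ, Ne, FaithfulSMul.algebraMap_eq_zero_iff]
  exact MvPolynomial.X_ne_zero 0

theorem zVar_ne_zero : zVar ≠ 0 := by
  rw [zVar, Ne, FaithfulSMul.algebraMap_eq_zero_iff]
  exact MvPolynomial.X_ne_zero 1

/-- An identity between polynomials in `√q` and `z` holds at all complex numbers. -/
theorem eval_eq_zero_of_algebraMap {p : MvPolynomial (Fin 2) ℂ}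
    (h : algebraMap (MvPolynomial (Fin 2) ℂ) kField p = 0) (x : Fin 2 → ℂ) :
    MvPolynomial.eval x p = 0 := by
  rw [FaithfulSMul.algebraMap_eq_zero_iff] at h
  rw [h, map_zero]

theorem sqrtQ_sq_ne_one : sqrtQ ^ 2 ≠ 1 := by
  intro h
  have := eval_eq_zero_of_algebraMap (p := MvPolynomial.X 0 ^ 2 - 1)
    (by rw [map_sub, map_pow, map_one, sub_eq_zero]; exact h) 0
  simp at this

theorem lam_ne_zero (m : ℕ) : lam m ≠ 0 := by
  rw [lam]
  refine div_ne_zero (fun h => ?_) (mul_ne_zero (pow_ne_zero 2 sqrtQ_ne_zero) zVar_ne_zero)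
  have := eval_eq_zero_of_algebraMap
    (p := MvPolynomial.X 1 + (1 - MvPolynomial.X 0 ^ 2) * MvPolynomial.C (1 / (m : ℂ)))
    (by
      rw [map_add, map_mul, map_sub, map_pow, map_one, ← MvPolynomial.algebraMap_eq,
        ← IsScalarTower.algebraMap_apply, map_div₀, map_one, map_natCast]
      exact h) ![1, 1]
  simp at this

/-- The `d`-th roots of unity have vanishing power sums. -/
theorem sum_pow_eq_zero {ξ : Fin d → ℂ} (hξ : Function.Injective ξ)
    (hξd : Set.range ξ = {x : ℂ | x ^ d = 1}) {s : ℕ} (h0 : 0 < s) (hs : s < d) :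
    ∑ a, ξ a ^ s = 0 := by
  have hprim := Complex.isPrimitiveRoot_exp d (by omega)
  set ζ := Complex.exp (2 * Real.pi * Complex.I / d)
  have hmem : ∀ a, ξ a ^ d = 1 := fun a => by
    have : ξ a ∈ Set.range ξ := ⟨a, rfl⟩
    rwa [hξd] at this
  -- Multiplication by a primitive root permutes the roots, so it fixes the power sum.
  have hmul : ζ ^ s * ∑ a, ξ a ^ s = ∑ a, ξ a ^ s := by
    have hex : ∀ a, ∃ b, ξ b = ζ * ξ a := fun a => by
      have : ζ * ξ a ∈ Set.range ξ := by
        rw [hξd, Set.mem_ofPred_eq, mul_pow, hprim.pow_eq_one, hmem, one_mul]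
      exact this
    choose σ hσ using hex
    have hinj : Function.Injective σ := fun a b hab => by
      have : ζ * ξ a = ζ * ξ b := by rw [← hσ, ← hσ, hab]
      exact hξ (mul_left_cancel₀ (hprim.ne_zero (by omega)) this)
    rw [Finset.mul_sum, ← (Finite.injective_iff_bijective.1 hinj).sum_comp fun a => ξ a ^ s]
    exact Finset.sum_congr rfl fun a _ => by rw [hσ, mul_pow]
  have hne := hprim.pow_ne_one_of_pos_of_lt h0.ne' hs
  by_contra hc
  exact hne (mul_right_cancel₀ hc (by rw [hmul, one_mul]))

theorem isRootFamily_map {L : Type} [Field L] [Algebra ℂ L] (hd : d ≠ 0) {ξ : Fin d → ℂ}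
    (hξ : Function.Injective ξ) (hξd : Set.range ξ = {x : ℂ | x ^ d = 1}) :
    IsRootFamily fun a => algebraMap ℂ L (ξ a) where
  ne_zero := by
    rw [← map_natCast (algebraMap ℂ L), Ne, FaithfulSMul.algebraMap_eq_zero_iff]
    exact_mod_cast hd
  inj := (algebraMap ℂ L).injective.comp hξ
  pow a := by
    have : ξ a ∈ Set.range ξ := ⟨a, rfl⟩
    rw [hξd] at this
    rw [← map_pow, this, map_one]
  sum s h0 hs := by
    simp only [← map_pow]
    rw [← map_sum, sum_pow_eq_zero hξ hξd h0 hs, map_zero]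

/-- The normalization `D_S` is such that a vertical strand contributes the factor `D_S / |S|` to the
normalized Markov traces of the Hecke algebras. -/
theorem kappa_eq {L : Type} [Field L] {s z r m : L} (hs : s ≠ 0) (hz : z ≠ 0) (hr : r ≠ 0)
    (hm : m ≠ 0) (hs2 : s ^ 2 ≠ 1)
    (h : r ^ 2 = (z + (1 - s ^ 2) * (1 / m)) / (s ^ 2 * z)) :
    kappa (s * r) ((s ^ 2 - 1) * r) = 1 / (r * z) / m := by
  have hs3 : s ^ 2 - 1 ≠ 0 := sub_ne_zero.2 hs2
  rw [kappa, mul_pow, h]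
  field_simp
  ring

end Scalars

end JL

end

theorem proposition6p8 (d : ℕ) (ξ : Fin d → ℂ) (hξ : Function.Injective ξ)
    (hξd : Set.range ξ = {x : ℂ | x ^ d = 1}) (S : Finset (Fin d)) (hS : S.Nonempty)
    (s z r D : JL.kS S.card)
    (hs : s = algebraMap JL.kField (JL.kS S.card) JL.sqrtQ)
    (hz : z = algebraMap JL.kField (JL.kS S.card) JL.zVar)
    (hr : r ^ 2 = algebraMap JL.kField (JL.kS S.card) (JL.lam S.card))
    (hD : D = 1 / (r * z))
    (ξ' : Fin d → JL.kS S.card)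
    (hξ' : ∀ a, ξ' a = algebraMap ℂ (JL.kS S.card) (ξ a)) :
    ∃ θ : ∀ n, JL.Y (JL.kS S.card) d (s * r) ((s ^ 2 - 1) * r) n
        ≃ₐ[JL.kS S.card] JL.YJ (JL.kS S.card) d (s ^ 2) n,
      JL.IsChangeOfGenerators s r θ ∧
    ∃ tr : ∀ n, JL.YJ (JL.kS S.card) d (s ^ 2) n →ₗ[JL.kS S.card] JL.kS S.card,
      JL.IsJuyumayaTrace (s ^ 2) z (JL.eSystem ξ' S) tr ∧
      (∀ tr', JL.IsJuyumayaTrace (s ^ 2) z (JL.eSystem ξ' S) tr' → tr' = tr) ∧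
      -- the rescaled trace is a Markov trace
      JL.IsMarkovTrace (s * r) ((s ^ 2 - 1) * r) (JL.rescaled D θ tr) ∧
      -- its parameters
      (∀ α : (Fin d → ℕ) → JL.kS S.card,
        JL.HasParameters ξ' (s * r) ((s ^ 2 - 1) * r) (JL.rescaled D θ tr) α ↔
          ∀ μ ∈ JL.Comp0 d, α μ = JL.alphaS D S μ) ∧
      -- the expression of the trace and of the invariants in the basis of Markov traces
      ∃ ρ : (Fin d → ℕ) →
          ∀ n, JL.Y (JL.kS S.card) d (s * r) ((s ^ 2 - 1) * r) n →ₗ[JL.kS S.card] JL.kS S.card,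
        (∀ μ ∈ JL.Comp0 d, JL.IsMarkovTrace (s * r) ((s ^ 2 - 1) * r) (ρ μ) ∧
          JL.HasParameters ξ' (s * r) ((s ^ 2 - 1) * r) (ρ μ) (Pi.single μ 1)) ∧
        (∀ n, 1 ≤ n → ∀ x,
          JL.rescaled D θ tr n x = ∑ μ ∈ JL.Comp0 d, JL.alphaS D S μ * ρ μ n x) ∧
        ∃ (δ' : ∀ n, JL.FramedBraid d n →* JL.YJ (JL.kS S.card) d (s ^ 2) n)
          (δ : ∀ n, JL.FramedBraid d n →* JL.Y (JL.kS S.card) d (s * r) ((s ^ 2 - 1) * r) n),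
          JL.IsDeltaJL r δ' ∧ JL.IsDelta s⁻¹ δ ∧
          ∀ n, 1 ≤ n → ∀ β : JL.FramedBraid d n,
            D ^ (n - 1) * tr n (δ' n β) =
              ∑ μ ∈ JL.Comp0 d, JL.alphaS D S μ * ρ μ n (δ n β) := by
  have hsz : s ≠ 0 := by rw [hs]; exact (map_ne_zero _).2 JL.sqrtQ_ne_zero
  have hzz : z ≠ 0 := by rw [hz]; exact (map_ne_zero _).2 JL.zVar_ne_zero
  have hrz : r ≠ 0 := fun h => (map_ne_zero _).2 (JL.lam_ne_zero S.card) (by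
    rw [← hr, h]; exact zero_pow two_ne_zero)
  have hs2 : s ^ 2 ≠ 1 := by
    rw [hs, ← map_pow, ← map_one (algebraMap JL.kField (JL.kS S.card))]
    exact fun h => JL.sqrtQ_sq_ne_one ((algebraMap JL.kField (JL.kS S.card)).injective h)
  have hd : d ≠ 0 := by
    rintro rfl
    exact hS.ne_empty (Finset.eq_empty_of_isEmpty S)
  have hm : (S.card : JL.kS S.card) ≠ 0 := by
    rw [← map_natCast (algebraMap ℂ (JL.kS S.card))]
    exact (map_ne_zero _).2 (Nat.cast_ne_zero.2 hS.card_ne_zero)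
  obtain rfl : ξ' = fun a => algebraMap ℂ (JL.kS S.card) (ξ a) := funext hξ'
  refine JL.juyumayaTrace_parameters (JL.isRootFamily_map hd hξ hξd) hsz hrz hs2 ?_ ?_ hm ?_
  · rw [hD]; exact one_div_ne_zero (mul_ne_zero hrz hzz)
  · rw [hD, one_div, inv_inv]
  · rw [hD]
    refine JL.kappa_eq hsz hzz hrz hm hs2 ?_
    refine hr.trans (Eq.trans (b := algebraMap JL.kField (JL.kS S.card)
      ((JL.zVar + (1 - JL.sqrtQ ^ 2) * (1 / (S.card : JL.kField))) /
        (JL.sqrtQ ^ 2 * JL.zVar))) rfl ?_)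
    rw [hs, hz]
    simp only [map_div₀, map_add, map_mul, map_sub, map_one, map_pow, map_natCast]
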